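/- **Conventions.** A *compact foliation* $(M,\mathcal F)$ is a compact smooth manifold $M$ without boundary with a smooth foliation $\mathcal F$. Its *holonomy groupoid* $G_M$, with source $s$, range $r$ and unit map $u:M\to G_M$, consists of the holonomy classes of leafwise paths, with its usual (possibly non-Hausdorff) smooth structure; for $A,B\subseteq M$ put $G_A^B=s^{-1}(A)\cap r^{-1}(B)$. A *smooth map of leaf spaces* $f:M_1/\mathcal F_1\to M_2/\mathcal F_2$ consists of an open cover $\{\Omega_\alpha\}_{\alpha\in I}$ of $M_1$ and smooth maps $f_{\alpha\beta}:(G_{M_1})_{\Omega_\beta}^{\Omega_\alpha}\to G_{M_2}$ with $f_{\beta\alpha}(\gamma^{-1})=f_{\alpha\beta}(\gamma)^{-1}$ and such that, for $\gamma_1\in (G_{M_1})_{\Omega_{\beta}}^{\Omega_\alpha}$ and $\gamma_2\in (G_{M_1})_{\Omega_{\delta}}^{\Omega_\beta}$ with $s(\gamma_1)=r(\gamma_2)$, one has $s(f_{\alpha\beta}(\gamma_1))=r(f_{\beta\delta}(\gamma_2))$ and $f_{\alpha\beta}(\gamma_1)f_{\beta\delta}(\gamma_2)=f_{\alpha\delta}(\gamma_1\gamma_2)$.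 Write $f_\alpha=r\circ f_{\alpha\alpha}\circ u|_{\Omega_\alpha}:\Omega_\alpha\to M_2$. Two such maps, with index sets $I$ and $I'$, are *equivalent* if they are the restrictions to $I$ and to $I'$ of a third one with index set $I\,\dot\cup\, I'$. The identity of $M/\mathcal F$ is given by the cover $\{M\}$ and $\mathrm{id}_{G_M}$; the composition of $f$ with $g=(\{\Theta_\xi\},\{g_{\xi\zeta}\})$ is given by the cover $\{f_\alpha^{-1}(\Theta_\xi)\}_{(\alpha,\xi)}$ and the maps $g_{\xi\zeta}\circ f_{\alpha\beta}$. For a Riemannian metric $g_M$ on $M$ with component $g_N$ normal to $\mathcal F$, the *foliated cone* $\mathcal O(M,\mathcal F)$ is $[0,\infty)\times M$ with the Riemannian metric $dt^2+g_M+t^2g_N$, and with the coarse structure whose entourages are the sets of pairs of points of bounded Riemannian distance (the distance of points in different components is $\infty$). A *metrizable coarse space* is a topological space with a coarse structure such that both are induced by one proper metric, where the value $\infty$ is allowed. A *coarse Borel map* is a Borel map which maps entourages to entourages and for which the preimages of relatively compact sets are relatively compact. Two coarse Borel maps $F,F':X\to Y$ are *coarsely equivalent* if $\{(F(x),F'(x))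 : x\in X\}$ is an entourage of $Y$. A map $F:[0,\infty)\times M_1\to[0,\infty)\times M_2$ is *induced* by $f$ if $F(t,x)=(t,f_{\alpha(i(x))}(x))$ for some finite family of open sets $U_1,\dots,U_m\subseteq M_1$, indices $\alpha(1),\dots,\alpha(m)\in I$ with $\overline{U_k}\subseteq\Omega_{\alpha(k)}$ for all $k$, and a Borel map $i:M_1\to\{1,\dots,m\}$ with $x\in U_{i(x)}$ for all $x$. **Theorem.** The foliated cone construction is a functor from the category of compact foliations and equivalence classes of smooth maps of leaf spaces to the category of metrizable coarse spaces and coarse equivalence classes of coarse Borel maps. In detail: 1. Equivalence of smooth maps of leaf spaces is an equivalence relation. 2. The coarse space $\mathcal O(M,\mathcal F)$ does not depend on the metric $g_M$: any two Riemannian metrics on $M$ give the same coarse structure on $[0,\infty)\times M$. If $M$ is connected, then the Riemannian distance on the cone is finite. 3. Every smooth map of leaf spaces induces at least one map of cones. 4. For every choice of a Riemannian metric on each compact foliation there is a functor which maps $(M,\mathcal F)$ to $\mathcal O(M,\mathcal F)$, which is a metrizable coarse space, and which maps the class of $f:M_1/\mathcal F_1\to M_2/\mathcal F_2$ to the coarse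 equivalence class of every map $F:\mathcal O(M_1,\mathcal F_1)\to\mathcal O(M_2,\mathcal F_2)$ induced by $f$; in particular every such $F$ is a coarse Borel map. -/

import Mathlib

open CategoryTheory Set Filter Topology Manifold Bundle
open scoped ContDiff ENNReal NNReal
universe u

/-! ### Coarse spaces -/

/-- A coarse structure on a set. -/
@[ext] structure CoarseStructure (X : Type u) where
  entourages : Set (Set (X × X))
  diag_mem : {p : X × X | p.1 = p.2} ∈ entourages
  subset_mem : ∀ E E', E ∈ entourages → E' ⊆ E → E' ∈ entourages
  union_mem : ∀ E E', E ∈ entourages → E' ∈ entourages → E ∪ E' ∈ entourages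
  inv_mem : ∀ E, E ∈ entourages → {p : X × X | (p.2, p.1) ∈ E} ∈ entourages
  comp_mem : ∀ E E', E ∈ entourages → E' ∈ entourages →
    {p : X × X | ∃ y, (p.1, y) ∈ E ∧ (y, p.2) ∈ E'} ∈ entourages

/-- A topological space with a coarse structure. -/
structure CoarseSpace : Type (u + 1) where
  carrier : Type u
  [top : TopologicalSpace carrier]
  coarse : CoarseStructure carrier

namespace CoarseSpace

instance : CoeSort CoarseSpace.{u} (Type u) := ⟨carrier⟩

attribute [instance] top

/-- Coarse Borel maps: Borel maps which map entourages to entourages and are proper in the sense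
that the preimages of relatively compact sets are relatively compact. -/
def IsCoarseBorel (X Y : CoarseSpace.{u}) (f : X → Y) : Prop :=
  @Measurable X Y (borel X) (borel Y) f ∧
    (∀ E ∈ X.coarse.entourages, Prod.map f f '' E ∈ Y.coarse.entourages) ∧
    ∀ K : Set Y, IsCompact (closure K) → IsCompact (closure (f ⁻¹' K))

/-- Coarse equivalence (closeness) of coarse Borel maps. -/
instance setoid (X Y : CoarseSpace.{u}) : Setoid {f : X → Y // IsCoarseBorel X Y f} where
  r f g := range (fun x => (f.1 x, g.1 x)) ∈ Y.coarse.entourages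
  iseqv :=
    { refl := fun f => Y.coarse.subset_mem _ _ Y.coarse.diag_mem (by rintro _ ⟨x, rfl⟩; rfl)
      symm := fun h => Y.coarse.subset_mem _ _ (Y.coarse.inv_mem _ h)
        (by rintro _ ⟨x, rfl⟩; exact ⟨x, rfl⟩)
      trans := fun {_ g _} h h' => Y.coarse.subset_mem _ _ (Y.coarse.comp_mem _ _ h h')
        (by rintro _ ⟨x, rfl⟩; exact ⟨g.1 x, ⟨x, rfl⟩, ⟨x, rfl⟩⟩) }

theorem isCoarseBorel_id (X : CoarseSpace.{u}) : IsCoarseBorel X X id :=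
  ⟨@measurable_id _ (borel X), fun E hE => by simpa using hE, fun _ h => h⟩

theorem IsCoarseBorel.comp {X Y Z : CoarseSpace.{u}} {g : Y → Z} {f : X → Y}
    (hg : IsCoarseBorel Y Z g) (hf : IsCoarseBorel X Y f) : IsCoarseBorel X Z (g ∘ f) := by
  refine ⟨@Measurable.comp _ _ _ (borel X) (borel Y) (borel Z) _ _ hg.1 hf.1, fun E hE => ?_,
    fun K hK => hf.2.2 _ (hg.2.2 _ hK)⟩
  have h := hg.2.1 _ (hf.2.1 _ hE)
  rwa [image_image] at h

/-- The category of coarse spaces and coarse equivalence classes of coarse Borel maps. -/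
instance : Category.{u} CoarseSpace.{u} where
  Hom X Y := Quotient (setoid X Y)
  id X := Quotient.mk _ ⟨id, isCoarseBorel_id X⟩
  comp {X Y Z} := Quotient.map₂ (fun f g => ⟨g.1 ∘ f.1, g.2.comp f.2⟩) (by
    intro f f' hf g g' hg
    refine Z.coarse.subset_mem _ _ (Z.coarse.comp_mem _ _ (g.2.2.1 _ hf) hg) ?_
    rintro _ ⟨x, rfl⟩
    exact ⟨g.1 (f'.1 x), ⟨_, ⟨x, rfl⟩, rfl⟩, ⟨f'.1 x, rfl⟩⟩)
  id_comp := by rintro X Y ⟨f⟩; rfl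
  comp_id := by rintro X Y ⟨f⟩; rfl
  assoc := by rintro X Y Z W ⟨f⟩ ⟨g⟩ ⟨h⟩; rfl

/-- The morphism represented by a coarse Borel map. -/
def toHom {X Y : CoarseSpace.{u}} (f : X → Y) (hf : IsCoarseBorel X Y f) : X ⟶ Y :=
  Quotient.mk (setoid X Y) ⟨f, hf⟩

/-- A coarse space is metrizable if its topology and its coarse structure are induced by a proper
metric. As usual in coarse geometry, points may have infinite distance. -/
def IsMetrizable : ObjectProperty CoarseSpace.{u} := fun X =>
  ∃ d : EMetricSpace X, d.toUniformSpace.toTopologicalSpace = X.top ∧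
    (∀ E : Set (X × X), E ∈ X.coarse.entourages ↔ ∃ R : ℝ≥0, ∀ p ∈ E, edist p.1 p.2 ≤ R) ∧
    ∀ (x : X) (R : ℝ≥0), IsCompact {y : X | edist y x ≤ R}

end CoarseSpace

/-- The category of metrizable coarse spaces and coarse equivalence classes of coarse Borel maps. -/
abbrev MetrizableCoarseSpace : Type (u + 1) := CoarseSpace.IsMetrizable.{u}.FullSubcategory

/-! ### Linear algebra -/

theorem isCompl_orthogonalBilin {E : Type*} [NormedAddCommGroup E] [NormedSpace ℝ E]
    [FiniteDimensional ℝ E] (b : E →L[ℝ] E →L[ℝ] ℝ) (hs : ∀ v w, b v w = b w v)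
    (hp : ∀ v, v ≠ 0 → 0 < b v v) (W : Submodule ℝ E) :
    IsCompl (W.orthogonalBilin b.toLinearMap₁₂) W := by
  have hr : LinearMap.IsRefl b.toLinearMap₁₂ := fun v w h => (hs w v).trans h
  refine ((LinearMap.BilinForm.isCompl_orthogonal_iff_disjoint
    (B := b.toLinearMap₁₂) hr (W := W)).2 ?_).symm
  rw [Submodule.disjoint_def]
  intro v hv hv'
  by_contra h
  exact (hp v h).ne' (hv' v hv)

/-- The orthogonal projection, with respect to the scalar product `b`, of `E` onto the orthogonal
complement of the subspace `W`. -/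
noncomputable def normalProjection {E : Type*} [NormedAddCommGroup E] [NormedSpace ℝ E]
    [FiniteDimensional ℝ E] (b : E →L[ℝ] E →L[ℝ] ℝ) (hs : ∀ v w, b v w = b w v)
    (hp : ∀ v, v ≠ 0 → 0 < b v v) (W : Submodule ℝ E) : E →L[ℝ] E :=
  LinearMap.toContinuousLinearMap (Submodule.projection (W.orthogonalBilin b.toLinearMap₁₂) W
    (isCompl_orthogonalBilin b hs hp W))

/-- The bilinear form `(λ, v), (μ, w) ↦ λ μ + b (v, w) + t² b (P v, P w)` on `ℝ × E`. -/
noncomputable def coneForm {E : Type*} [NormedAddCommGroup E] [NormedSpace ℝ E]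
    (b : E →L[ℝ] E →L[ℝ] ℝ) (P : E →L[ℝ] E) (t : ℝ) :
    (EuclideanSpace ℝ (Fin 1) × E) →L[ℝ] (EuclideanSpace ℝ (Fin 1) × E) →L[ℝ] ℝ :=
  let dt : (EuclideanSpace ℝ (Fin 1) × E) →L[ℝ] ℝ :=
    (EuclideanSpace.proj (𝕜 := ℝ) (0 : Fin 1)).comp
      (ContinuousLinearMap.fst ℝ (EuclideanSpace ℝ (Fin 1)) E)
  let pr : (EuclideanSpace ℝ (Fin 1) × E) →L[ℝ] E :=
    ContinuousLinearMap.snd ℝ (EuclideanSpace ℝ (Fin 1)) E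
  (ContinuousLinearMap.mul ℝ ℝ).bilinearComp dt dt + b.bilinearComp pr pr +
    t ^ 2 • b.bilinearComp (P.comp pr) (P.comp pr)

theorem coneForm_apply {E : Type*} [NormedAddCommGroup E] [NormedSpace ℝ E]
    (b : E →L[ℝ] E →L[ℝ] ℝ) (P : E →L[ℝ] E) (t : ℝ)
    (v w : EuclideanSpace ℝ (Fin 1) × E) :
    coneForm b P t v w = v.1 0 * w.1 0 + b v.2 w.2 + t ^ 2 * b (P v.2) (P w.2) := by
  simp [coneForm]

theorem nonneg_of_pos_form {E : Type*} [NormedAddCommGroup E] [NormedSpace ℝ E]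
    (b : E →L[ℝ] E →L[ℝ] ℝ) (hp : ∀ v, v ≠ 0 → 0 < b v v) (v : E) :
    0 ≤ b v v := by
  rcases eq_or_ne v 0 with rfl | h
  · simp
  · exact (hp v h).le

theorem coneForm_pos {E : Type*} [NormedAddCommGroup E] [NormedSpace ℝ E]
    (b : E →L[ℝ] E →L[ℝ] ℝ) (P : E →L[ℝ] E) (t : ℝ)
    (hp : ∀ v, v ≠ 0 → 0 < b v v) (v : EuclideanSpace ℝ (Fin 1) × E) (hv : v ≠ 0) :
    0 < coneForm b P t v v := by
  rw [coneForm_apply]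
  have h2 := mul_nonneg (sq_nonneg t) (nonneg_of_pos_form b hp (P v.2))
  by_cases h : v.2 = 0
  · have h1 : v.1 0 ≠ 0 := by
      intro h1
      refine hv (Prod.ext ?_ h)
      ext i
      rw [Subsingleton.elim i 0]
      simpa using h1
    have h3 := nonneg_of_pos_form b hp v.2
    have h4 := mul_self_pos.2 h1
    linarith
  · have h3 := hp v.2 h
    have h4 := mul_self_nonneg (v.1 0)
    linarith

theorem isVonNBounded_coneForm {E : Type*} [NormedAddCommGroup E] [NormedSpace ℝ E]
    (b : E →L[ℝ] E →L[ℝ] ℝ) (P : E →L[ℝ] E) (t : ℝ)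
    (hp : ∀ v, v ≠ 0 → 0 < b v v) (hb : Bornology.IsVonNBounded ℝ {v : E | b v v < 1}) :
    Bornology.IsVonNBounded ℝ {v : EuclideanSpace ℝ (Fin 1) × E | coneForm b P t v v < 1} := by
  have h0 := nonneg_of_pos_form b hp
  rw [NormedSpace.isVonNBounded_iff] at hb ⊢
  refine ((Metric.isBounded_closedBall (x := (0 : EuclideanSpace ℝ (Fin 1))) (r := 1)).prod
    hb).subset fun v hv => ?_
  simp only [mem_ofPred_eq, coneForm_apply] at hv
  have h1 := h0 v.2
  have h2 := mul_nonneg (sq_nonneg t) (h0 (P v.2))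
  refine ⟨?_, ?_⟩
  · rw [mem_closedBall_zero_iff, EuclideanSpace.norm_eq]
    simp only [Fin.sum_univ_one, Fin.isValue, Real.norm_eq_abs, sq_abs]
    exact Real.sqrt_le_one.2 (by nlinarith)
  · simp only [mem_ofPred_eq]
    nlinarith [mul_self_nonneg (v.1 0)]

/-! ### Compact foliations and their foliated cones -/

/-- A compact smooth manifold without boundary with a smooth foliation of dimension `p` and
codimension `q`. The charts, with values in `ℝ^p × ℝ^q`, are the charts of a foliated atlas: the
coordinate changes are smooth, and locally the transverse (second) coordinate of one chart is a
function of the transverse coordinate of the other one. -/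
structure CompactFoliation : Type (u + 1) where
  p : ℕ
  q : ℕ
  carrier : Type u
  [top : TopologicalSpace carrier]
  [t2 : T2Space carrier]
  [compact : CompactSpace carrier]
  [charted : ChartedSpace (EuclideanSpace ℝ (Fin p) × EuclideanSpace ℝ (Fin q)) carrier]
  [smooth : IsManifold 𝓘(ℝ, EuclideanSpace ℝ (Fin p) × EuclideanSpace ℝ (Fin q)) ∞ carrier]
  foliated : ∀ φ ∈ atlas (EuclideanSpace ℝ (Fin p) × EuclideanSpace ℝ (Fin q)) carrier,
    ∀ ψ ∈ atlas (EuclideanSpace ℝ (Fin p) × EuclideanSpace ℝ (Fin q)) carrier,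
    ∀ x ∈ φ.source ∩ ψ.source, ∃ k : EuclideanSpace ℝ (Fin q) → EuclideanSpace ℝ (Fin q),
      ∀ᶠ y in 𝓝 x, (ψ y).2 = k (φ y).2

namespace CompactFoliation

instance : CoeSort CompactFoliation.{u} (Type u) := ⟨carrier⟩

attribute [instance] top t2 compact charted smooth

variable (M : CompactFoliation.{u})

/-- The transverse model space `ℝ^q`. -/
abbrev Trans : Type := EuclideanSpace ℝ (Fin M.q)
/-- The longitudinal model space `ℝ^p`. -/
abbrev Plaque : Type := EuclideanSpace ℝ (Fin M.p)
/-- The model space `ℝ^p × ℝ^q`. -/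
abbrev Model : Type := M.Plaque × M.Trans
/-- The model of `M` as a manifold without boundary. -/
noncomputable abbrev I : ModelWithCorners ℝ M.Model M.Model := 𝓘(ℝ, M.Model)

/-- The tangent space of the leaf through `x`. The tangent space of `M` at `x` is identified with
`ℝ^p × ℝ^q` by the preferred chart at `x`, which is a foliation chart. -/
noncomputable def leafTangent (x : M) : Submodule ℝ (TangentSpace M.I x) :=
  LinearMap.ker (LinearMap.snd ℝ M.Plaque M.Trans)

/-- Smooth Riemannian metrics on `M`. -/
abbrev Metric : Type u :=
  ContMDiffRiemannianMetric M.I ∞ M.Model (fun x : M => TangentSpace M.I x)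

/-- The underlying manifold with boundary `[0, ∞) × M` of the cone. -/
abbrev Cone : Type u := EuclideanHalfSpace 1 × M

/-- The model of `[0, ∞) × M` as a manifold with boundary. -/
noncomputable abbrev coneI :
    ModelWithCorners ℝ (EuclideanSpace ℝ (Fin 1) × M.Model) (ModelProd (EuclideanHalfSpace 1) M.Model) :=
  (𝓡∂ 1).prod M.I

variable {M}

/-- The orthogonal projection of the tangent space at `x` onto the normal space of the foliation. -/
noncomputable def normalProj (g : M.Metric) (x : M) : M.Model →L[ℝ] M.Model :=
  normalProjection (g.inner x) (g.symm x) (g.pos x) (M.leafTangent x)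

/-- The Riemannian metric `dt² + g + t² g_N` on `[0, ∞) × M`, where `g_N` is the normal component
of `g`. -/
noncomputable def coneMetric (g : M.Metric) :
    RiemannianMetric (fun z : M.Cone => TangentSpace M.coneI z) where
  inner z := coneForm (E := M.Model) (g.inner z.2) (normalProj g z.2) (z.1.1 0)
  symm z v w := by
    have h := g.symm z.2
    refine (coneForm_apply _ _ _ _ _).trans (Eq.trans ?_ (coneForm_apply _ _ _ _ _).symm)
    exact congrArg₂ _ (congrArg₂ _ (mul_comm _ _) (h _ _)) (congrArg _ (h _ _))
  pos z v hv := coneForm_pos (E := M.Model) _ _ _ (g.pos z.2) v hv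
  continuousAt z := by
    refine Continuous.continuousAt ?_
    exact (coneForm (E := M.Model) (g.inner z.2) (normalProj g z.2) (z.1.1 0)).continuous.clm_apply
      continuous_id
  isVonNBounded z :=
    isVonNBounded_coneForm (E := M.Model) _ _ _ (g.pos z.2) (g.isVonNBounded z.2)

/-- The Riemannian distance on the cone: the infimum of the lengths of `C^1` paths, with value `∞` if
there are none. -/
noncomputable def coneEDist (g : M.Metric) (z z' : M.Cone) : ℝ≥0∞ :=
  letI : RiemannianBundle (fun z : M.Cone => TangentSpace M.coneI z) := ⟨coneMetric g⟩
  riemannianEDist M.coneI z z'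

theorem coneEDist_self (g : M.Metric) (z : M.Cone) : coneEDist g z z = 0 :=
  letI : RiemannianBundle (fun z : M.Cone => TangentSpace M.coneI z) := ⟨coneMetric g⟩
  riemannianEDist_self

theorem coneEDist_comm (g : M.Metric) (z z' : M.Cone) : coneEDist g z z' = coneEDist g z' z :=
  letI : RiemannianBundle (fun z : M.Cone => TangentSpace M.coneI z) := ⟨coneMetric g⟩
  riemannianEDist_comm

theorem coneEDist_triangle (g : M.Metric) (z z' z'' : M.Cone) :
    coneEDist g z z'' ≤ coneEDist g z z' + coneEDist g z' z'' :=
  letI : RiemannianBundle (fun z : M.Cone => TangentSpace M.coneI z) := ⟨coneMetric g⟩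
  riemannianEDist_triangle

/-! ### The holonomy groupoid -/

/-- The transverse coordinate `M → ℝ^q` of the preferred foliation chart at `x`
(meaningful near `x`). -/
noncomputable def trans (x : M) : M → M.Trans := fun y => (chartAt M.Model x y).2

/-- `f` is, near `x`, a function of the transverse coordinate alone, that is, constant on the
plaques near `x`. -/
def IsBasicAt (f : M → M.Trans) (x : M) : Prop :=
  ∃ k : M.Trans → M.Trans, f =ᶠ[𝓝 x] fun y => k (trans x y)

/-- The path `c` is smooth on `s` and its velocity is tangent to the foliation. -/
def IsLeafwiseOn (c : ℝ → M) (s : Set ℝ) : Prop :=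
  ContMDiffOn 𝓘(ℝ, ℝ) M.I ∞ c s ∧
    ∀ t ∈ s, mfderivWithin 𝓘(ℝ, ℝ) M.I c s t (1 : ℝ) ∈ M.leafTangent (c t)

/-- Leafwise paths, parametrized by `[0, 1]`: continuous, and smooth and tangent to the foliation on
every closed subinterval whose interior misses a certain finite set of break points. -/
def IsLeafwisePath (c : ℝ → M) : Prop :=
  ContinuousOn c (Icc 0 1) ∧ ∃ S : Set ℝ, S.Finite ∧
    ∀ a b : ℝ, 0 ≤ a → a < b → b ≤ 1 → Disjoint S (Ioo a b) → IsLeafwiseOn c (Icc a b)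

/-- A continuation along `c`: a family of germs at the points `c t` of functions which are constant
on plaques, such that nearby members of the family are germs of one and the same function.
This is what one gets by following the plaques along `c`. -/
def IsContinuation (c : ℝ → M) (σ : ℝ → M → M.Trans) : Prop :=
  ∀ t ∈ Icc (0 : ℝ) 1, IsBasicAt (σ t) (c t) ∧
    ∀ᶠ s in 𝓝[Icc 0 1] t, σ s =ᶠ[𝓝 (c s)] σ t

/-- The local diffeomorphism `e` of `ℝ^q` represents the holonomy of the leafwise path `c` with
respect to the foliation charts `φ` at `c 0` and `ψ` at `c 1`: the plaque of `φ` with transverse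
coordinate `w` is connected, along leafwise paths which stay close to `c`, to the plaque of `ψ`
with transverse coordinate `e w`. -/
def IsHolonomy (φ ψ : OpenPartialHomeomorph M M.Model) (c : ℝ → M)
    (e : OpenPartialHomeomorph M.Trans M.Trans) : Prop :=
  e ∈ contDiffGroupoid ∞ 𝓘(ℝ, M.Trans) ∧ (φ (c 0)).2 ∈ e.source ∧ e (φ (c 0)).2 = (ψ (c 1)).2 ∧
    ∃ σ : ℝ → M → M.Trans, IsContinuation c σ ∧
      (σ 0 =ᶠ[𝓝 (c 0)] fun y => e (φ y).2) ∧ σ 1 =ᶠ[𝓝 (c 1)] fun y => (ψ y).2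

theorem IsLeafwiseOn.congr {c c' : ℝ → M} {s : Set ℝ} (h : IsLeafwiseOn c s)
    (hc : ∀ t ∈ s, c' t = c t) : IsLeafwiseOn c' s := by
  refine ⟨h.1.congr hc, fun t ht => ?_⟩
  have h1 := h.2 t ht
  have h2 := mfderivWithin_congr (I := 𝓘(ℝ, ℝ)) (I' := M.I) (x := t) hc (hc t ht)
  change ((mfderivWithin 𝓘(ℝ, ℝ) M.I c' s t (1 : ℝ) : M.Model)).2 = 0
  change ((mfderivWithin 𝓘(ℝ, ℝ) M.I c s t (1 : ℝ) : M.Model)).2 = 0 at h1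
  rw [h2]
  exact h1

theorem IsLeafwiseOn.comp_affine {c : ℝ → M} {a b a' b' : ℝ} (hab : a < b)
    (h : IsLeafwiseOn c (Icc a' b')) (k m : ℝ)
    (hk : ∀ t ∈ Icc a b, k * t + m ∈ Icc a' b') :
    IsLeafwiseOn (fun t => c (k * t + m)) (Icc a b) := by
  have hs : ContDiff ℝ ∞ fun t : ℝ => k * t + m := by fun_prop
  have hs' : ContMDiff 𝓘(ℝ, ℝ) 𝓘(ℝ, ℝ) ∞ fun t : ℝ => k * t + m := hs.contMDiff
  refine ⟨h.1.comp hs'.contMDiffOn hk, fun t ht => ?_⟩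
  have h1 := h.2 _ (hk t ht)
  have hcomp := mfderivWithin_comp (I := 𝓘(ℝ, ℝ)) (I' := 𝓘(ℝ, ℝ)) (I'' := M.I)
    (f := fun t : ℝ => k * t + m) (g := c) (s := Icc a b) (u := Icc a' b') t
    ((h.1.mdifferentiableOn (by simp)) _ (hk t ht))
    ((hs'.mdifferentiable (by simp) t).mdifferentiableWithinAt) hk
    (uniqueMDiffWithinAt_iff_uniqueDiffWithinAt.2 (uniqueDiffOn_Icc hab t ht))
  have h3 : mfderivWithin 𝓘(ℝ, ℝ) M.I (fun t => c (k * t + m)) (Icc a b) t (1 : ℝ) =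
      mfderivWithin 𝓘(ℝ, ℝ) M.I c (Icc a' b') (k * t + m)
        (mfderivWithin 𝓘(ℝ, ℝ) 𝓘(ℝ, ℝ) (fun t : ℝ => k * t + m) (Icc a b) t (1 : ℝ)) :=
    DFunLike.congr_fun hcomp (1 : ℝ)
  rw [h3]
  obtain ⟨r, hr⟩ : ∃ r : ℝ, (mfderivWithin 𝓘(ℝ, ℝ) 𝓘(ℝ, ℝ) (fun t : ℝ => k * t + m)
    (Icc a b) t (1 : ℝ) : ℝ) = r • (1 : ℝ) :=
    (fun x : ℝ => ⟨x, by simp⟩ : ∀ x : ℝ, ∃ r : ℝ, x = r • (1 : ℝ)) _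
  have h4 := (mfderivWithin 𝓘(ℝ, ℝ) M.I c (Icc a' b') (k * t + m)).map_smul r (1 : ℝ)
  have h5 := (M.leafTangent (c (k * t + m))).smul_mem r h1
  rw [← h4] at h5
  exact (congrArg (fun v : ℝ => mfderivWithin 𝓘(ℝ, ℝ) M.I c (Icc a' b') (k * t + m) v ∈
    M.leafTangent (c (k * t + m))) hr).mpr h5

theorem isLeafwisePath_const (x : M) : IsLeafwisePath fun _ => x := by
  refine ⟨continuousOn_const, ∅, finite_empty, fun a b _ _ _ _ => ⟨contMDiffOn_const, ?_⟩⟩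
  intro t _
  rw [mfderivWithin_const]
  exact Submodule.zero_mem _

/-- The path that runs through `c₂` and then through `c₁`. -/
noncomputable def concat (c₁ c₂ : ℝ → M) : ℝ → M :=
  fun t => if t ≤ 1 / 2 then c₂ (2 * t + 0) else c₁ (2 * t + -1)

theorem concat_left (c₁ c₂ : ℝ → M) {t : ℝ} (ht : t ≤ 1 / 2) :
    concat c₁ c₂ t = c₂ (2 * t + 0) := if_pos ht

theorem concat_right {c₁ c₂ : ℝ → M} (h : c₁ 0 = c₂ 1) {t : ℝ} (ht : 1 / 2 ≤ t) :
    concat c₁ c₂ t = c₁ (2 * t + -1) := by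
  rcases ht.eq_or_lt with rfl | ht
  · rw [concat_left _ _ le_rfl]
    norm_num [h]
  · exact if_neg ht.not_ge

theorem IsLeafwisePath.concat {c₁ c₂ : ℝ → M} (h₁ : IsLeafwisePath c₁) (h₂ : IsLeafwisePath c₂)
    (h : c₁ 0 = c₂ 1) : IsLeafwisePath (concat c₁ c₂) := by
  obtain ⟨k₁, S₁, f₁, h₁⟩ := h₁
  obtain ⟨k₂, S₂, f₂, h₂⟩ := h₂
  have e : Icc (0 : ℝ) 1 = Icc 0 (1 / 2) ∪ Icc (1 / 2) 1 :=
    (Icc_union_Icc_eq_Icc (by norm_num) (by norm_num)).symm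
  refine ⟨?_, (fun t => 1 / 2 * t) '' S₂ ∪ (fun t => 1 / 2 * t + 1 / 2) '' S₁ ∪ {1 / 2},
    ((f₂.image _).union (f₁.image _)).union (finite_singleton _), ?_⟩
  · rw [e]
    refine ContinuousOn.union_of_isClosed ?_ ?_ isClosed_Icc isClosed_Icc
    · refine ContinuousOn.congr (f := fun t => c₂ (2 * t + 0)) ?_ fun t ht =>
        concat_left _ _ ht.2
      exact k₂.comp (by fun_prop) fun t ht => ⟨by linarith [ht.1], by linarith [ht.2]⟩
    · refine ContinuousOn.congr (f := fun t => c₁ (2 * t + -1)) ?_ fun t ht =>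
        concat_right h ht.1
      exact k₁.comp (by fun_prop) fun t ht => ⟨by linarith [ht.1], by linarith [ht.2]⟩
  · intro a b ha hab hb hd
    rw [disjoint_left] at hd
    have hm : b ≤ 1 / 2 ∨ 1 / 2 ≤ a := by
      by_contra! hh
      exact hd (Or.inr rfl) ⟨hh.2, hh.1⟩
    rcases hm with hm | hm
    · refine IsLeafwiseOn.congr (c := fun t => c₂ (2 * t + 0)) ?_ fun t ht =>
        concat_left _ _ (ht.2.trans hm)
      refine IsLeafwiseOn.comp_affine hab (a' := 2 * a) (b' := 2 * b)
        (h₂ _ _ (by linarith) (by linarith) (by linarith) ?_) _ _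
        fun t ht => ⟨by linarith [ht.1], by linarith [ht.2]⟩
      rw [disjoint_left]
      intro t ht ht'
      exact hd (Or.inl (Or.inl ⟨t, ht, rfl⟩)) ⟨by linarith [ht'.1], by linarith [ht'.2]⟩
    · refine IsLeafwiseOn.congr (c := fun t => c₁ (2 * t + -1)) ?_ fun t ht =>
        concat_right h (hm.trans ht.1)
      refine IsLeafwiseOn.comp_affine hab (a' := 2 * a + -1) (b' := 2 * b + -1)
        (h₁ _ _ (by linarith) (by linarith) (by linarith) ?_) _ _
        fun t ht => ⟨by linarith [ht.1], by linarith [ht.2]⟩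
      rw [disjoint_left]
      intro t ht ht'
      exact hd (Or.inl (Or.inr ⟨t, ht, rfl⟩)) ⟨by linarith [ht'.1], by linarith [ht'.2]⟩

theorem IsLeafwisePath.reverse {c : ℝ → M} (h : IsLeafwisePath c) :
    IsLeafwisePath fun t => c (-1 * t + 1) := by
  obtain ⟨k, S, f, h⟩ := h
  refine ⟨k.comp (by fun_prop) fun t ht => ⟨by linarith [ht.2], by linarith [ht.1]⟩,
    (fun t => 1 - t) '' S, f.image _, fun a b ha hab hb hd => ?_⟩
  rw [disjoint_left] at hd
  refine IsLeafwiseOn.comp_affine hab (a' := 1 - b) (b' := 1 - a)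
    (h _ _ (by linarith) (by linarith) (by linarith) ?_) _ _
    fun t ht => ⟨by linarith [ht.2], by linarith [ht.1]⟩
  rw [disjoint_left]
  intro t ht ht'
  exact hd ⟨t, ht, rfl⟩ ⟨by linarith [ht'.2], by linarith [ht'.1]⟩

theorem IsBasicAt.post {f : M → M.Trans} {x : M} (h : IsBasicAt f x) (k : M.Trans → M.Trans) :
    IsBasicAt (fun y => k (f y)) x := by
  obtain ⟨l, hl⟩ := h
  exact ⟨fun w => k (l w), hl.fun_comp k⟩

theorem IsContinuation.post {c : ℝ → M} {σ : ℝ → M → M.Trans} (h : IsContinuation c σ)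
    (k : M.Trans → M.Trans) : IsContinuation c fun t y => k (σ t y) :=
  fun t ht => ⟨(h t ht).1.post k, (h t ht).2.mono fun _ hs => hs.fun_comp k⟩

theorem IsContinuation.reverse {c : ℝ → M} {σ : ℝ → M → M.Trans} (h : IsContinuation c σ) :
    IsContinuation (fun t => c (-1 * t + 1)) fun t => σ (-1 * t + 1) := by
  intro t ht
  have ht' : -1 * t + 1 ∈ Icc (0 : ℝ) 1 := ⟨by linarith [ht.2], by linarith [ht.1]⟩
  refine ⟨(h _ ht').1, ?_⟩
  have : Tendsto (fun t : ℝ => -1 * t + 1) (𝓝[Icc 0 1] t) (𝓝[Icc 0 1] (-1 * t + 1)) :=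
    ContinuousWithinAt.tendsto_nhdsWithin (by fun_prop)
      fun s hs => ⟨by linarith [hs.2], by linarith [hs.1]⟩
  exact this.eventually (h _ ht').2

theorem IsContinuation.concat {c₁ c₂ : ℝ → M} {σ₁ σ₂ : ℝ → M → M.Trans}
    (k₁ : ContinuousOn c₁ (Icc 0 1))
    (h₁ : IsContinuation c₁ σ₁) (h₂ : IsContinuation c₂ σ₂) (h : c₁ 0 = c₂ 1)
    (hσ : σ₁ 0 =ᶠ[𝓝 (c₁ 0)] σ₂ 1) :
    IsContinuation (concat c₁ c₂)
      fun t => if t ≤ 1 / 2 then σ₂ (2 * t + 0) else σ₁ (2 * t + -1) := by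
  intro t ht
  beta_reduce
  have e : Icc (0 : ℝ) 1 = Icc 0 (1 / 2) ∪ Icc (1 / 2) 1 :=
    (Icc_union_Icc_eq_Icc (by norm_num) (by norm_num)).symm
  have T₂ : ∀ t ∈ Icc (0 : ℝ) (1 / 2),
      Tendsto (fun t : ℝ => 2 * t + 0) (𝓝[Icc 0 (1 / 2)] t) (𝓝[Icc 0 1] (2 * t + 0)) := fun t _ =>
    ContinuousWithinAt.tendsto_nhdsWithin (by fun_prop)
      fun s hs => ⟨by linarith [hs.1], by linarith [hs.2]⟩
  have T₁ : ∀ t ∈ Icc (1 / 2 : ℝ) 1,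
      Tendsto (fun t : ℝ => 2 * t + -1) (𝓝[Icc (1 / 2) 1] t) (𝓝[Icc 0 1] (2 * t + -1)) :=
    fun t _ => ContinuousWithinAt.tendsto_nhdsWithin (by fun_prop)
      fun s hs => ⟨by linarith [hs.1], by linarith [hs.2]⟩
  -- all the germs of the second half agree with those of `σ₁`
  have hr : ∀ s, 1 / 2 ≤ s → (if s ≤ 1 / 2 then σ₂ (2 * s + 0) else σ₁ (2 * s + -1))
      =ᶠ[𝓝 (c₁ (2 * s + -1))] σ₁ (2 * s + -1) := by
    intro s hs
    rcases hs.eq_or_lt with rfl | hs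
    · rw [if_pos le_rfl]
      norm_num
      exact hσ.symm
    · rw [if_neg hs.not_ge]
  rcases lt_trichotomy t (1 / 2) with hlt | rfl | hgt
  · have ht₂ : t ∈ Icc (0 : ℝ) (1 / 2) := ⟨ht.1, hlt.le⟩
    have h2 := h₂ (2 * t + 0) ⟨by linarith [ht.1], by linarith⟩
    rw [concat_left _ _ hlt.le, if_pos hlt.le]
    refine ⟨h2.1, ?_⟩
    have hn : 𝓝[Icc 0 1] t = 𝓝[Icc 0 (1 / 2)] t :=
      nhdsWithin_eq_nhdsWithin' (s := Iio (1 / 2)) (Iio_mem_nhds hlt) (by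
        ext s; simp only [mem_inter_iff, mem_Icc, mem_Iio]
        constructor
        · rintro ⟨⟨a, b⟩, c⟩; exact ⟨⟨a, c.le⟩, c⟩
        · rintro ⟨⟨a, b⟩, c⟩; exact ⟨⟨a, by linarith⟩, c⟩)
    rw [hn]
    filter_upwards [(T₂ t ht₂).eventually h2.2, self_mem_nhdsWithin] with s hs hs'
    rw [concat_left _ _ hs'.2, if_pos hs'.2]
    exact hs
  · have h2 := h₂ (2 * (1 / 2) + 0) ⟨by norm_num, by norm_num⟩
    have h1 := h₁ (2 * (1 / 2) + -1) ⟨by norm_num, by norm_num⟩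
    rw [concat_left _ _ le_rfl, if_pos le_rfl]
    refine ⟨h2.1, ?_⟩
    rw [e, nhdsWithin_union, eventually_sup]
    constructor
    · filter_upwards [(T₂ (1 / 2) ⟨by norm_num, le_rfl⟩).eventually h2.2,
        self_mem_nhdsWithin] with s hs hs'
      rw [concat_left _ _ hs'.2, if_pos hs'.2]
      exact hs
    · have hc : Tendsto (fun s => c₁ (2 * s + -1)) (𝓝[Icc (1 / 2) 1] (1 / 2)) (𝓝 (c₁ 0)) := by
        have := (k₁ (2 * (1 / 2) + -1) ⟨by norm_num, by norm_num⟩).tendsto.comp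
          (T₁ (1 / 2) ⟨le_rfl, by norm_num⟩)
        norm_num at this
        norm_num
        exact this
      filter_upwards [(T₁ (1 / 2) ⟨le_rfl, by norm_num⟩).eventually h1.2, self_mem_nhdsWithin,
        hc.eventually (eventually_eventually_nhds.2 hσ)] with s hs hs' hs''
      rw [concat_right h hs'.1]
      refine (hr s hs'.1).trans (hs.trans ?_)
      norm_num
      exact hs''
  · have ht₁ : t ∈ Icc (1 / 2 : ℝ) 1 := ⟨hgt.le, ht.2⟩
    have h1 := h₁ (2 * t + -1) ⟨by linarith, by linarith [ht.2]⟩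
    rw [concat_right h hgt.le, if_neg hgt.not_ge]
    refine ⟨h1.1, ?_⟩
    have hn : 𝓝[Icc 0 1] t = 𝓝[Icc (1 / 2) 1] t :=
      nhdsWithin_eq_nhdsWithin' (s := Ioi (1 / 2)) (Ioi_mem_nhds hgt) (by
        ext s; simp only [mem_inter_iff, mem_Icc, mem_Ioi]
        constructor
        · rintro ⟨⟨a, b⟩, c⟩; exact ⟨⟨c.le, b⟩, c⟩
        · rintro ⟨⟨a, b⟩, c⟩; exact ⟨⟨by linarith, b⟩, c⟩)
    rw [hn]
    filter_upwards [(T₁ t ht₁).eventually h1.2, self_mem_nhdsWithin] with s hs hs'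
    rw [concat_right h hs'.1]
    exact (hr s hs'.1).trans hs

/-- Elements of the holonomy groupoid: holonomy classes of leafwise paths. A class is recorded by
its source, its range, and its holonomy germ with respect to the preferred foliation charts at the
source and the range, the germ being given as the set of all functions which represent it;
leafwise paths with the same end points are identified exactly if their holonomy germs agree. -/
@[ext] structure HolonomyGroupoid (M : CompactFoliation.{u}) where
  src : M
  rng : M
  germ : Set (M.Trans → M.Trans)
  exists_path : ∃ (c : ℝ → M) (e : OpenPartialHomeomorph M.Trans M.Trans),
    IsLeafwisePath c ∧ c 0 = src ∧ c 1 = rng ∧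
    IsHolonomy (chartAt M.Model src) (chartAt M.Model rng) c e ∧
    germ = {k | k =ᶠ[𝓝 (trans src src)] e}

theorem tendsto_trans (x : M) : Tendsto (trans x) (𝓝 x) (𝓝 (trans x x)) :=
  (continuous_snd.continuousAt.comp
    ((chartAt M.Model x).continuousAt (mem_chart_source M.Model x))).tendsto

theorem tendsto_symm {X Y : Type*} [TopologicalSpace X] [TopologicalSpace Y]
    (e : OpenPartialHomeomorph X Y) {a : X} (ha : a ∈ e.source) :
    Tendsto e.symm (𝓝 (e a)) (𝓝 a) := by
  have := (e.symm.continuousAt (e.map_source ha)).tendsto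
  rwa [e.left_inv ha] at this

namespace HolonomyGroupoid

/-- The class of the constant path. -/
noncomputable def unit (x : M) : HolonomyGroupoid M where
  src := x
  rng := x
  germ := {k | k =ᶠ[𝓝 (trans x x)] id}
  exists_path := by
    refine ⟨fun _ => x, OpenPartialHomeomorph.refl _, isLeafwisePath_const x, rfl, rfl,
      ⟨(contDiffGroupoid ∞ 𝓘(ℝ, M.Trans)).id_mem, mem_univ _, rfl, fun _ => trans x,
        fun t _ => ⟨⟨id, EventuallyEq.rfl⟩, Eventually.of_forall fun _ => EventuallyEq.rfl⟩,
        EventuallyEq.rfl, EventuallyEq.rfl⟩, rfl⟩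

/-- The class of the reversed path, with the inverse holonomy germ. -/
noncomputable def inv (γ : HolonomyGroupoid M) : HolonomyGroupoid M where
  src := γ.rng
  rng := γ.src
  germ := {k | ∃ h ∈ γ.germ, ∀ᶠ w in 𝓝 (trans γ.src γ.src), k (h w) = w}
  exists_path := by
    obtain ⟨c, e, hc, h0, h1, ⟨he, ha, hea, σ, hσ, hσ0, hσ1⟩, hg⟩ := γ.exists_path
    rw [h0] at ha hea hσ0
    rw [h1] at hea hσ1
    refine ⟨fun t => c (-1 * t + 1), e.symm, hc.reverse, by norm_num [h1], by norm_num [h0],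
      ⟨(contDiffGroupoid ∞ 𝓘(ℝ, M.Trans)).symm he, ?_, ?_,
        fun t y => e.symm (σ (-1 * t + 1) y), hσ.reverse.post _, ?_, ?_⟩, ?_⟩
    · norm_num [h1]
      rw [← hea]
      exact e.map_source ha
    · norm_num [h1, h0]
      rw [← hea, e.left_inv ha]
    · norm_num [h1]
      exact hσ1.fun_comp e.symm
    · norm_num [h0]
      filter_upwards [hσ0, (tendsto_trans γ.src).eventually (e.open_source.mem_nhds ha)]
        with y hy hy'
      rw [hy]
      exact e.left_inv hy'
    · ext k
      have ht : Tendsto e.symm (𝓝 (trans γ.rng γ.rng)) (𝓝 (trans γ.src γ.src)) := by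
        have := tendsto_symm e ha
        rwa [hea] at this
      have hb : trans γ.rng γ.rng ∈ e.target := by
        change (chartAt M.Model γ.rng γ.rng).2 ∈ _
        rw [← hea]
        exact e.map_source ha
      rw [hg]
      constructor
      · rintro ⟨h, hh, hk⟩
        filter_upwards [ht.eventually hh, ht.eventually hk, e.open_target.mem_nhds hb]
          with y h1 h2 h3
        rw [h1, e.right_inv h3] at h2
        exact h2
      · intro hk
        refine ⟨e, EventuallyEq.rfl, ?_⟩
        have ht' : Tendsto e (𝓝 (trans γ.src γ.src)) (𝓝 (trans γ.rng γ.rng)) := by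
          have := (e.continuousAt ha).tendsto
          rwa [hea] at this
        filter_upwards [ht'.eventually hk, e.open_source.mem_nhds ha] with w h1 h2
        rw [h1, e.left_inv h2]

/-- The product `γ₁ γ₂`, defined if the source of `γ₁` is the range of `γ₂`: the class of the path
which runs first through `γ₂` and then through `γ₁`. -/
noncomputable def mul (γ₁ γ₂ : HolonomyGroupoid M) (h : γ₁.src = γ₂.rng) : HolonomyGroupoid M where
  src := γ₂.src
  rng := γ₁.rng
  germ := {k | ∃ h₁ ∈ γ₁.germ, ∃ h₂ ∈ γ₂.germ, k =ᶠ[𝓝 (trans γ₂.src γ₂.src)] h₁ ∘ h₂}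
  exists_path := by
    obtain ⟨c₁, e₁, hc₁, h₁0, h₁1, ⟨he₁, ha₁, hea₁, σ₁, hσ₁, hσ₁0, hσ₁1⟩, hg₁⟩ := γ₁.exists_path
    obtain ⟨c₂, e₂, hc₂, h₂0, h₂1, ⟨he₂, ha₂, hea₂, σ₂, hσ₂, hσ₂0, hσ₂1⟩, hg₂⟩ := γ₂.exists_path
    have hj : c₁ 0 = c₂ 1 := by rw [h₁0, h₂1, h]
    rw [hj, h₂1, h] at ha₁ hea₁ hσ₁0
    rw [h₂0] at ha₂ hea₂ hσ₂0
    rw [h₁1] at hea₁ hσ₁1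
    rw [h₂1] at hea₂ hσ₂1
    have hgl : σ₁ 0 =ᶠ[𝓝 (c₁ 0)] fun y => e₁ (σ₂ 1 y) := by
      rw [hj, h₂1]
      exact hσ₁0.trans (hσ₂1.symm.fun_comp e₁)
    refine ⟨concat c₁ c₂, e₂.trans e₁, hc₁.concat hc₂ hj, ?_, ?_,
      ⟨(contDiffGroupoid ∞ 𝓘(ℝ, M.Trans)).trans he₂ he₁, ?_, ?_, _,
        IsContinuation.concat hc₁.1 hσ₁ (hσ₂.post e₁) hj hgl, ?_, ?_⟩, ?_⟩
    · rw [concat_left _ _ (by norm_num)]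
      norm_num [h₂0]
    · rw [concat_right hj (by norm_num)]
      norm_num [h₁1]
    · rw [concat_left _ _ (by norm_num)]
      norm_num [h₂0, ha₂, hea₂, ha₁]
    · rw [concat_left _ _ (by norm_num), concat_right hj (by norm_num)]
      norm_num [h₂0, hea₂, hea₁, h₁1]
    · rw [concat_left _ _ (by norm_num)]
      norm_num [h₂0]
      exact hσ₂0.fun_comp e₁
    · rw [concat_right hj (by norm_num)]
      norm_num [h₁1]
      exact hσ₁1
    · ext k
      rw [hg₁, hg₂, h]
      have ht : Tendsto e₂ (𝓝 (trans γ₂.src γ₂.src)) (𝓝 (trans γ₂.rng γ₂.rng)) := by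
        have := (e₂.continuousAt ha₂).tendsto
        rwa [hea₂] at this
      constructor
      · rintro ⟨k₁, hk₁, k₂, hk₂, hk⟩
        refine hk.trans ?_
        filter_upwards [hk₂, ht.eventually hk₁] with w h1 h2
        simp only [Function.comp_apply, h1, h2]
        rfl
      · intro hk
        exact ⟨e₁, EventuallyEq.rfl, e₂, EventuallyEq.rfl, hk⟩

end HolonomyGroupoid

/-- The data of a chart of the holonomy groupoid: foliation charts `φ`, `ψ` near the source and the
range, and a local diffeomorphism `e` between the transversals. -/
structure HolonomyChart (M : CompactFoliation.{u}) where
  φ : OpenPartialHomeomorph M M.Model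
  ψ : OpenPartialHomeomorph M M.Model
  e : OpenPartialHomeomorph M.Trans M.Trans
  φ_mem : φ ∈ atlas M.Model M
  ψ_mem : ψ ∈ atlas M.Model M
  e_mem : e ∈ contDiffGroupoid ∞ 𝓘(ℝ, M.Trans)

namespace HolonomyChart

/-- The domain of a chart of the holonomy groupoid: the classes from the domain of `φ` to the domain
of `ψ` whose holonomy with respect to `φ` and `ψ` is the germ of `e`. Here `k` is the transverse
coordinate change from the preferred chart at the range to `ψ`, so that the germs of
`k ∘ h ∘ (transverse coordinate at the source)` and `e ∘ (transverse coordinate of φ)` agree. -/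
def dom (C : HolonomyChart M) : Set (HolonomyGroupoid M) :=
  {γ | γ.src ∈ C.φ.source ∧ γ.rng ∈ C.ψ.source ∧ (C.φ γ.src).2 ∈ C.e.source ∧
    C.e (C.φ γ.src).2 = (C.ψ γ.rng).2 ∧ ∃ h ∈ γ.germ, ∃ k : M.Trans → M.Trans,
      ((fun y => (C.ψ y).2) =ᶠ[𝓝 γ.rng] fun y => k (trans γ.rng y)) ∧
      ((fun y => C.e (C.φ y).2) =ᶠ[𝓝 γ.src] fun y => k (h (trans γ.src y)))}

/-- The coordinates of a class: the coordinates (longitudinal and transverse) of its source and the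
longitudinal coordinate of its range. -/
noncomputable def coord (C : HolonomyChart M) (γ : HolonomyGroupoid M) : M.Model × M.Plaque :=
  (C.φ γ.src, (C.ψ γ.rng).1)

end HolonomyChart

/-- The topology of the holonomy groupoid, in general not Hausdorff: it is generated by the parts of
the chart domains which open sets cut out in the coordinates. -/
instance : TopologicalSpace (HolonomyGroupoid M) :=
  TopologicalSpace.generateFrom
    {U | ∃ (C : HolonomyChart M) (O : Set (M.Model × M.Plaque)), IsOpen O ∧
      U = C.dom ∩ C.coord ⁻¹' O}

/-- Smoothness, on the open subset `A`, of a map between holonomy groupoids: it is continuous, and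
smooth when expressed in the charts. -/
def SmoothOnGroupoid {N : CompactFoliation.{u}} (F : HolonomyGroupoid M → HolonomyGroupoid N)
    (A : Set (HolonomyGroupoid M)) : Prop :=
  ∀ γ ∈ A, ContinuousWithinAt F A γ ∧
    ∀ (C : HolonomyChart M) (D : HolonomyChart N), γ ∈ C.dom → F γ ∈ D.dom →
      ∃ Φ : M.Model × M.Plaque → N.Model × N.Plaque, ContDiffAt ℝ ∞ Φ (C.coord γ) ∧
        ∀ᶠ δ in 𝓝[A] γ, D.coord (F δ) = Φ (C.coord δ)

theorem HolonomyChart.dom_inter_mem_nhds (C : HolonomyChart M) {γ : HolonomyGroupoid M}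
    (hγ : γ ∈ C.dom) {O : Set (M.Model × M.Plaque)} (hO : O ∈ 𝓝 (C.coord γ)) :
    C.dom ∩ C.coord ⁻¹' O ∈ 𝓝 γ := by
  obtain ⟨O', h1, h2, h3⟩ := mem_nhds_iff.1 hO
  have h4 : IsOpen (C.dom ∩ C.coord ⁻¹' O') :=
    TopologicalSpace.GenerateOpen.basic _ ⟨C, O', h2, rfl⟩
  exact mem_of_superset (h4.mem_nhds ⟨hγ, h3⟩) (inter_subset_inter_right _ (preimage_mono h1))

theorem HolonomyChart.dom_mem_nhds (C : HolonomyChart M) {γ : HolonomyGroupoid M}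
    (hγ : γ ∈ C.dom) : C.dom ∈ 𝓝 γ :=
  mem_of_superset (C.dom_inter_mem_nhds hγ univ_mem) inter_subset_left

theorem HolonomyChart.tendsto_coord (C : HolonomyChart M) {γ : HolonomyGroupoid M}
    (hγ : γ ∈ C.dom) : Tendsto C.coord (𝓝 γ) (𝓝 (C.coord γ)) := fun _ hO =>
  mem_map.2 (mem_of_superset (C.dom_inter_mem_nhds hγ hO) inter_subset_right)

/-- Every class lies in the domain of some chart. -/
theorem exists_holonomyChart (γ : HolonomyGroupoid M) : ∃ C : HolonomyChart M, γ ∈ C.dom := by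
  obtain ⟨c, e, hc, h0, h1, ⟨he, ha, hea, -⟩, hg⟩ := γ.exists_path
  rw [h0] at ha hea
  rw [h1] at hea
  refine ⟨⟨chartAt _ γ.src, chartAt _ γ.rng, e, chart_mem_atlas _ _, chart_mem_atlas _ _, he⟩,
    mem_chart_source _ _, mem_chart_source _ _, ha, hea, e, ?_, id, EventuallyEq.rfl,
    EventuallyEq.rfl⟩
  rw [hg]
  exact EventuallyEq.rfl

theorem SmoothOnGroupoid.comp {N P : CompactFoliation.{u}}
    {G : HolonomyGroupoid N → HolonomyGroupoid P} {F : HolonomyGroupoid M → HolonomyGroupoid N}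
    {B : Set (HolonomyGroupoid N)} {A : Set (HolonomyGroupoid M)} (hG : SmoothOnGroupoid G B)
    (hF : SmoothOnGroupoid F A) (h : MapsTo F A B) : SmoothOnGroupoid (G ∘ F) A := by
  intro γ hγ
  obtain ⟨c1, h1⟩ := hF γ hγ
  obtain ⟨c2, h2⟩ := hG _ (h hγ)
  refine ⟨c2.comp c1 h, fun C D hC hD => ?_⟩
  obtain ⟨E, hE⟩ := exists_holonomyChart (F γ)
  obtain ⟨Φ, hΦ, hΦ'⟩ := h1 C E hC hE
  obtain ⟨Ψ, hΨ, hΨ'⟩ := h2 E D hE hD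
  have e : E.coord (F γ) = Φ (C.coord γ) := hΦ'.self_of_nhdsWithin hγ
  rw [e] at hΨ
  refine ⟨Ψ ∘ Φ, hΨ.comp _ hΦ, ?_⟩
  filter_upwards [hΦ', (c1.tendsto_nhdsWithin h).eventually hΨ'] with δ h3 h4
  exact h4.trans (congrArg Ψ h3)

theorem SmoothOnGroupoid.mono {N : CompactFoliation.{u}}
    {F : HolonomyGroupoid M → HolonomyGroupoid N} {A B : Set (HolonomyGroupoid M)}
    (hF : SmoothOnGroupoid F B) (h : A ⊆ B) : SmoothOnGroupoid F A := by
  intro γ hγ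
  obtain ⟨c1, h1⟩ := hF γ (h hγ)
  refine ⟨c1.mono h, fun C D hC hD => ?_⟩
  obtain ⟨Φ, hΦ, hΦ'⟩ := h1 C D hC hD
  exact ⟨Φ, hΦ, nhdsWithin_mono _ h hΦ'⟩

theorem SmoothOnGroupoid.congr {N : CompactFoliation.{u}}
    {F F' : HolonomyGroupoid M → HolonomyGroupoid N} {A : Set (HolonomyGroupoid M)}
    (hF : SmoothOnGroupoid F A) (h : EqOn F' F A) : SmoothOnGroupoid F' A := by
  intro γ hγ
  obtain ⟨c1, h1⟩ := hF γ hγ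
  refine ⟨c1.congr h (h hγ), fun C D hC hD => ?_⟩
  obtain ⟨Φ, hΦ, hΦ'⟩ := h1 C D hC (h hγ ▸ hD)
  refine ⟨Φ, hΦ, ?_⟩
  filter_upwards [hΦ', self_mem_nhdsWithin] with δ h2 h3
  rw [h h3, h2]

theorem contDiffAt_transition {φ φ' : OpenPartialHomeomorph M M.Model} (hφ : φ ∈ atlas M.Model M)
    (hφ' : φ' ∈ atlas M.Model M) {x : M} (hx : x ∈ φ.source) (hx' : x ∈ φ'.source) :
    ContDiffAt ℝ ∞ (fun v => φ' (φ.symm v)) (φ x) := by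
  have h1 : φ.symm.trans φ' ∈ contDiffGroupoid ∞ M.I := HasGroupoid.compatible hφ hφ'
  have h2 := (contMDiffOn_iff_contDiffOn.1 (contMDiffOn_of_mem_contDiffGroupoid h1))
  refine h2.contDiffAt ((φ.symm.trans φ').open_source.mem_nhds ?_)
  rw [OpenPartialHomeomorph.trans_source]
  refine ⟨φ.map_source hx, ?_⟩
  rw [mem_preimage, φ.left_inv hx]
  exact hx'

/-- The coordinate changes of the holonomy groupoid are smooth. -/
theorem smoothOnGroupoid_id (A : Set (HolonomyGroupoid M)) : SmoothOnGroupoid id A := by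
  intro γ hγ
  refine ⟨continuousWithinAt_id, fun C D hC hD => ?_⟩
  refine ⟨fun v => (D.φ (C.φ.symm v.1), (D.ψ (C.ψ.symm (v.2, C.e v.1.2))).1), ?_, ?_⟩
  · have h1 : ContDiffAt ℝ ∞ (fun v : M.Model × M.Plaque => D.φ (C.φ.symm v.1)) (C.coord γ) :=
      ContDiffAt.comp (f := Prod.fst) (g := fun v => D.φ (C.φ.symm v)) (C.coord γ)
        (contDiffAt_transition C.φ_mem D.φ_mem hC.1 hD.1) contDiffAt_fst
    have h2 : ContDiffAt ℝ ∞ C.e (C.φ γ.src).2 :=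
      (contMDiffOn_iff_contDiffOn.1 (contMDiffOn_of_mem_contDiffGroupoid C.e_mem)).contDiffAt
        (C.e.open_source.mem_nhds hC.2.2.1)
    have h3 : ContDiffAt ℝ ∞ (fun v : M.Model × M.Plaque => C.e v.1.2) (C.coord γ) :=
      h2.comp (C.coord γ) (contDiffAt_snd.comp _ contDiffAt_fst)
    have h4 := contDiffAt_transition C.ψ_mem D.ψ_mem hC.2.1 hD.2.1
    have h5 : C.ψ γ.rng = ((C.coord γ).2, C.e (C.coord γ).1.2) := Prod.ext rfl hC.2.2.2.1.symm
    rw [h5] at h4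
    have h6 : ContDiffAt ℝ ∞ (fun v : M.Model × M.Plaque => (v.2, C.e v.1.2)) (C.coord γ) :=
      contDiffAt_snd.prodMk h3
    have h7 : ContDiffAt ℝ ∞ (fun v : M.Model × M.Plaque => D.ψ (C.ψ.symm (v.2, C.e v.1.2)))
      (C.coord γ) :=
      ContDiffAt.comp (f := fun v : M.Model × M.Plaque => (v.2, C.e v.1.2))
        (g := fun w => D.ψ (C.ψ.symm w)) (C.coord γ) h4 h6
    exact h1.prodMk (contDiffAt_fst.comp _ h7)
  · filter_upwards [mem_nhdsWithin_of_mem_nhds (C.dom_mem_nhds hC)] with δ hδ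
    have h5 : ((C.coord δ).2, C.e (C.coord δ).1.2) = C.ψ δ.rng := Prod.ext rfl hδ.2.2.2.1
    rw [h5, C.ψ.left_inv hδ.2.1]
    simp only [HolonomyChart.coord, C.φ.left_inv hδ.1, id]

theorem continuous_src : Continuous (HolonomyGroupoid.src : HolonomyGroupoid M → M) := by
  refine continuous_iff_continuousAt.2 fun γ => ?_
  obtain ⟨C, hC⟩ := exists_holonomyChart γ
  have h1 : Tendsto (fun δ => C.φ.symm (C.coord δ).1) (𝓝 γ) (𝓝 γ.src) :=
    (tendsto_symm C.φ hC.1).comp ((continuous_fst.tendsto _).comp (C.tendsto_coord hC))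
  refine h1.congr' ?_
  filter_upwards [C.dom_mem_nhds hC] with δ hδ
  exact C.φ.left_inv hδ.1

theorem continuous_rng : Continuous (HolonomyGroupoid.rng : HolonomyGroupoid M → M) := by
  refine continuous_iff_continuousAt.2 fun γ => ?_
  obtain ⟨C, hC⟩ := exists_holonomyChart γ
  have h5 : ∀ δ ∈ C.dom, C.ψ δ.rng = ((C.coord δ).2, C.e (C.coord δ).1.2) :=
    fun δ hδ => Prod.ext rfl hδ.2.2.2.1.symm
  have h2 : Tendsto (fun δ => ((C.coord δ).2, C.e (C.coord δ).1.2)) (𝓝 γ) (𝓝 (C.ψ γ.rng)) := by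
    rw [h5 γ hC]
    have h := C.tendsto_coord hC
    refine (((continuous_snd.tendsto _).comp h)).prodMk_nhds ?_
    exact (C.e.continuousAt hC.2.2.1).tendsto.comp
      (((continuous_snd.comp continuous_fst).tendsto _).comp h)
  refine ((tendsto_symm C.ψ hC.2.1).comp h2).congr' ?_
  filter_upwards [C.dom_mem_nhds hC] with δ hδ
  simp only [Function.comp_apply]
  rw [← h5 δ hδ, C.ψ.left_inv hδ.2.1]

theorem continuous_unit : Continuous (HolonomyGroupoid.unit : M → HolonomyGroupoid M) := by
  refine continuous_generateFrom_iff.2 ?_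
  rintro _ ⟨C, O, hO, rfl⟩
  refine isOpen_iff_mem_nhds.2 fun x hx => ?_
  obtain ⟨⟨h1, h2, h3, h4, h, hh, k, hk, hk'⟩, h5⟩ := hx
  change x ∈ C.φ.source at h1
  change x ∈ C.ψ.source at h2
  change (C.φ x).2 ∈ C.e.source at h3
  change (fun y => (C.ψ y).2) =ᶠ[𝓝 x] fun y => k (trans x y) at hk
  change (fun y => C.e (C.φ y).2) =ᶠ[𝓝 x] fun y => k (h (trans x y)) at hk'
  change h =ᶠ[𝓝 (trans x x)] id at hh
  change (C.φ x, (C.ψ x).1) ∈ O at h5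
  have hE : (fun y => C.e (C.φ y).2) =ᶠ[𝓝 x] fun y => (C.ψ y).2 := by
    filter_upwards [hk, hk', (tendsto_trans x).eventually hh] with y a b c
    rw [a, b, c, id]
  have hφ := C.φ.continuousAt h1
  have hψ := C.ψ.continuousAt h2
  have hO' : ∀ᶠ y in 𝓝 x, (C.φ y, (C.ψ y).1) ∈ O :=
    (hφ.prodMk (continuous_fst.continuousAt.comp hψ)).eventually_mem (hO.mem_nhds h5)
  have he : ∀ᶠ y in 𝓝 x, (C.φ y).2 ∈ C.e.source :=
    (continuous_snd.continuousAt.comp hφ).eventually_mem (C.e.open_source.mem_nhds h3)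
  filter_upwards [C.φ.open_source.mem_nhds h1, C.ψ.open_source.mem_nhds h2, hO', he,
    eventually_eventually_nhds.2 hE] with y y1 y2 y3 y4 y5
  obtain ⟨k', hk'⟩ := M.foliated _ (chart_mem_atlas M.Model y) _ C.ψ_mem y
    ⟨mem_chart_source _ _, y2⟩
  exact ⟨⟨y1, y2, y4, y5.self_of_nhds, id, EventuallyEq.rfl, k', hk', EventuallyEq.trans y5 hk'⟩,
    y3⟩

namespace HolonomyGroupoid

theorem mul_congr {γ₁ γ₁' γ₂ γ₂' : HolonomyGroupoid M} (h₁ : γ₁ = γ₁') (h₂ : γ₂ = γ₂')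
    (h : γ₁.src = γ₂.rng) : ∃ h' : γ₁'.src = γ₂'.rng, mul γ₁' γ₂' h' = mul γ₁ γ₂ h := by
  subst h₁ h₂
  exact ⟨h, rfl⟩

theorem unit_mul_unit (x : M) : mul (unit x) (unit x) rfl = unit x := by
  refine HolonomyGroupoid.ext rfl rfl (Set.ext fun k => ⟨?_, ?_⟩)
  · rintro ⟨h₁, hh₁, h₂, hh₂, hk⟩
    change h₁ =ᶠ[𝓝 (trans x x)] id at hh₁
    change h₂ =ᶠ[𝓝 (trans x x)] id at hh₂
    change k =ᶠ[𝓝 (trans x x)] h₁ ∘ h₂ at hk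
    change k =ᶠ[𝓝 (trans x x)] id
    filter_upwards [hk, hh₁, hh₂] with w a b c
    rw [a, Function.comp_apply, c, id, b, id]
  · intro hk
    exact ⟨id, EventuallyEq.rfl, id, EventuallyEq.rfl, hk⟩

theorem eq_unit_of_mul_self (γ : HolonomyGroupoid M) (h : γ.src = γ.rng) (hm : mul γ γ h = γ) :
    γ = unit γ.rng := by
  obtain ⟨c, e, -, h0, h1, ⟨-, ha, hea, -⟩, hg⟩ := γ.exists_path
  rw [h0] at ha hea
  rw [h1, ← h] at hea
  have hm' : (e ∘ e) ∈ (mul γ γ h).germ := by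
    refine ⟨e, ?_, e, ?_, EventuallyEq.rfl⟩ <;> rw [hg] <;> exact EventuallyEq.rfl
  rw [hm, hg] at hm'
  change (e ∘ e) =ᶠ[𝓝 (trans γ.src γ.src)] e at hm'
  have ht : Tendsto e (𝓝 (trans γ.src γ.src)) (𝓝 (trans γ.src γ.src)) := by
    have := (e.continuousAt ha).tendsto
    rwa [hea] at this
  have he : e =ᶠ[𝓝 (trans γ.src γ.src)] id := by
    have hs := e.open_source.mem_nhds ha
    filter_upwards [hm', hs, ht.eventually hs] with w a b c
    exact e.injOn c b a
  refine HolonomyGroupoid.ext h rfl ?_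
  rw [hg, ← h]
  exact Set.ext fun k => ⟨fun hk => EventuallyEq.trans hk he,
    fun hk => EventuallyEq.trans hk he.symm⟩

end HolonomyGroupoid

/-! ### Smooth maps of leaf spaces -/

/-- A smooth map of leaf spaces from `M/F` to `N/F'`, given by an open cover `Ω` of `M`, indexed by
`ι`, and smooth maps `map α β` from `G^{Ω α}_{Ω β}` (the classes with range in `Ω α` and source in
`Ω β`) to the holonomy groupoid of `N`, which are compatible with inverses and products.
The values of `map α β` outside of `G^{Ω α}_{Ω β}` are irrelevant. -/
structure LeafMapOn (M N : CompactFoliation.{u}) (ι : Type u) where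
  Ω : ι → Set M
  isOpen : ∀ α, IsOpen (Ω α)
  cover : ∀ x, ∃ α, x ∈ Ω α
  map : ι → ι → HolonomyGroupoid M → HolonomyGroupoid N
  smooth : ∀ α β, SmoothOnGroupoid (map α β) {γ | γ.rng ∈ Ω α ∧ γ.src ∈ Ω β}
  map_inv : ∀ α β γ, γ.rng ∈ Ω α → γ.src ∈ Ω β → map β α γ.inv = (map α β γ).inv
  map_mul : ∀ α₁ α₂ α₃ γ₁ γ₂ (h : γ₁.src = γ₂.rng), γ₁.rng ∈ Ω α₁ → γ₁.src ∈ Ω α₂ →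
    γ₂.src ∈ Ω α₃ → ∃ h' : (map α₁ α₂ γ₁).src = (map α₂ α₃ γ₂).rng,
      (map α₁ α₂ γ₁).mul (map α₂ α₃ γ₂) h' = map α₁ α₃ (γ₁.mul γ₂ h)

namespace LeafMapOn

variable {N P Q : CompactFoliation.{u}} {ι κ : Type u}

/-- The map `Ω α → N` underlying `map α α`, that is, its composition with the unit map. -/
noncomputable def base (f : LeafMapOn M N ι) (α : ι) (x : M) : N :=
  (f.map α α (HolonomyGroupoid.unit x)).rng

theorem map_unit (f : LeafMapOn M N ι) {α : ι} {x : M} (hx : x ∈ f.Ω α) :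
    f.map α α (HolonomyGroupoid.unit x) = HolonomyGroupoid.unit (f.base α x) := by
  obtain ⟨h, h'⟩ := f.map_mul α α α (HolonomyGroupoid.unit x) (HolonomyGroupoid.unit x) rfl
    hx hx hx
  rw [HolonomyGroupoid.unit_mul_unit] at h'
  exact HolonomyGroupoid.eq_unit_of_mul_self _ h h'

theorem rng_map (f : LeafMapOn M N ι) {α β : ι} {γ : HolonomyGroupoid M} (hr : γ.rng ∈ f.Ω α)
    (hs : γ.src ∈ f.Ω β) : (f.map α β γ).rng = f.base α γ.rng := by
  obtain ⟨h, -⟩ := f.map_mul α α β (HolonomyGroupoid.unit γ.rng) γ rfl hr hr hs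
  rw [f.map_unit hr] at h
  exact h.symm

theorem src_map (f : LeafMapOn M N ι) {α β : ι} {γ : HolonomyGroupoid M} (hr : γ.rng ∈ f.Ω α)
    (hs : γ.src ∈ f.Ω β) : (f.map α β γ).src = f.base β γ.src := by
  obtain ⟨h, -⟩ := f.map_mul α β β γ (HolonomyGroupoid.unit γ.src) rfl hr hs hs
  exact h

theorem continuousOn_base (f : LeafMapOn M N ι) (α : ι) : ContinuousOn (f.base α) (f.Ω α) := by
  intro x hx
  have h := (f.smooth α α (HolonomyGroupoid.unit x) ⟨hx, hx⟩).1
  exact (continuous_rng.continuousAt.comp_continuousWithinAt h).comp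
    (f := HolonomyGroupoid.unit) (x := x) continuous_unit.continuousWithinAt
    fun y hy => ⟨hy, hy⟩

/-- The identity. -/
noncomputable def id (M : CompactFoliation.{u}) : LeafMapOn M M PUnit.{u + 1} where
  Ω _ := univ
  isOpen _ := isOpen_univ
  cover _ := ⟨PUnit.unit, mem_univ _⟩
  map _ _ γ := γ
  smooth _ _ := smoothOnGroupoid_id _
  map_inv _ _ _ _ _ := rfl
  map_mul _ _ _ _ _ h _ _ _ := ⟨h, rfl⟩

/-- The composition `g ∘ f`. -/
noncomputable def comp (f : LeafMapOn M N ι) (g : LeafMapOn N P κ) : LeafMapOn M P (ι × κ) where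
  Ω i := f.Ω i.1 ∩ f.base i.1 ⁻¹' g.Ω i.2
  isOpen i := (f.continuousOn_base i.1).isOpen_inter_preimage (f.isOpen i.1) (g.isOpen i.2)
  cover x := by
    obtain ⟨α, hα⟩ := f.cover x
    obtain ⟨ξ, hξ⟩ := g.cover (f.base α x)
    exact ⟨(α, ξ), hα, hξ⟩
  map i j γ := g.map i.2 j.2 (f.map i.1 j.1 γ)
  smooth i j := by
    refine SmoothOnGroupoid.comp (g.smooth i.2 j.2)
      ((f.smooth i.1 j.1).mono fun γ hγ => ⟨hγ.1.1, hγ.2.1⟩) fun γ hγ => ⟨?_, ?_⟩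
    · rw [f.rng_map hγ.1.1 hγ.2.1]
      exact hγ.1.2
    · rw [f.src_map hγ.1.1 hγ.2.1]
      exact hγ.2.2
  map_inv i j γ hr hs := by
    rw [f.map_inv i.1 j.1 γ hr.1 hs.1]
    refine g.map_inv _ _ _ ?_ ?_
    · rw [f.rng_map hr.1 hs.1]
      exact hr.2
    · rw [f.src_map hr.1 hs.1]
      exact hs.2
  map_mul i j k γ₁ γ₂ h h₁ h₂ h₃ := by
    have h₂' : γ₂.rng ∈ f.Ω j.1 := h ▸ h₂.1
    obtain ⟨h', e⟩ := f.map_mul i.1 j.1 k.1 γ₁ γ₂ h h₁.1 h₂.1 h₃.1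
    rw [← e]
    refine g.map_mul _ _ _ _ _ h' ?_ ?_ ?_
    · rw [f.rng_map h₁.1 h₂.1]
      exact h₁.2
    · rw [f.src_map h₁.1 h₂.1]
      exact h₂.2
    · rw [f.src_map h₂' h₃.1]
      exact h₃.2

/-- `f` is obtained from `F` by restriction of the index set along `s`. -/
def IsRestriction (F : LeafMapOn M N κ) (s : ι → κ) (f : LeafMapOn M N ι) : Prop :=
  (∀ α, f.Ω α = F.Ω (s α)) ∧ ∀ α β γ, γ.rng ∈ f.Ω α → γ.src ∈ f.Ω β →
    f.map α β γ = F.map (s α) (s β) γ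

theorem IsRestriction.base_eq {F : LeafMapOn M N κ} {s : ι → κ} {f : LeafMapOn M N ι}
    (h : F.IsRestriction s f) {α : ι} {x : M} (hx : x ∈ f.Ω α) : f.base α x = F.base (s α) x :=
  congrArg HolonomyGroupoid.rng (h.2 α α (HolonomyGroupoid.unit x) hx hx)

/-- Reindexing of a smooth map of leaf spaces. -/
def reindex (F : LeafMapOn M N κ) (s : ι → κ) (hs : ∀ x, ∃ α, x ∈ F.Ω (s α)) :
    LeafMapOn M N ι where
  Ω α := F.Ω (s α)
  isOpen _ := F.isOpen _
  cover := hs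
  map α β := F.map (s α) (s β)
  smooth _ _ := F.smooth _ _
  map_inv _ _ := F.map_inv _ _
  map_mul _ _ _ := F.map_mul _ _ _

theorem isRestriction_self (f : LeafMapOn M N ι) : f.IsRestriction (fun α => α) f :=
  ⟨fun _ => rfl, fun _ _ _ _ _ => rfl⟩

theorem IsRestriction.comp_left {ν : Type u} {F : LeafMapOn M N κ} {s : ι → κ}
    {f : LeafMapOn M N ι} (h : F.IsRestriction s f) (g : LeafMapOn N P ν) :
    (F.comp g).IsRestriction (fun i => (s i.1, i.2)) (f.comp g) := by
  refine ⟨fun i => Set.ext fun x => ?_, fun i j γ hr hs =>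
    congrArg (g.map i.2 j.2) (h.2 i.1 j.1 γ hr.1 hs.1)⟩
  change x ∈ f.Ω i.1 ∧ f.base i.1 x ∈ g.Ω i.2 ↔ x ∈ F.Ω (s i.1) ∧ F.base (s i.1) x ∈ g.Ω i.2
  rw [← h.1]
  exact and_congr_right fun hx => by rw [h.base_eq hx]

theorem IsRestriction.comp_right {ν : Type u} {F : LeafMapOn N P κ} {s : ι → κ}
    {g : LeafMapOn N P ι} (h : F.IsRestriction s g) (f : LeafMapOn M N ν) :
    (f.comp F).IsRestriction (fun i => (i.1, s i.2)) (f.comp g) := by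
  refine ⟨fun i => Set.ext fun x => ?_, fun i j γ hr hs => h.2 i.2 j.2 _ ?_ ?_⟩
  · change x ∈ f.Ω i.1 ∧ f.base i.1 x ∈ g.Ω i.2 ↔ x ∈ f.Ω i.1 ∧ f.base i.1 x ∈ F.Ω (s i.2)
    rw [← h.1]
  · rw [f.rng_map hr.1 hs.1]
    exact hr.2
  · rw [f.src_map hr.1 hs.1]
    exact hs.2

theorem base_comp (f : LeafMapOn M N ι) (g : LeafMapOn N P κ) (i : ι × κ) {x : M}
    (hx : x ∈ f.Ω i.1) : (f.comp g).base i x = g.base i.2 (f.base i.1 x) :=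
  congrArg (fun γ => (g.map i.2 i.2 γ).rng) (f.map_unit hx)

end LeafMapOn

/-- A smooth map of leaf spaces, with an arbitrary index set of the open cover. -/
structure LeafMap (M N : CompactFoliation.{u}) where
  ι : Type u
  data : LeafMapOn M N ι

namespace LeafMap

variable {N P Q : CompactFoliation.{u}}

/-- Two smooth maps of leaf spaces are equivalent if they are the restrictions of a third one, which
is indexed by the disjoint union of their index sets. -/
def IsEquivalent (f f' : LeafMap M N) : Prop :=
  ∃ F : LeafMapOn M N (f.ι ⊕ f'.ι), F.IsRestriction Sum.inl f.data ∧ F.IsRestriction Sum.inr f'.data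

/-- The identity. -/
noncomputable def id (M : CompactFoliation.{u}) : LeafMap M M := ⟨_, LeafMapOn.id M⟩

/-- The composition `g ∘ f`. -/
noncomputable def comp (f : LeafMap M N) (g : LeafMap N P) : LeafMap M P := ⟨_, f.data.comp g.data⟩

theorem equiv_of_isRestriction {f f' : LeafMap M N} {κ : Type u} (F : LeafMapOn M N κ)
    (s : f.ι → κ) (s' : f'.ι → κ) (h : F.IsRestriction s f.data) (h' : F.IsRestriction s' f'.data) :
    IsEquivalent f f' := by
  refine ⟨F.reindex (Sum.elim s s') fun x => ?_, h, h'⟩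
  obtain ⟨α, hα⟩ := f.data.cover x
  rw [h.1] at hα
  exact ⟨Sum.inl α, hα⟩

theorem comp_congr_left {f f' : LeafMap M N} (h : IsEquivalent f f') (g : LeafMap N P) :
    IsEquivalent (f.comp g) (f'.comp g) := by
  obtain ⟨F, h, h'⟩ := h
  exact equiv_of_isRestriction (F.comp g.data) _ _ (h.comp_left _) (h'.comp_left _)

theorem comp_congr_right (f : LeafMap M N) {g g' : LeafMap N P} (h : IsEquivalent g g') :
    IsEquivalent (f.comp g) (f.comp g') := by
  obtain ⟨F, h, h'⟩ := h
  exact equiv_of_isRestriction (f.data.comp F) _ _ (h.comp_right _) (h'.comp_right _)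

theorem id_comp (f : LeafMap M N) : IsEquivalent ((id M).comp f) f :=
  equiv_of_isRestriction f.data Prod.snd _
    ⟨fun _ => univ_inter _, fun _ _ _ _ _ => rfl⟩ f.data.isRestriction_self

theorem comp_id (f : LeafMap M N) : IsEquivalent (f.comp (id N)) f :=
  equiv_of_isRestriction f.data Prod.fst _
    ⟨fun _ => inter_univ _, fun _ _ _ _ _ => rfl⟩ f.data.isRestriction_self

theorem comp_assoc (f : LeafMap M N) (g : LeafMap N P) (h : LeafMap P Q) :
    IsEquivalent ((f.comp g).comp h) (f.comp (g.comp h)) := by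
  refine equiv_of_isRestriction ((f.data.comp g.data).comp h.data) _
    (fun i => ((i.1, i.2.1), i.2.2)) (LeafMapOn.isRestriction_self _)
    ⟨fun i => Set.ext fun x => ?_, fun _ _ _ _ _ => rfl⟩
  change x ∈ f.data.Ω i.1 ∧ f.data.base i.1 x ∈ g.data.Ω i.2.1 ∧
      g.data.base i.2.1 (f.data.base i.1 x) ∈ h.data.Ω i.2.2 ↔
    (x ∈ f.data.Ω i.1 ∧ f.data.base i.1 x ∈ g.data.Ω i.2.1) ∧
      (f.data.comp g.data).base (i.1, i.2.1) x ∈ h.data.Ω i.2.2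
  rw [and_assoc]
  refine and_congr_right fun hx => ?_
  have hb := f.data.base_comp g.data (i.1, i.2.1) hx
  exact and_congr_right fun _ => iff_of_eq (congrArg (· ∈ h.data.Ω i.2.2) hb.symm)

end LeafMap

/-- The category of compact foliations and equivalence classes of smooth maps of leaf spaces. -/
noncomputable instance : Category.{u + 1} CompactFoliation.{u} where
  Hom M N := Quot (LeafMap.IsEquivalent (M := M) (N := N))
  id M := Quot.mk _ (LeafMap.id M)
  comp := Quot.map₂ LeafMap.comp (fun f _ _ h => LeafMap.comp_congr_right f h)
    fun _ _ g h => LeafMap.comp_congr_left h g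
  id_comp := by
    rintro M N ⟨f⟩
    exact Quot.sound (LeafMap.id_comp f)
  comp_id := by
    rintro M N ⟨f⟩
    exact Quot.sound (LeafMap.comp_id f)
  assoc := by
    rintro M N P Q ⟨f⟩ ⟨g⟩ ⟨h⟩
    exact Quot.sound (LeafMap.comp_assoc f g h)

/-- The morphism of compact foliations represented by a smooth map of leaf spaces. -/
def LeafMap.toHom {N : CompactFoliation.{u}} (f : LeafMap M N) : M ⟶ N := Quot.mk _ f

/-! ### The foliated cone as a coarse space, and induced maps -/

/-- The foliated cone: the space `[0, ∞) × M` with the coarse structure of the Riemannian distance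
of the cone metric; the entourages are the sets of pairs of bounded distance. -/
noncomputable def foliatedCone (g : M.Metric) : CoarseSpace.{u} where
  carrier := M.Cone
  coarse :=
    { entourages := {E | ∃ R : ℝ≥0, ∀ p ∈ E, coneEDist g p.1 p.2 ≤ R}
      diag_mem := ⟨0, fun p hp => by rw [show p.1 = p.2 from hp, coneEDist_self]; simp⟩
      subset_mem := fun E E' ⟨R, hR⟩ h => ⟨R, fun p hp => hR p (h hp)⟩
      union_mem := fun E E' ⟨R, hR⟩ ⟨R', hR'⟩ => ⟨R + R', fun p hp => by
        push_cast
        rcases hp with hp | hp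
        · exact (hR p hp).trans le_self_add
        · exact (hR' p hp).trans le_add_self⟩
      inv_mem := fun E ⟨R, hR⟩ => ⟨R, fun p hp => by
        rw [coneEDist_comm]
        exact hR _ hp⟩
      comp_mem := fun E E' ⟨R, hR⟩ ⟨R', hR'⟩ => ⟨R + R', fun p ⟨y, h, h'⟩ => by
        push_cast
        exact (coneEDist_triangle g p.1 y p.2).trans (add_le_add (hR _ h) (hR' _ h'))⟩ }

/-- `F` is a map of cones induced by the smooth map of leaf spaces `f`: it is of the form
`F (t, x) = (t, f_{α (i x)} x)`, where `U 0, …, U (m - 1)` are open sets, the closure of `U k` is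
(compact and) contained in the member `Ω (α k)` of the open cover which belongs to `f`, and `i` is
a Borel function on `M` with `x ∈ U (i x)` for all `x`. -/
def LeafMap.IsInduced {N : CompactFoliation.{u}} (f : LeafMap M N) (F : M.Cone → N.Cone) : Prop :=
  ∃ (m : ℕ) (U : Fin m → Set M) (α : Fin m → f.ι) (i : M → Fin m),
    (∀ k, IsOpen (U k) ∧ closure (U k) ⊆ f.data.Ω (α k)) ∧
    @Measurable M (Fin m) (borel M) ⊤ i ∧ (∀ x, x ∈ U (i x)) ∧
    ∀ t x, F (t, x) = (t, f.data.base (α (i x)) x)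

end CompactFoliation

/-! A smooth map of leaf spaces is represented by maps `f_α` on the pieces `Ω_α` of a cover. On
overlaps they agree only up to sliding along leaves, so an induced map `F(t, x) = (t, f_{α(i x)} x)`
is in general discontinuous. Two estimates, both uniform in the height `t`, make it a coarse map.

The first concerns a single `f_α`. It maps leafwise vectors to leafwise vectors, because nearby
points of a plaque are joined by a class close to a unit, whose image is again close to a unit
(`modelDeriv_base_snd_eq_zero`). The normal part of a vector is the shortest vector congruent to it
modulo the leaf tangent space. Hence a norm bound for a linear map that respects leaf tangent spaces
also bounds its effect on normal parts, and the derivative of `(t, x) ↦ (t, f_α x)` is bounded over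
compact subsets of `Ω_α` by a constant independent of `t` (`coneSq_map_le`,
`exists_coneMetric_mfderiv_le`). The case of the identity shows that the cone does not depend on the
metric (`coneEDist_le_of_metric`).

The second concerns the jumps. The points `f_α x` and `f_β x` are the ends of the class
`f_{βα}(1_x)`. The term `t² g_N` vanishes on leafwise vectors, so moving inside plaques costs the
same at every height. Following a continuation along a leafwise path shows that all classes near a
given one have ends at bounded distance in every slice (`IsContinuation.exists_sliceClose`,
`HolonomyGroupoid.exists_eventually_sliceClose`). Compactness then bounds the jumps
(`exists_sliceClose_base`).

A path in the cone that is shorter than a Lebesgue number of the cover projects into one piece, so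
its ends have images at bounded distance: two jumps and one image path
(`exists_coneEDist_le_of_length_le`). Longer paths are cut into such pieces
(`exists_coneEDist_map_le`). Properness holds because `F` preserves heights. The jump estimate also
shows that all maps induced by `f` are close. Functoriality follows, since composites of induced
maps are induced, and maps induced by equivalent `f`, `f'` are all induced by the map that restricts
to both.

Transitivity of equivalence is a gluing argument: maps that share the restriction `g` are combined
by passing through an index of `g` and multiplying in the groupoid (`LeafMapOn.exists_glue`). -/

/-! ### Distances and lengths of a Riemannian metric -/

section RiemannianLength

open MeasureTheory

variable {E : Type*} [NormedAddCommGroup E] [NormedSpace ℝ E]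
  {H : Type*} [TopologicalSpace H] {I : ModelWithCorners ℝ E H}
  {X : Type*} [TopologicalSpace X] [ChartedSpace H X]
  {E' : Type*} [NormedAddCommGroup E'] [NormedSpace ℝ E']
  {H' : Type*} [TopologicalSpace H'] {I' : ModelWithCorners ℝ E' H'}
  {X' : Type*} [TopologicalSpace X'] [ChartedSpace H' X']

namespace Bundle.RiemannianMetric

/-- The Riemannian distance of a Riemannian metric. -/
noncomputable def eDist (R : RiemannianMetric (fun x : X => TangentSpace I x)) (x y : X) : ℝ≥0∞ :=
  letI : RiemannianBundle (fun x : X => TangentSpace I x) := ⟨R⟩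
  riemannianEDist I x y

/-- The square of the speed of a path. -/
noncomputable def sqSpeed (R : RiemannianMetric (fun x : X => TangentSpace I x)) (c : ℝ → X)
    (s : ℝ) : ℝ :=
  R.inner (c s) (mfderiv 𝓘(ℝ, ℝ) I c s (1 : ℝ)) (mfderiv 𝓘(ℝ, ℝ) I c s (1 : ℝ))

/-- The length of a path. -/
noncomputable def length (R : RiemannianMetric (fun x : X => TangentSpace I x)) (c : ℝ → X)
    (a b : ℝ) : ℝ≥0∞ :=
  ∫⁻ s in Icc a b, ENNReal.ofReal √(R.sqSpeed c s)

variable {R : RiemannianMetric (fun x : X => TangentSpace I x)}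
  {R' : RiemannianMetric (fun x : X' => TangentSpace I' x)}

theorem inner_self_nonneg (x : X) (v : TangentSpace I x) : 0 ≤ R.inner x v v := by
  rcases eq_or_ne v 0 with rfl | h
  · simp
  · exact (R.pos x v h).le

theorem enorm_eq (R : RiemannianMetric (fun x : X => TangentSpace I x)) (x : X)
    (v : TangentSpace I x) :
    letI : RiemannianBundle (fun x : X => TangentSpace I x) := ⟨R⟩
    ‖v‖ₑ = ENNReal.ofReal √(R.inner x v v) := by
  let : RiemannianBundle (fun x : X => TangentSpace I x) := ⟨R⟩
  rw [← ofReal_norm, norm_eq_sqrt_real_inner]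
  rfl

theorem length_eq (R : RiemannianMetric (fun x : X => TangentSpace I x)) (c : ℝ → X) (a b : ℝ) :
    letI : RiemannianBundle (fun x : X => TangentSpace I x) := ⟨R⟩
    pathELength I c a b = R.length c a b := by
  let : RiemannianBundle (fun x : X => TangentSpace I x) := ⟨R⟩
  rw [pathELength_eq_lintegral_mfderiv_Icc]
  exact lintegral_congr fun s => R.enorm_eq _ _

theorem eDist_le_length {c : ℝ → X} {a b : ℝ} (hab : a ≤ b)
    (hc : ContMDiffOn 𝓘(ℝ, ℝ) I 1 c (Icc a b)) : R.eDist (c a) (c b) ≤ R.length c a b := by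
  let : RiemannianBundle (fun x : X => TangentSpace I x) := ⟨R⟩
  rw [← R.length_eq]
  exact riemannianEDist_le_pathELength hc rfl rfl hab

theorem exists_length_lt {x y : X} {r : ℝ≥0∞} (h : R.eDist x y < r) :
    ∃ c : ℝ → X, c 0 = x ∧ c 1 = y ∧ ContMDiffOn 𝓘(ℝ, ℝ) I 1 c (Icc 0 1) ∧
      R.length c 0 1 < r := by
  let : RiemannianBundle (fun x : X => TangentSpace I x) := ⟨R⟩
  obtain ⟨c, h0, h1, hc, hl⟩ := exists_lt_of_riemannianEDist_lt h
  exact ⟨c, h0, h1, hc, by rwa [← R.length_eq]⟩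

theorem length_mono (R : RiemannianMetric (fun x : X => TangentSpace I x)) (c : ℝ → X)
    {a b a' b' : ℝ} (h : a' ≤ a) (h' : b ≤ b') :
    R.length c a b ≤ R.length c a' b' :=
  lintegral_mono_set (Icc_subset_Icc h h')

theorem length_add (R : RiemannianMetric (fun x : X => TangentSpace I x)) (c : ℝ → X)
    {a b d : ℝ} (h : a ≤ b) (h' : b ≤ d) :
    R.length c a b + R.length c b d = R.length c a d := by
  let : RiemannianBundle (fun x : X => TangentSpace I x) := ⟨R⟩
  simp only [← R.length_eq]
  exact pathELength_add h h'

/-- The two-sided derivative in `sqSpeed` may be a junk value at the ends of a path that is only C¹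
on the closed interval. The ends are a null set, so the open interval suffices. -/
theorem length_le_mul_length {c : ℝ → X} {c' : ℝ → X'} {a b : ℝ} {L : ℝ≥0}
    (h : ∀ s ∈ Ioo a b, R'.sqSpeed c' s ≤ L ^ 2 * R.sqSpeed c s) :
    R'.length c' a b ≤ L * R.length c a b := by
  rw [length, length, ← restrict_Ioo_eq_restrict_Icc, ← lintegral_const_mul' _ _ ENNReal.coe_ne_top]
  refine setLIntegral_mono' measurableSet_Ioo fun s hs => ?_
  rw [← ENNReal.ofReal_coe_nnreal, ← ENNReal.ofReal_mul NNReal.zero_le_coe]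
  refine ENNReal.ofReal_le_ofReal (Real.sqrt_le_iff.2 ⟨by positivity, ?_⟩)
  rw [mul_pow, Real.sq_sqrt (by exact inner_self_nonneg _ _)]
  exact h s hs

theorem length_le_of_sqSpeed_le {c : ℝ → X} {a b : ℝ} {C : ℝ≥0}
    (h : ∀ s ∈ Ioo a b, R.sqSpeed c s ≤ C ^ 2) :
    R.length c a b ≤ C * ENNReal.ofReal (b - a) := by
  rw [length, ← restrict_Ioo_eq_restrict_Icc, ← Real.volume_Ioo, ← setLIntegral_const]
  refine setLIntegral_mono' measurableSet_Ioo fun s hs => ?_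
  rw [← ENNReal.ofReal_coe_nnreal]
  exact ENNReal.ofReal_le_ofReal (Real.sqrt_le_iff.2 ⟨by positivity, h s hs⟩)

theorem eDist_le_mul_length {c : ℝ → X} {c' : ℝ → X'} {a b : ℝ} {L : ℝ≥0} (hab : a ≤ b)
    (hc' : ContMDiffOn 𝓘(ℝ, ℝ) I' 1 c' (Icc a b))
    (h : ∀ s ∈ Ioo a b, R'.sqSpeed c' s ≤ L ^ 2 * R.sqSpeed c s) :
    R'.eDist (c' a) (c' b) ≤ L * R.length c a b :=
  (eDist_le_length hab hc').trans (length_le_mul_length h)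

/-- The case `L = 0` must be excluded: if no path joins the points, their distance is `⊤`, and `0 *
⊤ = 0`. -/
theorem le_mul_eDist {x y : X} {d : ℝ≥0∞} {L : ℝ≥0} (hL : L ≠ 0)
    (h : ∀ c : ℝ → X, ContMDiffOn 𝓘(ℝ, ℝ) I 1 c (Icc 0 1) → c 0 = x → c 1 = y →
      d ≤ L * R.length c 0 1) : d ≤ L * R.eDist x y := by
  refine ENNReal.le_mul_of_forall_lt (Or.inl (by simpa using hL))
    (Or.inl ENNReal.coe_ne_top) fun a ha b hb => ?_
  obtain ⟨c, h0, h1, hc, hl⟩ := exists_length_lt hb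
  exact (h c hc h0 h1).trans (by gcongr)

theorem mdifferentiableAt_of_mem_Ioo {c : ℝ → X} {a b : ℝ}
    (hc : ContMDiffOn 𝓘(ℝ, ℝ) I 1 c (Icc a b)) {s : ℝ} (hs : s ∈ Ioo a b) :
    MDifferentiableAt 𝓘(ℝ, ℝ) I c s :=
  (hc.contMDiffAt (Icc_mem_nhds hs.1 hs.2)).mdifferentiableAt one_ne_zero

theorem sqSpeed_comp {c : ℝ → X} {s : ℝ} (hc : MDifferentiableAt 𝓘(ℝ, ℝ) I c s) {f : X → X'}
    (hf : MDifferentiableAt I I' f (c s)) :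
    R'.sqSpeed (fun s => f (c s)) s =
      R'.inner (f (c s)) (mfderiv I I' f (c s) (mfderiv 𝓘(ℝ, ℝ) I c s (1 : ℝ)))
        (mfderiv I I' f (c s) (mfderiv 𝓘(ℝ, ℝ) I c s (1 : ℝ))) := by
  rw [sqSpeed]
  change R'.inner _ (mfderiv 𝓘(ℝ, ℝ) I' (f ∘ c) s (1 : ℝ))
    (mfderiv 𝓘(ℝ, ℝ) I' (f ∘ c) s (1 : ℝ)) = _
  rw [mfderiv_comp s hf hc]
  rfl

/-- All assumptions on `f` are made along the path only, so that this applies to maps which are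
smooth on an open subset, such as `coneBase`. -/
theorem eDist_comp_le_mul_length {f : X → X'} {L : ℝ≥0} {c : ℝ → X} {a b : ℝ} (hab : a ≤ b)
    (hc : ContMDiffOn 𝓘(ℝ, ℝ) I 1 c (Icc a b))
    (hf : ∀ s ∈ Icc a b, ContMDiffAt I I' 1 f (c s))
    (h : ∀ s ∈ Icc a b, ∀ v : TangentSpace I (c s),
      R'.inner (f (c s)) (mfderiv I I' f (c s) v) (mfderiv I I' f (c s) v) ≤
        L ^ 2 * R.inner (c s) v v) :
    R'.eDist (f (c a)) (f (c b)) ≤ L * R.length c a b := by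
  refine eDist_le_mul_length (c' := fun s => f (c s)) hab
    (fun s hs => (hf s hs).comp_contMDiffWithinAt s (hc s hs)) fun s hs => ?_
  have hs' := Ioo_subset_Icc_self hs
  rw [sqSpeed_comp (mdifferentiableAt_of_mem_Ioo hc hs)
    ((hf s hs').mdifferentiableAt one_ne_zero)]
  exact h s hs' _

theorem eDist_le_mul_eDist {f : X → X'} {L : ℝ≥0} (hL : L ≠ 0) (hf : ContMDiff I I' 1 f)
    (h : ∀ x (v : TangentSpace I x),
      R'.inner (f x) (mfderiv I I' f x v) (mfderiv I I' f x v) ≤ L ^ 2 * R.inner x v v)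
    (x y : X) : R'.eDist (f x) (f y) ≤ L * R.eDist x y := by
  refine le_mul_eDist hL ?_
  rintro c hc rfl rfl
  exact eDist_comp_le_mul_length zero_le_one hc (fun s _ => hf _) fun s _ => h _

/-- The length of the initial pieces of a path of finite length takes all intermediate values. -/
theorem exists_length_eq {c : ℝ → X} {a b : ℝ} {r : ℝ≥0} (hr : R.length c a b ≠ ⊤)
    (hab : a ≤ b) (h : r ≤ R.length c a b) :
    ∃ s ∈ Icc a b, R.length c a s = r := by
  set F : ℝ → ℝ := fun s => (R.length c a s).toReal with hF
  have hfin : ∀ s ≤ b, R.length c a s ≠ ⊤ := fun s hs =>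
    ne_top_of_le_ne_top hr (R.length_mono c le_rfl hs)
  have hcont : ContinuousOn F (Icc a b) := by
    intro s hs
    -- Absolute continuity of the integral: as the total length is finite, short parameter intervals
    -- carry little length.
    have key : Tendsto (fun s' => R.length c (min s s') (max s s')) (𝓝[Icc a b] s) (𝓝 0) := by
      have h1 : Tendsto (fun s' => ∫⁻ t in Icc (min s s') (max s s'),
          ENNReal.ofReal √(R.sqSpeed c t) ∂(volume.restrict (Icc a b))) (𝓝[Icc a b] s) (𝓝 0) := by
        refine tendsto_setLIntegral_zero hr ?_
        refine tendsto_of_tendsto_of_tendsto_of_le_of_le (g := fun _ => 0)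
          (h := fun s' => ENNReal.ofReal (max s s' - min s s')) tendsto_const_nhds ?_
          (fun _ => zero_le) fun s' => ?_
        · have : Tendsto (fun s' => max s s' - min s s') (𝓝[Icc a b] s) (𝓝 (max s s - min s s)) :=
            Continuous.continuousWithinAt (f := fun s' => max s s' - min s s') (by fun_prop)
          simpa using ENNReal.tendsto_ofReal this
        · refine (Measure.restrict_apply_le _ _).trans ?_
          simp
      refine h1.congr' ?_
      filter_upwards [self_mem_nhdsWithin] with s' hs'
      rw [length, Measure.restrict_restrict measurableSet_Icc, inter_eq_left.2]
      exact Icc_subset_Icc (le_min hs.1 hs'.1) (max_le hs.2 hs'.2)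
    rw [ContinuousWithinAt, tendsto_iff_dist_tendsto_zero]
    have key2 := (ENNReal.tendsto_toReal ENNReal.zero_ne_top).comp key
    refine key2.congr' ?_
    filter_upwards [self_mem_nhdsWithin] with s' hs'
    rcases le_total s s' with hss | hss
    · have e := R.length_add c hs.1 hss
      rw [Function.comp_apply, min_eq_left hss, max_eq_right hss, hF]
      simp only
      rw [← e, ENNReal.toReal_add (hfin s hs.2)
        (ne_top_of_le_ne_top hr (R.length_mono c hs.1 hs'.2)), Real.dist_eq, add_sub_cancel_left,
        abs_of_nonneg ENNReal.toReal_nonneg]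
    · have e := R.length_add c hs'.1 hss
      rw [Function.comp_apply, min_eq_right hss, max_eq_left hss, hF]
      simp only
      rw [← e, ENNReal.toReal_add (hfin s' hs'.2)
        (ne_top_of_le_ne_top hr (R.length_mono c hs'.1 hs.2)), dist_comm, Real.dist_eq,
        add_sub_cancel_left, abs_of_nonneg ENNReal.toReal_nonneg]
  have h0 : F a = 0 := by
    simp [hF, length]
  have := intermediate_value_Icc hab hcont
  rw [h0] at this
  obtain ⟨s, hs, hs'⟩ := this ⟨r.2, by
    have := ENNReal.toReal_mono hr h
    simpa using this⟩
  refine ⟨s, hs, ?_⟩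
  rw [← ENNReal.ofReal_toReal (hfin s hs.2)]
  change ENNReal.ofReal (F s) = r
  rw [hs']
  simp

end Bundle.RiemannianMetric
end RiemannianLength

/-! ### The normal projection and the cone metric -/

section NormalProjection

variable {E : Type*} [NormedAddCommGroup E] [NormedSpace ℝ E] [FiniteDimensional ℝ E]
  {b : E →L[ℝ] E →L[ℝ] ℝ} {hs : ∀ v w, b v w = b w v} {hp : ∀ v, v ≠ 0 → 0 < b v v}
  {W : Submodule ℝ E}

theorem sub_normalProjection_mem (v : E) : v - normalProjection b hs hp W v ∈ W := by
  have h := Submodule.projection_add_projection_eq_self (isCompl_orthogonalBilin b hs hp W) v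
  have h2 := Submodule.projection_apply_mem (isCompl_orthogonalBilin b hs hp W).symm v
  rw [← eq_sub_iff_add_eq'] at h
  rw [h] at h2
  exact h2

/-- Pythagoras: `v - w` is the sum of the projection of `v` and a vector of `W`, which are
orthogonal. The normal part thus computes the quotient norm modulo `W`. -/
theorem form_normalProjection_le (v : E) {w : E} (hw : w ∈ W) :
    b (normalProjection b hs hp W v) (normalProjection b hs hp W v) ≤ b (v - w) (v - w) := by
  set P := normalProjection b hs hp W v with hP
  have h1 : (v - P) - w ∈ W := W.sub_mem (sub_normalProjection_mem v) hw
  have h2 : P ∈ W.orthogonalBilin b.toLinearMap₁₂ :=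
    Submodule.projection_apply_mem (isCompl_orthogonalBilin b hs hp W) v
  have h3 : b ((v - P) - w) P = 0 := h2 _ h1
  have h4 : v - w = P + ((v - P) - w) := by abel
  have h5 := nonneg_of_pos_form b hp ((v - P) - w)
  rw [h4]
  simp only [map_add, _root_.add_apply]
  rw [hs P (v - P - w), h3]
  linarith

end NormalProjection

namespace CompactFoliation

variable {M N : CompactFoliation.{u}}

/-- A Riemannian metric as a family of bilinear forms on the model space. -/
noncomputable def form (g : M.Metric) (x : M) : M.Model →L[ℝ] M.Model →L[ℝ] ℝ := g.inner x

theorem form_nonneg (g : M.Metric) (x : M) (v : M.Model) : 0 ≤ form g x v v :=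
  nonneg_of_pos_form (E := M.Model) (g.inner x) (g.pos x) v

theorem sub_normalProj_snd (g : M.Metric) (x : M) (v : M.Model) :
    (v - normalProj g x v).2 = 0 :=
  sub_normalProjection_mem (b := form g x) (W := M.leafTangent x) v

theorem form_normalProj_le (g : M.Metric) (x : M) (v : M.Model) {w : M.Model} (hw : w.2 = 0) :
    form g x (normalProj g x v) (normalProj g x v) ≤ form g x (v - w) (v - w) :=
  form_normalProjection_le (b := form g x) (W := M.leafTangent x) v hw

/-- Minimality with `w = v`. This is the reason why leafwise curves have the same length at all
heights. -/
theorem form_normalProj_eq_zero (g : M.Metric) (x : M) {v : M.Model} (hv : v.2 = 0) :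
    form g x (normalProj g x v) (normalProj g x v) = 0 :=
  le_antisymm ((form_normalProj_le g x v hv).trans_eq (by simp)) (form_nonneg _ _ _)

/-- The square of the norm of a vector with respect to the cone metric. -/
noncomputable def coneSq (g : M.Metric) (t : ℝ) (x : M) (r : ℝ) (v : M.Model) : ℝ :=
  r * r + form g x v v + t ^ 2 * form g x (normalProj g x v) (normalProj g x v)

theorem coneMetric_inner_self (g : M.Metric) (z : M.Cone)
    (v : EuclideanSpace ℝ (Fin 1) × M.Model) :
    (coneMetric g).inner z v v = coneSq g (z.1.1 0) z.2 (v.1 0) v.2 :=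
  coneForm_apply _ _ _ _ _

/-- Let `P` be the normal projection. The vectors `A v` and `A (P v)` differ by a leafwise vector,
so the normal part of `A v` is no longer than `A (P v)`, hence than `L` times the length of `P v`.
The factor `t²` passes through the estimate, and `1 ≤ L` takes care of the vertical term. -/
theorem coneSq_map_le {g : M.Metric} {h : N.Metric} {x : M} {y : N}
    {A : M.Model →L[ℝ] N.Model} (hA : ∀ v, v.2 = 0 → (A v).2 = 0) {L : ℝ} (hL1 : 1 ≤ L)
    (hL : ∀ v, form h y (A v) (A v) ≤ L ^ 2 * form g x v v) (t r : ℝ) (v : M.Model) :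
    coneSq h t y r (A v) ≤ L ^ 2 * coneSq g t x r v := by
  have h1 := hL v
  have h2 := form_normalProj_le h y (A v) (hA _ (sub_normalProj_snd g x v))
  rw [← map_sub, sub_sub_cancel] at h2
  have h3 := mul_le_mul_of_nonneg_left (h2.trans (hL _)) (sq_nonneg t)
  have h4 : r * r ≤ L ^ 2 * (r * r) :=
    le_mul_of_one_le_left (mul_self_nonneg r) (by nlinarith)
  unfold coneSq
  nlinarith

/-- A crude bound which deteriorates with `t`. It serves only for the topology of the cone and the
finiteness of the distance. -/
theorem coneSq_le (g : M.Metric) (t : ℝ) (x : M) (v : M.Model) :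
    coneSq g t x 0 v ≤ (1 + t ^ 2) * form g x v v := by
  have h2 := form_normalProj_le g x v (w := 0) rfl
  rw [sub_zero] at h2
  have := mul_le_mul_of_nonneg_left h2 (sq_nonneg t)
  unfold coneSq
  nlinarith

theorem form_le_coneSq (g : M.Metric) (t : ℝ) (x : M) (r : ℝ) (v : M.Model) :
    form g x v v ≤ coneSq g t x r v := by
  have := mul_nonneg (sq_nonneg t) (form_nonneg g x (normalProj g x v))
  have := mul_self_nonneg r
  unfold coneSq
  nlinarith

theorem sq_le_coneSq (g : M.Metric) (t : ℝ) (x : M) (r : ℝ) (v : M.Model) :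
    r * r ≤ coneSq g t x r v := by
  have := mul_nonneg (sq_nonneg t) (form_nonneg g x (normalProj g x v))
  have := form_nonneg g x v
  unfold coneSq
  nlinarith

/-! ### Comparison of the cone distance with heights and with the distance of `M` -/

/-- The Riemannian distance on the compact manifold `M`. -/
noncomputable def metricEDist (g : M.Metric) (x y : M) : ℝ≥0∞ := g.toRiemannianMetric.eDist x y

theorem metricEDist_snd_le (g : M.Metric) (z z' : M.Cone) :
    metricEDist g z.2 z'.2 ≤ coneEDist g z z' := by
  have := Bundle.RiemannianMetric.eDist_le_mul_eDist (R := coneMetric g)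
    (R' := g.toRiemannianMetric) (f := (Prod.snd : M.Cone → M)) (L := 1) one_ne_zero contMDiff_snd
    (fun z v => by
      rw [mfderiv_snd]
      have := form_le_coneSq g (z.1.1 0) z.2 ((v.1 : EuclideanSpace ℝ (Fin 1)) 0) v.2
      rw [← coneMetric_inner_self g z v] at this
      rw [NNReal.coe_one, one_pow, one_mul]
      exact this) z z'
  rw [ENNReal.coe_one, one_mul] at this
  exact this

theorem edist_height_le (g : M.Metric) (z z' : M.Cone) :
    edist (z.1.1 0) (z'.1.1 0) ≤ coneEDist g z z' := by
  let e : EuclideanSpace ℝ (Fin 1) →L[ℝ] ℝ := EuclideanSpace.proj (𝕜 := ℝ) (0 : Fin 1)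
  -- Read through the model with corners, the height is a linear functional, which is its own
  -- derivative.
  have hd : ∀ z : M.Cone, HasMFDerivAt M.coneI 𝓘(ℝ, ℝ) (fun z : M.Cone => e ((𝓡∂ 1) z.1)) z
      (e.comp (ContinuousLinearMap.fst ℝ (EuclideanSpace ℝ (Fin 1)) M.Model)) := by
    intro z
    exact e.hasMFDerivAt.comp z ((ModelWithCorners.hasMFDerivAt (𝓡∂ 1)).comp z
      (hasMFDerivAt_fst z))
  have := Bundle.RiemannianMetric.eDist_le_mul_eDist (R := coneMetric g)
    (R' := (riemannianMetricVectorSpace ℝ).toRiemannianMetric)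
    (f := fun z : M.Cone => e ((𝓡∂ 1) z.1)) (L := 1) one_ne_zero
    (e.contMDiff.comp ((ModelWithCorners.contMDiff (𝓡∂ 1)).comp contMDiff_fst))
    (fun z v => by
      rw [(hd z).mfderiv]
      have := sq_le_coneSq g (z.1.1 0) z.2 ((v.1 : EuclideanSpace ℝ (Fin 1)) 0) v.2
      rw [← coneMetric_inner_self g z v] at this
      rw [NNReal.coe_one, one_pow, one_mul]
      refine Eq.trans_le ?_ this
      exact real_inner_self_eq_norm_mul_norm (F := ℝ) _ |>.trans
        (abs_mul_abs_self ((v.1 : EuclideanSpace ℝ (Fin 1)) 0))) z z'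
  rw [ENNReal.coe_one, one_mul] at this
  rw [IsRiemannianManifold.out (I := 𝓘(ℝ, ℝ))]
  exact this

theorem coneEDist_slice_le (g : M.Metric) (t : EuclideanHalfSpace 1) (x y : M) {L : ℝ≥0}
    (hL : 1 + (t.1 0) ^ 2 ≤ L ^ 2) :
    coneEDist g (t, x) (t, y) ≤ L * metricEDist g x y := by
  have hL0 : L ≠ 0 := by
    rintro rfl
    have := sq_nonneg (t.1 0)
    norm_num at hL
    linarith
  refine Bundle.RiemannianMetric.eDist_le_mul_eDist (R := g.toRiemannianMetric)
    (R' := coneMetric g) (f := fun x : M => ((t, x) : M.Cone)) hL0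
    (contMDiff_const.prodMk contMDiff_id) (fun x v => ?_) x y
  rw [mfderiv_prod_right]
  refine (coneMetric_inner_self g (t, x) (0, v)).trans_le ?_
  refine (coneSq_le g _ x v).trans ?_
  exact mul_le_mul_of_nonneg_right hL (form_nonneg g x v)

/-- The vertical path in the cone. -/
noncomputable def verticalPath (x : M) (r : ℝ) : M.Cone :=
  ((𝓡∂ 1).symm (EuclideanSpace.single 0 r), x)

theorem contMDiffOn_verticalPath (x : M) :
    ContMDiffOn 𝓘(ℝ, ℝ) M.coneI 1 (verticalPath x) (Ici 0) := by
  refine ContMDiffOn.prodMk ?_ contMDiffOn_const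
  refine (ModelWithCorners.contMDiffOn_symm (𝓡∂ 1)).comp (t := range (𝓡∂ 1))
    (f := fun r : ℝ => EuclideanSpace.single (0 : Fin 1) r) ?_ ?_
  · refine ContMDiff.contMDiffOn (contMDiff_iff_contDiff.2 ?_)
    rw [contDiff_euclidean]
    intro i
    rw [Subsingleton.elim i 0]
    simp only [PiLp.single_apply, if_true]
    exact contDiff_id
  · intro r hr
    rw [mem_preimage, range_modelWithCornersEuclideanHalfSpace]
    simpa using hr

theorem verticalPath_fst {x : M} {r : ℝ} (hr : 0 ≤ r) :
    (verticalPath x r).1.1 0 = r := by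
  have := (𝓡∂ 1).right_inv (x := EuclideanSpace.single (0 : Fin 1) r) (by
    rw [range_modelWithCornersEuclideanHalfSpace]
    simpa using hr)
  have := congrArg (fun v : EuclideanSpace ℝ (Fin 1) => v 0) this
  rw [PiLp.single_apply, if_pos rfl] at this
  exact this

theorem EuclideanHalfSpace.ext_one {t t' : EuclideanHalfSpace 1} (h : t.1 0 = t'.1 0) : t = t' := by
  refine EuclideanHalfSpace.ext _ _ ?_
  ext i
  rw [Subsingleton.elim i 0, h]

theorem verticalPath_height (t : EuclideanHalfSpace 1) (x : M) :
    verticalPath x (t.1 0) = (t, x) :=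
  Prod.ext (EuclideanHalfSpace.ext_one (verticalPath_fst t.2)) rfl

theorem coneEDist_vertical_le (g : M.Metric) (t t' : EuclideanHalfSpace 1) (x : M) :
    coneEDist g (t, x) (t', x) ≤ edist (t.1 0) (t'.1 0) := by
  wlog h : t.1 0 ≤ t'.1 0 generalizing t t'
  · rw [coneEDist_comm, edist_comm]
    exact this _ _ (le_of_not_ge h)
  have hc := (contMDiffOn_verticalPath x).mono
    (Icc_subset_Ici_self.trans (Ici_subset_Ici.2 t.2) : Icc (t.1 0) (t'.1 0) ⊆ Ici 0)
  have h1 := Bundle.RiemannianMetric.eDist_le_length (R := coneMetric g) h hc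
  rw [verticalPath_height, verticalPath_height] at h1
  refine h1.trans ?_
  have h2 := Bundle.RiemannianMetric.length_le_of_sqSpeed_le (R := coneMetric g)
    (c := verticalPath x) (a := t.1 0) (b := t'.1 0) (C := 1) ?_
  · rw [ENNReal.coe_one, one_mul] at h2
    rwa [edist_comm, edist_dist, Real.dist_eq, abs_of_nonneg (sub_nonneg.2 h)]
  · intro s hs
    have hs0 : 0 < s := lt_of_le_of_lt t.2 hs.1
    have hd := Bundle.RiemannianMetric.mdifferentiableAt_of_mem_Ioo hc hs
    let e : EuclideanSpace ℝ (Fin 1) →L[ℝ] ℝ := EuclideanSpace.proj (𝕜 := ℝ) (0 : Fin 1)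
    -- The velocity is read off from its two projections: near `s` the height along the path is the
    -- parameter itself, and the component in `M` is constant. Uniqueness of derivatives gives `1`
    -- and `0`.
    have e1 : HasMFDerivAt M.coneI 𝓘(ℝ, ℝ) (fun z : M.Cone => e ((𝓡∂ 1) z.1)) (verticalPath x s)
        (e.comp (ContinuousLinearMap.fst ℝ (EuclideanSpace ℝ (Fin 1)) M.Model)) :=
      e.hasMFDerivAt.comp _ ((ModelWithCorners.hasMFDerivAt (𝓡∂ 1)).comp _
        (hasMFDerivAt_fst _))
    have e2 := (e1.comp s hd.hasMFDerivAt).congr_of_eventuallyEq (f₁ := fun r => r) (by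
      filter_upwards [Ioi_mem_nhds hs0] with r hr
      exact (verticalPath_fst (x := x) (le_of_lt hr)).symm)
    have e3 := hasMFDerivAt_unique e2 (hasMFDerivAt_id s)
    have e4 := congrArg (fun A : ℝ →L[ℝ] ℝ => A 1) e3
    have f1 : HasMFDerivAt M.coneI M.I (Prod.snd : M.Cone → M) (verticalPath x s) _ :=
      hasMFDerivAt_snd _
    have f3 := hasMFDerivAt_unique (f1.comp s hd.hasMFDerivAt) (hasMFDerivAt_const x s)
    have f4 := congrArg (fun A : ℝ →L[ℝ] M.Model => A 1) f3
    set v : EuclideanSpace ℝ (Fin 1) × M.Model :=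
      mfderiv 𝓘(ℝ, ℝ) M.coneI (verticalPath x) s (1 : ℝ) with hv
    have e5 : v.1 0 = 1 := e4
    have f5 : v.2 = 0 := f4
    refine (coneMetric_inner_self g _ v).trans_le ?_
    rw [e5, f5, coneSq]
    simp

theorem coneEDist_le (g : M.Metric) (t t' : EuclideanHalfSpace 1) (x y : M) {L : ℝ≥0}
    (hL : 1 + (t.1 0) ^ 2 ≤ L ^ 2) :
    coneEDist g (t, x) (t', y) ≤ edist (t.1 0) (t'.1 0) + L * metricEDist g x y := by
  rw [add_comm]
  exact (coneEDist_triangle g _ (t, y) _).trans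
    (add_le_add (coneEDist_slice_le g t x y hL) (coneEDist_vertical_le g t t' y))

/-! ### The topology of the cone, finiteness of the distance, and metrizability -/

/-- The extended metric on `M` given by a Riemannian metric. -/
noncomputable abbrev emetricSpace (g : M.Metric) : PseudoEMetricSpace M :=
  letI : RiemannianBundle (fun x : M => TangentSpace M.I x) := 
    ⟨g.toContinuousRiemannianMetric.toRiemannianMetric⟩
  PseudoEMetricSpace.ofRiemannianMetric M.I M

theorem nhds_basis_metricEDist (g : M.Metric) (x : M) :
    (𝓝 x).HasBasis (fun c : ℝ≥0∞ => 0 < c) fun c => {y | metricEDist g x y < c} := by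
  have := @Metric.nhds_basis_eball M (emetricSpace g) x
  convert this using 2 with c
  ext y
  exact iff_of_eq (congrArg (· < c) (@edist_comm M (emetricSpace g) x y))

/-- The ball of infinite radius is open and closed. -/
theorem metricEDist_lt_top (g : M.Metric) [ConnectedSpace M] (x y : M) :
    metricEDist g x y < ⊤ := by
  let := emetricSpace g
  have h : IsClopen (Metric.eball x ⊤) := ⟨Metric.isClosed_eball_top, by exact Metric.isOpen_eball⟩
  have h2 := h.eq_univ ⟨x, Metric.mem_eball_self (by simp)⟩
  have h3 : y ∈ Metric.eball x ⊤ := h2 ▸ mem_univ y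
  rw [Metric.mem_eball, edist_comm] at h3
  exact h3

theorem exists_slice_const (t : ℝ) : ∃ L : ℝ≥0, L ≠ 0 ∧ 1 + t ^ 2 ≤ (L : ℝ) ^ 2 := by
  have h : (0 : ℝ) < 1 + t ^ 2 := by positivity
  refine ⟨(1 + t ^ 2).toNNReal, (Real.toNNReal_pos.2 h).ne', ?_⟩
  rw [Real.coe_toNNReal _ h.le]
  nlinarith [sq_nonneg t]

theorem coneEDist_lt_top (g : M.Metric) [ConnectedSpace M] (z z' : M.Cone) :
    coneEDist g z z' < ⊤ := by
  obtain ⟨L, -, hL⟩ := exists_slice_const (z.1.1 0)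
  refine (coneEDist_le g z.1 z'.1 z.2 z'.2 hL).trans_lt ?_
  exact ENNReal.add_lt_top.2 ⟨edist_lt_top _ _,
    ENNReal.mul_lt_top ENNReal.coe_lt_top (metricEDist_lt_top g _ _)⟩

theorem isInducing_height : IsInducing fun t : EuclideanHalfSpace 1 => t.1 0 :=
  (((EuclideanSpace.equiv (Fin 1) ℝ).toHomeomorph.trans
    (Homeomorph.funUnique (Fin 1) ℝ)).isInducing).comp IsInducing.subtypeVal

/-- The cone distance induces the product topology: it dominates the distances of the two factors,
and conversely `coneEDist_le` bounds it by them with a constant depending only on the height of the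
centre `z`. -/
theorem nhds_basis_coneEDist (g : M.Metric) (z : M.Cone) :
    (𝓝 z).HasBasis (fun c : ℝ≥0∞ => 0 < c) fun c => {y | coneEDist g z y < c} := by
  have hz : (𝓝 z).HasBasis (fun c : ℝ≥0∞ × ℝ≥0∞ => 0 < c.1 ∧ 0 < c.2) fun c =>
      {y : M.Cone | edist (z.1.1 0) (y.1.1 0) < c.1 ∧ metricEDist g z.2 y.2 < c.2} := by
    have h1 : (𝓝 z.1).HasBasis (fun c : ℝ≥0∞ => 0 < c)
        fun c => {t | edist (z.1.1 0) (t.1 0) < c} := by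
      rw [isInducing_height.nhds_eq_comap]
      convert Metric.nhds_basis_eball.comap (fun t : EuclideanHalfSpace 1 => t.1 0) using 2
        with c
      ext t
      exact iff_of_eq (congrArg (· < c) (edist_comm _ _))
    rw [← Prod.mk.eta (p := z), nhds_prod_eq]
    exact h1.prod (nhds_basis_metricEDist g z.2)
  obtain ⟨L, hL0, hL⟩ := exists_slice_const (z.1.1 0)
  refine hz.to_hasBasis' (fun c hc => ⟨min c.1 c.2, lt_min hc.1 hc.2, fun y hy => ⟨?_, ?_⟩⟩)
    fun c hc => ?_
  · exact (edist_height_le g z y).trans_lt (hy.trans_le (min_le_left _ _))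
  · exact (metricEDist_snd_le g z y).trans_lt (hy.trans_le (min_le_right _ _))
  · have hL0' : (L : ℝ≥0∞) ≠ 0 := by simpa using hL0
    refine mem_of_superset (hz.mem_of_mem (i := (c / 2, c / 2 / L))
      ⟨ENNReal.half_pos hc.ne', ENNReal.div_pos (ENNReal.half_pos hc.ne').ne' (by simp)⟩) ?_
    rintro y ⟨h1, h2⟩
    refine (coneEDist_le g z.1 y.1 z.2 y.2 hL).trans_lt ?_
    rw [← ENNReal.add_halves c]
    refine ENNReal.add_lt_add h1 ?_
    rw [mul_comm]
    exact ENNReal.mul_lt_of_lt_div h2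

/-- The extended metric on the cone. -/
noncomputable abbrev coneEMetricSpace (g : M.Metric) : EMetricSpace M.Cone :=
  letI : PseudoEMetricSpace M.Cone := PseudoEMetricSpace.ofEDistOfTopology (coneEDist g)
    (coneEDist_self g) (coneEDist_comm g) (coneEDist_triangle g) (nhds_basis_coneEDist g)
  haveI : T0Space (EuclideanHalfSpace 1) := t0Space_of_injective_of_continuous
    (fun _ _ h => EuclideanHalfSpace.ext_one h) isInducing_height.continuous
  EMetricSpace.ofT0PseudoEMetricSpace M.Cone

theorem isCompact_height_le (M : CompactFoliation.{u}) (r : ℝ) :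
    IsCompact {z : M.Cone | z.1.1 0 ≤ r} := by
  have h : IsCompact {t : EuclideanHalfSpace 1 | t.1 0 ≤ r} := by
    have h1 : Continuous fun s : ℝ => (𝓡∂ 1).symm (EuclideanSpace.single (0 : Fin 1) s) := by
      refine (𝓡∂ 1).continuous_symm.comp ?_
      exact (EuclideanSpace.equiv (Fin 1) ℝ).symm.continuous.comp
        (continuous_pi fun i => by
          rw [Subsingleton.elim i 0]
          simp only [Pi.single_apply, if_true]
          exact continuous_id)
    refine (isCompact_Icc.image h1 (s := Icc 0 r)).of_isClosed_subset
      (isClosed_le isInducing_height.continuous continuous_const) fun t ht => ?_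
    refine ⟨t.1 0, ⟨t.2, ht⟩, ?_⟩
    refine (congrArg (𝓡∂ 1).symm ?_).trans ((𝓡∂ 1).left_inv t)
    ext i
    rw [Subsingleton.elim i 0, PiLp.single_apply, if_pos rfl]
    rfl
  convert h.prod (isCompact_univ (X := M)) using 1
  ext z
  simp

/-- Properness holds because the distance dominates the difference of heights: a closed ball lies in
a set of bounded height, which is compact since `M` is. -/
theorem isMetrizable_foliatedCone (g : M.Metric) :
    CoarseSpace.IsMetrizable (foliatedCone g) := by
  refine ⟨coneEMetricSpace g, rfl, fun E => by rfl, fun x R => ?_⟩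
  refine (isCompact_height_le M (x.1.1 0 + R)).of_isClosed_subset
    (@Metric.isClosed_closedEBall M.Cone (coneEMetricSpace g).toPseudoEMetricSpace x R) fun y hy => ?_
  have h := (edist_height_le g y x).trans hy
  rw [edist_dist, Real.dist_eq] at h
  have h2 := (ENNReal.ofReal_le_iff_le_toReal ENNReal.coe_ne_top).1 h
  have := (abs_le.1 h2).2
  simp only [ENNReal.coe_toReal] at this
  change y.1.1 0 ≤ _
  linarith

/-! ### Riemannian metrics and leaf tangent spaces in foliation charts -/

/-- The derivative of a chart. -/
noncomputable def chartDeriv (φ : OpenPartialHomeomorph M M.Model) (x : M) : M.Model →L[ℝ] M.Model :=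
  mfderiv M.I 𝓘(ℝ, M.Model) φ x

section

attribute [local instance] normedAddCommGroupTangentSpaceVectorSpace
  normedSpaceTangentSpaceVectorSpace

theorem norm_sq_tangentSpace (g : M.Metric) (x : M) (v : TangentSpace M.I x) :
    letI : RiemannianBundle (fun x : M => TangentSpace M.I x) :=
      ⟨g.toContinuousRiemannianMetric.toRiemannianMetric⟩
    ‖v‖ ^ 2 = g.inner x v v := by
  let : RiemannianBundle (fun x : M => TangentSpace M.I x) :=
    ⟨g.toContinuousRiemannianMetric.toRiemannianMetric⟩
  exact (real_inner_self_eq_norm_sq v).symm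

/-- Near `x₀` the Riemannian norm and the norm of the model space, read in the preferred chart at
`x₀`, bound each other. This is one direction; `eventually_form_le` is the other. -/
theorem eventually_sq_norm_chartDeriv_le (g : M.Metric) (x₀ : M) :
    ∃ C : ℝ≥0, ∀ᶠ x in 𝓝 x₀, ∀ v : M.Model,
      ‖chartDeriv (chartAt M.Model x₀) x v‖ ^ 2 ≤ C * form g x v v := by
  let : RiemannianBundle (fun x : M => TangentSpace M.I x) :=
    ⟨g.toContinuousRiemannianMetric.toRiemannianMetric⟩
  obtain ⟨C, hC, h⟩ := eventually_norm_mfderiv_extChartAt_lt M.I x₀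
  refine ⟨(C ^ 2).toNNReal, h.mono fun x hx (v : TangentSpace M.I x) => ?_⟩
  have h1 := (mfderiv M.I 𝓘(ℝ, M.Model) (extChartAt M.I x₀) x).le_of_opNorm_le hx.le v
  have h3 := (pow_le_pow_left₀ (norm_nonneg _) h1 2).trans_eq
    ((mul_pow _ _ 2).trans (congrArg (C ^ 2 * ·) (norm_sq_tangentSpace g x v)))
  rw [Real.coe_toNNReal _ (sq_nonneg C)]
  exact h3

theorem eventually_form_le (g : M.Metric) (x₀ : M) :
    ∃ C : ℝ≥0, ∀ᶠ x in 𝓝 x₀, ∀ v : M.Model,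
      form g x v v ≤ C * ‖chartDeriv (chartAt M.Model x₀) x v‖ ^ 2 := by
  let : RiemannianBundle (fun x : M => TangentSpace M.I x) :=
    ⟨g.toContinuousRiemannianMetric.toRiemannianMetric⟩
  obtain ⟨C, hC, h⟩ := eventually_norm_mfderivWithin_symm_extChartAt_comp_lt M.I x₀
  refine ⟨(C ^ 2).toNNReal, ?_⟩
  filter_upwards [h, chart_source_mem_nhds M.Model x₀] with x hx hx' (v : TangentSpace M.I x)
  have hx'' : x ∈ (extChartAt M.I x₀).source := by rwa [extChartAt_source]
  -- The derivatives of the chart and of its inverse cancel, so `v` is recovered from its image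
  -- under the derivative of the chart.
  have h0 := congrArg (fun A : M.Model →L[ℝ] M.Model => A v)
    (mfderivWithin_extChartAt_symm_comp_mfderiv_extChartAt' hx'')
  have hl : (extChartAt M.I x₀).symm (extChartAt M.I x₀ x) = x := (extChartAt M.I x₀).left_inv hx''
  rw [Real.coe_toNNReal _ (sq_nonneg C)]
  have h1 := (mfderivWithin 𝓘(ℝ, M.Model) M.I (extChartAt M.I x₀).symm (range M.I)
    (extChartAt M.I x₀ x)).le_of_opNorm_le hx.le
    ((mfderiv M.I 𝓘(ℝ, M.Model) (extChartAt M.I x₀) x) v)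
  have h3 := (norm_sq_tangentSpace g _ _).symm.trans_le
    ((pow_le_pow_left₀ (norm_nonneg _) h1 2).trans_eq (mul_pow _ _ 2))
  rw [hl] at h3
  refine Eq.trans_le ?_ h3
  exact congrArg (fun w : M.Model => form g x w w) h0.symm

end

theorem mem_maximalAtlas {φ : OpenPartialHomeomorph M M.Model} (hφ : φ ∈ atlas M.Model M) :
    φ ∈ IsManifold.maximalAtlas M.I ∞ M :=
  IsManifold.subset_maximalAtlas hφ

theorem mdifferentiableAt_chart {φ : OpenPartialHomeomorph M M.Model}
    (hφ : φ ∈ atlas M.Model M) {x : M} (hx : x ∈ φ.source) :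
    MDifferentiableAt M.I 𝓘(ℝ, M.Model) φ x :=
  ((contMDiffOn_of_mem_maximalAtlas (mem_maximalAtlas hφ)).contMDiffAt
    (φ.open_source.mem_nhds hx)).mdifferentiableAt (by simp)

theorem chartDeriv_chartAt (x : M) (v : M.Model) : chartDeriv (chartAt M.Model x) x v = v := by
  have h := mfderiv_chartAt_eq_tangentCoordChange (I := M.I) (x := x) (y := x) (mem_chart_source _ _)
  have h2 := tangentCoordChange_self (I := M.I) (x := x) (z := x) (v := v) (mem_extChartAt_source x)
  exact (congrArg (fun A : M.Model →L[ℝ] M.Model => A v) h).trans h2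

/-- The derivative of a function which is given in a chart. -/
theorem mfderiv_eq_fderiv_comp_chartDeriv {F : Type*} [NormedAddCommGroup F] [NormedSpace ℝ F]
    {f : M → F} {G : M.Model → F} {φ : OpenPartialHomeomorph M M.Model} (hφ : φ ∈ atlas M.Model M)
    {x : M} (hx : x ∈ φ.source) (hG : DifferentiableAt ℝ G (φ x))
    (h : f =ᶠ[𝓝 x] fun y => G (φ y)) (v : M.Model) :
    mfderiv M.I 𝓘(ℝ, F) f x v = fderiv ℝ G (φ x) (chartDeriv φ x v) := by
  have h1 := (hG.hasFDerivAt.hasMFDerivAt.comp x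
    (mdifferentiableAt_chart hφ hx).hasMFDerivAt).congr_of_eventuallyEq h
  exact congrArg (fun A : M.Model →L[ℝ] F => A v) h1.mfderiv

/-- Near `p`, `G` is constant on the line through `p` in direction `w`, since the second coordinate
does not change along it. -/
theorem fderiv_eq_zero_of_snd_eq_zero {A B F : Type*} [NormedAddCommGroup A] [NormedSpace ℝ A]
    [NormedAddCommGroup B] [NormedSpace ℝ B] [NormedAddCommGroup F] [NormedSpace ℝ F]
    {G : A × B → F} {p : A × B} (hG : DifferentiableAt ℝ G p)
    (h : ∀ᶠ q in 𝓝 p, q.2 = p.2 → G q = G p) {w : A × B} (hw : w.2 = 0) :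
    fderiv ℝ G p w = 0 := by
  have h1 : HasDerivAt (fun r : ℝ => p + r • w) w 0 := by
    simpa using ((hasDerivAt_id (0 : ℝ)).smul_const w).const_add p
  have h2 : HasDerivAt (fun r : ℝ => G (p + r • w)) (fderiv ℝ G p w) 0 := by
    have : HasFDerivAt G (fderiv ℝ G p) (p + (0 : ℝ) • w) := by simpa using hG.hasFDerivAt
    exact this.comp_hasDerivAt 0 h1
  have h3 : (fun r : ℝ => G (p + r • w)) =ᶠ[𝓝 0] fun _ => G p := by
    have h4 : Tendsto (fun r : ℝ => p + r • w) (𝓝 0) (𝓝 p) := by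
      simpa using h1.continuousAt.tendsto
    filter_upwards [h4.eventually h] with r hr
    exact hr (by simp [hw])
  exact (h2.congr_of_eventuallyEq h3.symm).unique (hasDerivAt_const 0 (G p))

theorem differentiableAt_transition {φ ψ : OpenPartialHomeomorph M M.Model}
    (hφ : φ ∈ atlas M.Model M) (hψ : ψ ∈ atlas M.Model M) {x : M} (hx : x ∈ φ.source)
    (hx' : x ∈ ψ.source) : DifferentiableAt ℝ (fun v => ψ (φ.symm v)) (φ x) :=
  (contDiffAt_transition hφ hψ hx hx').differentiableAt (by simp)

/-- The transverse coordinate of `ψ` is locally a function of that of `φ`, so it is constant along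
the plaques of `φ`. -/
theorem chartDeriv_snd_eq_zero {φ ψ : OpenPartialHomeomorph M M.Model}
    (hφ : φ ∈ atlas M.Model M) (hψ : ψ ∈ atlas M.Model M) {x : M} (hx : x ∈ φ.source)
    (hx' : x ∈ ψ.source) {v : M.Model} (hv : (chartDeriv φ x v).2 = 0) :
    (chartDeriv ψ x v).2 = 0 := by
  have hG := differentiableAt_transition hφ hψ hx hx'
  have h1 : ψ =ᶠ[𝓝 x] fun y => ψ (φ.symm (φ y)) := by
    filter_upwards [φ.open_source.mem_nhds hx] with y hy
    rw [φ.left_inv hy]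
  have h2 : chartDeriv ψ x v = _ := mfderiv_eq_fderiv_comp_chartDeriv hφ hx hG h1 v
  rw [h2]
  have h3 : (fderiv ℝ (fun v => ψ (φ.symm v)) (φ x) (chartDeriv φ x v)).2 =
      fderiv ℝ (fun v => (ψ (φ.symm v)).2) (φ x) (chartDeriv φ x v) := by
    rw [(hG.hasFDerivAt.snd).fderiv]
    rfl
  rw [h3]
  refine fderiv_eq_zero_of_snd_eq_zero hG.snd ?_ hv
  obtain ⟨k, hk⟩ := M.foliated φ hφ ψ hψ x ⟨hx, hx'⟩
  have h4 := hk.self_of_nhds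
  filter_upwards [(tendsto_symm φ hx).eventually hk, φ.open_target.mem_nhds (φ.map_source hx)]
    with q hq hq' he
  rw [hq, φ.right_inv hq', φ.left_inv hx, h4, he]

/-- Both directions compare `φ` with the preferred chart at `x`, through which the tangent space is
identified with the model space and whose derivative at `x` is therefore the identity. -/
theorem chartDeriv_snd_eq_zero_iff {φ : OpenPartialHomeomorph M M.Model}
    (hφ : φ ∈ atlas M.Model M) {x : M} (hx : x ∈ φ.source) (v : M.Model) :
    (chartDeriv φ x v).2 = 0 ↔ v.2 = 0 := by
  constructor <;> intro h
  · have := chartDeriv_snd_eq_zero hφ (chart_mem_atlas M.Model x) hx (mem_chart_source _ _) h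
    rwa [chartDeriv_chartAt] at this
  · refine chartDeriv_snd_eq_zero (chart_mem_atlas M.Model x) hφ (mem_chart_source _ _) hx ?_
    rwa [chartDeriv_chartAt]

/-! ### Derivatives of maps between foliations -/

/-- The derivative of a map between foliated manifolds as a map between the model spaces. -/
noncomputable def modelDeriv (f : M → N) (x : M) : M.Model →L[ℝ] N.Model := mfderiv M.I N.I f x

theorem chartDeriv_modelDeriv {f : M → N} {x : M} (hf : ContMDiffAt M.I N.I 1 f x)
    {φ : OpenPartialHomeomorph M M.Model} (hφ : φ ∈ atlas M.Model M) (hx : x ∈ φ.source)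
    {ψ : OpenPartialHomeomorph N N.Model} (hψ : ψ ∈ atlas N.Model N) (hx' : f x ∈ ψ.source)
    (v : M.Model) :
    ContDiffAt ℝ 1 (fun q => ψ (f (φ.symm q))) (φ x) ∧
    chartDeriv ψ (f x) (modelDeriv f x v) =
      fderiv ℝ (fun q => ψ (f (φ.symm q))) (φ x) (chartDeriv φ x v) := by
  have h1 : ContMDiffAt M.I 𝓘(ℝ, N.Model) 1 (fun y => ψ (f y)) x :=
    (((contMDiffOn_of_mem_maximalAtlas (mem_maximalAtlas hψ)).contMDiffAt
      (ψ.open_source.mem_nhds hx')).of_le (by norm_num)).comp x hf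
  have h2 : ContMDiffAt 𝓘(ℝ, M.Model) M.I 1 φ.symm (φ x) :=
    ((contMDiffOn_symm_of_mem_maximalAtlas (mem_maximalAtlas hφ)).contMDiffAt
      (φ.open_target.mem_nhds (φ.map_source hx))).of_le (by norm_num)
  have h3 : ContDiffAt ℝ 1 (fun q => ψ (f (φ.symm q))) (φ x) := by
    refine contMDiffAt_iff_contDiffAt.1 (ContMDiffAt.comp (φ x) (g := fun y => ψ (f y)) ?_ h2)
    rwa [φ.left_inv hx]
  refine ⟨h3, ?_⟩
  have h4 := mfderiv_eq_fderiv_comp_chartDeriv hφ hx (h3.differentiableAt (by simp))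
    (f := fun y => ψ (f y)) (by
      filter_upwards [φ.open_source.mem_nhds hx] with y hy
      rw [φ.left_inv hy]) v
  have h5 := (mdifferentiableAt_chart hψ hx').hasMFDerivAt.comp x
    (hf.mdifferentiableAt one_ne_zero).hasMFDerivAt
  exact (congrArg (fun A : M.Model →L[ℝ] N.Model => A v) h5.mfderiv).symm.trans h4

/-- Only the plaque through `x` matters: the transverse component of `f` is constant on it near `x`,
so its derivative kills horizontal vectors. -/
theorem modelDeriv_snd_eq_zero {f : M → N} {x : M} (hf : ContMDiffAt M.I N.I 1 f x)
    {φ : OpenPartialHomeomorph M M.Model} (hφ : φ ∈ atlas M.Model M) (hx : x ∈ φ.source)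
    {ψ : OpenPartialHomeomorph N N.Model} (hψ : ψ ∈ atlas N.Model N) (hx' : f x ∈ ψ.source)
    (h : ∀ᶠ y in 𝓝 x, (φ y).2 = (φ x).2 → (ψ (f y)).2 = (ψ (f x)).2) {v : M.Model}
    (hv : v.2 = 0) : (modelDeriv f x v).2 = 0 := by
  obtain ⟨h1, h2⟩ := chartDeriv_modelDeriv hf hφ hx hψ hx' v
  rw [← chartDeriv_snd_eq_zero_iff hψ hx', h2]
  have hG := h1.differentiableAt (by simp)
  have h3 : (fderiv ℝ (fun q => ψ (f (φ.symm q))) (φ x) (chartDeriv φ x v)).2 =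
      fderiv ℝ (fun q => (ψ (f (φ.symm q))).2) (φ x) (chartDeriv φ x v) := by
    rw [(hG.hasFDerivAt.snd).fderiv]
    rfl
  rw [h3]
  refine fderiv_eq_zero_of_snd_eq_zero hG.snd ?_ ((chartDeriv_snd_eq_zero_iff hφ hx v).2 hv)
  filter_upwards [(tendsto_symm φ hx).eventually h, φ.open_target.mem_nhds (φ.map_source hx)]
    with q hq hq' he
  rw [φ.left_inv hx]
  refine hq ?_
  rw [φ.right_inv hq', he]

/-- In preferred charts at `x₀` and `f x₀` both metrics are comparable to the norms of the model
spaces, and the derivative of `f` is continuous at `x₀`, hence bounded nearby. -/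
theorem eventually_form_modelDeriv_le (g : M.Metric) (h : N.Metric) {f : M → N} {x₀ : M}
    (hf : ∀ᶠ x in 𝓝 x₀, ContMDiffAt M.I N.I 1 f x) :
    ∃ L : ℝ≥0, ∀ᶠ x in 𝓝 x₀, ∀ v : M.Model,
      form h (f x) (modelDeriv f x v) (modelDeriv f x v) ≤ L * form g x v v := by
  have hf' := hf.self_of_nhds
  set φ := chartAt M.Model x₀
  set ψ := chartAt N.Model (f x₀)
  obtain ⟨C, hC⟩ := eventually_sq_norm_chartDeriv_le g x₀
  obtain ⟨C', hC'⟩ := eventually_form_le h (f x₀)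
  have hx₀ : x₀ ∈ φ.source := mem_chart_source _ _
  have hG := (chartDeriv_modelDeriv hf' (chart_mem_atlas M.Model x₀) hx₀
    (chart_mem_atlas N.Model (f x₀)) (mem_chart_source _ _) 0).1
  have hK : ∀ᶠ q in 𝓝 (φ x₀), ‖fderiv ℝ (fun q => ψ (f (φ.symm q))) q‖ <
      ‖fderiv ℝ (fun q => ψ (f (φ.symm q))) (φ x₀)‖ + 1 := by
    have := ((hG.fderiv_right (m := 0) (by norm_num)).continuousAt.norm).eventually_lt
      (continuousAt_const (y := ‖fderiv ℝ (fun q => ψ (f (φ.symm q))) (φ x₀)‖ + 1))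
      (lt_add_one _)
    exact this
  set K := ‖fderiv ℝ (fun q => ψ (f (φ.symm q))) (φ x₀)‖ + 1 with hKdef
  have hK0 : 0 ≤ K := by positivity
  refine ⟨C' * (K.toNNReal ^ 2 * C), ?_⟩
  filter_upwards [hC, hf'.continuousAt.eventually hC', (φ.continuousAt hx₀).eventually hK,
    hf, φ.open_source.mem_nhds hx₀, hf'.continuousAt.eventually
      (ψ.open_source.mem_nhds (mem_chart_source _ _))] with x h1 h2 h3 h4 h5 h6 v
  refine (h2 _).trans ?_
  rw [(chartDeriv_modelDeriv h4 (chart_mem_atlas M.Model x₀) h5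
    (chart_mem_atlas N.Model (f x₀)) h6 v).2]
  push_cast
  rw [mul_assoc, mul_assoc, Real.coe_toNNReal K hK0]
  refine mul_le_mul_of_nonneg_left ?_ C'.2
  refine (pow_le_pow_left₀ (norm_nonneg _) (ContinuousLinearMap.le_of_opNorm_le _ h3.le _) 2).trans ?_
  rw [mul_pow]
  exact mul_le_mul_of_nonneg_left (h1 v) (sq_nonneg K)

end CompactFoliation

/-- Local bounds on a compact set give a global one, because the maximum of two bounds is again a
bound. All uniform constants over compact subsets of `M` arise in this way. -/
theorem IsCompact.exists_nnreal_forall {X : Type*} [TopologicalSpace X] {K : Set X}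
    (hK : IsCompact K) {P : ℝ≥0 → X → Prop} (hP : ∀ x L L', L ≤ L' → P L x → P L' x)
    (h : ∀ x ∈ K, ∃ L, ∀ᶠ y in 𝓝[K] x, P L y) : ∃ L, ∀ x ∈ K, P L x := by
  refine hK.induction_on (p := fun s => ∃ L, ∀ x ∈ s, P L x) ⟨0, by simp⟩
    (fun s t hst ⟨L, hL⟩ => ⟨L, fun x hx => hL x (hst hx)⟩)
    (fun s t ⟨L, hL⟩ ⟨L', hL'⟩ => ⟨max L L', ?_⟩) fun x hx => ?_
  · rintro x (hx | hx)
    · exact hP _ _ _ (le_max_left _ _) (hL x hx)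
    · exact hP _ _ _ (le_max_right _ _) (hL' x hx)
  · obtain ⟨L, hL⟩ := h x hx
    exact ⟨_, hL, L, fun y hy => hy⟩

/-! ### Independence of the coarse structure from the metric -/

namespace CompactFoliation

variable {M N : CompactFoliation.{u}}

/-- By compactness `g'` is bounded by a multiple of `g`. The identity preserves the leaf tangent
spaces, so `coneSq_map_le` carries the bound to all heights at once. -/
theorem coneEDist_le_of_metric (g g' : M.Metric) :
    ∃ L : ℝ≥0, ∀ z z', coneEDist g' z z' ≤ L * coneEDist g z z' := by
  obtain ⟨L, hL⟩ := (isCompact_univ (X := M)).exists_nnreal_forall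
    (P := fun L x => ∀ v : M.Model, form g' x v v ≤ L * form g x v v)
    (fun x L L' h h' v => (h' v).trans
      (mul_le_mul_of_nonneg_right (NNReal.coe_le_coe.2 h) (form_nonneg _ _ _)))
    fun x _ => by
      obtain ⟨L, hL⟩ := eventually_form_modelDeriv_le g g'
        (Eventually.of_forall fun x => contMDiffAt_id (I := M.I) (x := x))
      refine ⟨L, mem_nhdsWithin_of_mem_nhds (hL.mono fun y hy v => ?_)⟩
      have := hy v
      rw [modelDeriv, mfderiv_id] at this
      exact this
  have hL1 : (1 : ℝ) ≤ (L + 1 : ℝ≥0) := by simp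
  -- `L` bounds squares of norms; `L + 1` is at least `1`, and its square is at least `L`.
  refine ⟨L + 1, Bundle.RiemannianMetric.eDist_le_mul_eDist (f := fun z => z) (by simp)
    contMDiff_id fun z v => ?_⟩
  rw [show mfderiv M.coneI M.coneI (fun z : M.Cone => z) z = _ from mfderiv_id]
  refine (coneMetric_inner_self g' z v).trans_le (le_of_le_of_eq ?_
    (congrArg (((L + 1 : ℝ≥0) : ℝ) ^ 2 * ·) (coneMetric_inner_self g z v).symm))
  refine coneSq_map_le (A := ContinuousLinearMap.id ℝ M.Model) (fun v hv => hv) hL1 (fun v => ?_)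
    _ _ _
  refine (hL z.2 (mem_univ _) v).trans (mul_le_mul_of_nonneg_right ?_ (form_nonneg _ _ _))
  push_cast
  nlinarith [L.2]

theorem foliatedCone_eq (g g' : M.Metric) : foliatedCone g = foliatedCone g' := by
  have h : ∀ g g' : M.Metric, ∀ E : Set (M.Cone × M.Cone),
      (∃ R : ℝ≥0, ∀ p ∈ E, coneEDist g p.1 p.2 ≤ R) →
        ∃ R : ℝ≥0, ∀ p ∈ E, coneEDist g' p.1 p.2 ≤ R := by
    rintro g g' E ⟨R, hR⟩
    obtain ⟨L, hL⟩ := coneEDist_le_of_metric g g'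
    refine ⟨L * R, fun p hp => (hL _ _).trans ?_⟩
    push_cast
    exact mul_le_mul_right (hR p hp) _
  unfold foliatedCone
  congr 1
  ext E
  exact ⟨h g g' E, h g' g E⟩

/-! ### Plaques and leafwise paths -/

/-- The velocity within `s` of a path, as an element of the model space. -/
noncomputable def velocityWithin (c : ℝ → M) (s : Set ℝ) (t : ℝ) : M.Model :=
  mfderivWithin 𝓘(ℝ, ℝ) M.I c s t (1 : ℝ)

theorem hasDerivWithinAt_chart_comp {c : ℝ → M} {s : Set ℝ} {t : ℝ}
    (hc : MDifferentiableWithinAt 𝓘(ℝ, ℝ) M.I c s t)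
    {φ : OpenPartialHomeomorph M M.Model} (hφ : φ ∈ atlas M.Model M) (ht : c t ∈ φ.source) :
    HasDerivWithinAt (fun t => φ (c t)) (chartDeriv φ (c t) (velocityWithin c s t)) s t := by
  have h := (mdifferentiableAt_chart hφ ht).hasMFDerivAt.comp_hasMFDerivWithinAt t
    hc.hasMFDerivWithinAt
  have h' : HasFDerivWithinAt (fun t => φ (c t)) ((chartDeriv φ (c t)).comp
    (show ℝ →L[ℝ] M.Model from mfderivWithin 𝓘(ℝ, ℝ) M.I c s t)) s t := h.hasFDerivWithinAt
  exact h'.hasDerivWithinAt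

/-- A velocity tangent to the leaf has no transverse component in any foliation chart, so the
transverse coordinate has derivative zero. -/
theorem IsLeafwiseOn.snd_chart_eq {c : ℝ → M} {a b : ℝ} (hab : a < b)
    (hc : IsLeafwiseOn c (Icc a b)) {φ : OpenPartialHomeomorph M M.Model}
    (hφ : φ ∈ atlas M.Model M) (h : ∀ s ∈ Icc a b, c s ∈ φ.source) :
    ∀ s ∈ Icc a b, (φ (c s)).2 = (φ (c a)).2 := by
  have hd : ∀ s ∈ Icc a b, HasDerivWithinAt (fun s => (φ (c s)).2) 0 (Icc a b) s := by
    intro s hs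
    have h1 := (hasDerivWithinAt_chart_comp ((hc.1 s hs).mdifferentiableWithinAt (by simp))
      hφ (h s hs)).hasFDerivWithinAt.snd.hasDerivWithinAt
    have h2 : (chartDeriv φ (c s) (velocityWithin c (Icc a b) s)).2 = 0 :=
      (chartDeriv_snd_eq_zero_iff hφ (h s hs) _).2 (hc.2 s hs)
    simpa [h2] using h1
  exact constant_of_derivWithin_zero (fun s hs => (hd s hs).differentiableWithinAt)
    fun s hs => (hd s (Ico_subset_Icc_self hs)).derivWithin
      (uniqueDiffOn_Icc hab s (Ico_subset_Icc_self hs))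

theorem IsLeafwisePath.eventually_trans_eq {c : ℝ → M} (hc : IsLeafwisePath c) {t : ℝ}
    (ht : t ∈ Icc (0 : ℝ) 1) :
    ∀ᶠ s in 𝓝[Icc 0 1] t, trans (c t) (c s) = trans (c t) (c t) := by
  obtain ⟨hcont, S, hS, hl⟩ := hc
  have h1 : ∀ᶠ s in 𝓝[Icc 0 1] t, c s ∈ (chartAt M.Model (c t)).source :=
    (hcont t ht).eventually (chart_source_mem_nhds M.Model (c t))
  -- Near `t` the only possible break point is `t` itself, so the open interval between `s` and `t`
  -- contains none.
  have h2 : ∀ᶠ s in 𝓝 t, s ∉ S \ {t} :=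
    (hS.subset sdiff_subset).isClosed.isOpen_compl.eventually_mem (by simp)
  obtain ⟨ε, hε, h3⟩ := Metric.eventually_nhds_iff.1 ((eventually_nhdsWithin_iff.1 h1).and h2)
  refine eventually_nhdsWithin_iff.2 (Metric.eventually_nhds_iff.2 ⟨ε, hε, fun s hs hs' => ?_⟩)
  have key : ∀ a b, 0 ≤ a → a < b → b ≤ 1 → (a = t ∨ b = t) → (∀ r ∈ Icc a b, dist r t < ε) →
      trans (c t) (c b) = trans (c t) (c a) := by
    intro a b ha hab hb hor hr
    refine (hl a b ha hab hb ?_).snd_chart_eq hab (chart_mem_atlas M.Model (c t)) ?_ b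
      (right_mem_Icc.2 hab.le)
    · refine disjoint_left.2 fun r hrS hr' => (h3 (hr r (Ioo_subset_Icc_self hr'))).2 ⟨hrS, ?_⟩
      rintro rfl
      rcases hor with h | h
      · exact hr'.1.ne h
      · exact hr'.2.ne h.symm
    · exact fun r hr' => (h3 (hr r hr')).1 ⟨ha.trans hr'.1, hr'.2.trans hb⟩
  rw [Real.dist_eq, abs_lt] at hs
  rcases lt_trichotomy s t with h | rfl | h
  · refine (key s t hs'.1 h ht.2 (Or.inr rfl) fun r hr => ?_).symm
    rw [Real.dist_eq, abs_lt]
    constructor <;> linarith [hr.1, hr.2]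
  · rfl
  · refine key t s ht.1 h hs'.2 (Or.inl rfl) fun r hr => ?_
    rw [Real.dist_eq, abs_lt]
    constructor <;> linarith [hr.1, hr.2]

/-! ### Closeness uniform in the height, and segments in plaques -/

/-- The points `y` and `z` have distance at most `R` in each slice `{t} × M` of the cone. -/
def SliceClose (g : M.Metric) (R : ℝ≥0) (y z : M) : Prop :=
  ∀ t : EuclideanHalfSpace 1, coneEDist g (t, y) (t, z) ≤ R

theorem SliceClose.mono {g : M.Metric} {R R' : ℝ≥0} {y z : M} (h : SliceClose g R y z)
    (hR : R ≤ R') : SliceClose g R' y z := fun t => (h t).trans (by exact_mod_cast hR)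

theorem SliceClose.trans {g : M.Metric} {R R' : ℝ≥0} {x y z : M} (h : SliceClose g R x y)
    (h' : SliceClose g R' y z) : SliceClose g (R + R') x z := fun t => by
  push_cast
  exact (coneEDist_triangle g _ (t, y) _).trans (add_le_add (h t) (h' t))

/-- The segment in a chart from `y` to `y'`. -/
noncomputable def chartSegment (φ : OpenPartialHomeomorph M M.Model) (y y' : M) (s : ℝ) : M :=
  φ.symm (φ y + s • (φ y' - φ y))

section ChartSegment

variable {φ : OpenPartialHomeomorph M M.Model} {y y' : M}

theorem chartSegment_zero (hy : y ∈ φ.source) : chartSegment φ y y' 0 = y := by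
  simp [chartSegment, φ.left_inv hy]

theorem chartSegment_one (hy : y' ∈ φ.source) : chartSegment φ y y' 1 = y' := by
  simp [chartSegment, φ.left_inv hy]

theorem contMDiffOn_chartSegment (hφ : φ ∈ atlas M.Model M)
    (h : ∀ s ∈ Icc (0 : ℝ) 1, φ y + s • (φ y' - φ y) ∈ φ.target) :
    ContMDiffOn 𝓘(ℝ, ℝ) M.I ∞ (chartSegment φ y y') (Icc 0 1) := by
  have h1 : ContDiff ℝ ∞ fun s : ℝ => φ y + s • (φ y' - φ y) := by fun_prop
  exact (contMDiffOn_symm_of_mem_maximalAtlas (mem_maximalAtlas hφ)).comp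
    h1.contMDiff.contMDiffOn h

theorem chartDeriv_velocityWithin_chartSegment (hφ : φ ∈ atlas M.Model M)
    (h : ∀ s ∈ Icc (0 : ℝ) 1, φ y + s • (φ y' - φ y) ∈ φ.target) {s : ℝ} (hs : s ∈ Icc (0 : ℝ) 1) :
    chartDeriv φ (chartSegment φ y y' s) (velocityWithin (chartSegment φ y y') (Icc 0 1) s) =
      φ y' - φ y := by
  have h1 := hasDerivWithinAt_chart_comp
    ((contMDiffOn_chartSegment hφ h s hs).mdifferentiableWithinAt (by simp)) hφ
    (φ.map_target (h s hs))
  have h2 : HasDerivWithinAt (fun s : ℝ => φ y + s • (φ y' - φ y)) (φ y' - φ y) (Icc 0 1) s := by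
    simpa using (((hasDerivAt_id s).smul_const (φ y' - φ y)).const_add (φ y)).hasDerivWithinAt
  have h3 := h2.congr_of_mem (f₁ := fun s => φ (chartSegment φ y y' s))
    (fun r hr => φ.right_inv (h r hr)) hs
  exact (uniqueDiffOn_Icc zero_lt_one s hs).eq_deriv _ h1 h3

theorem isLeafwiseOn_chartSegment (hφ : φ ∈ atlas M.Model M)
    (h : ∀ s ∈ Icc (0 : ℝ) 1, φ y + s • (φ y' - φ y) ∈ φ.target) (he : (φ y).2 = (φ y').2) :
    IsLeafwiseOn (chartSegment φ y y') (Icc 0 1) := by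
  refine ⟨contMDiffOn_chartSegment hφ h, fun s hs => ?_⟩
  refine (chartDeriv_snd_eq_zero_iff hφ (φ.map_target (h s hs)) _).1 (Eq.trans
    (congrArg Prod.snd (chartDeriv_velocityWithin_chartSegment hφ h hs)) ?_)
  rw [Prod.snd_sub, he, sub_self]

theorem isLeafwisePath_chartSegment (hφ : φ ∈ atlas M.Model M)
    (h : ∀ s ∈ Icc (0 : ℝ) 1, φ y + s • (φ y' - φ y) ∈ φ.target) (he : (φ y).2 = (φ y').2) :
    IsLeafwisePath (chartSegment φ y y') := by
  refine ⟨(contMDiffOn_chartSegment hφ h).continuousOn, ∅, finite_empty, fun a b ha hab hb _ => ?_⟩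
  have h1 := (isLeafwiseOn_chartSegment hφ h he).comp_affine hab 1 0
    fun t ht => ⟨by linarith [ht.1], by linarith [ht.2]⟩
  simpa using h1

/-- The segment is leafwise, so the term `t² g_N` vanishes along it and its speed is at most `√C ‖φ
y' - φ y‖` at every height. The factor `C + 1` dominates the square root. -/
theorem sliceClose_of_chartSegment (g : M.Metric) (hφ : φ ∈ atlas M.Model M)
    (hy : y ∈ φ.source) (hy' : y' ∈ φ.source)
    (h : ∀ s ∈ Icc (0 : ℝ) 1, φ y + s • (φ y' - φ y) ∈ φ.target) (he : (φ y).2 = (φ y').2)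
    {C : ℝ≥0} (hC : ∀ s ∈ Icc (0 : ℝ) 1, ∀ v : M.Model,
      form g (chartSegment φ y y' s) v v ≤ C * ‖chartDeriv φ (chartSegment φ y y' s) v‖ ^ 2) :
    SliceClose g ((C + 1) * ‖φ y' - φ y‖₊) y y' := by
  intro t
  have hc : ContMDiffOn 𝓘(ℝ, ℝ) M.I 1 (chartSegment φ y y') (Icc 0 1) :=
    (contMDiffOn_chartSegment hφ h).of_le (by norm_num)
  have hc' : ContMDiffOn 𝓘(ℝ, ℝ) M.coneI 1 (fun s => ((t, chartSegment φ y y' s) : M.Cone))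
      (Icc 0 1) := contMDiffOn_const.prodMk hc
  have h1 := Bundle.RiemannianMetric.eDist_le_length (R := coneMetric g) zero_le_one hc'
  rw [chartSegment_zero hy, chartSegment_one hy'] at h1
  refine h1.trans ?_
  have h2 := Bundle.RiemannianMetric.length_le_of_sqSpeed_le (R := coneMetric g)
    (c := fun s => ((t, chartSegment φ y y' s) : M.Cone)) (a := 0) (b := 1)
    (C := (C + 1) * ‖φ y' - φ y‖₊) fun s hs => ?_
  · simpa using h2
  · have hs' := Ioo_subset_Icc_self hs
    have hd := Bundle.RiemannianMetric.mdifferentiableAt_of_mem_Ioo hc hs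
    have e1 := hd.hasMFDerivAt
    have e2 := ((hasMFDerivAt_const (I := 𝓘(ℝ, ℝ)) (I' := 𝓡∂ 1) t s).prodMk e1).mfderiv
    have e3 : mfderiv 𝓘(ℝ, ℝ) M.I (chartSegment φ y y') s (1 : ℝ) =
        velocityWithin (chartSegment φ y y') (Icc 0 1) s := by
      rw [velocityWithin, mfderivWithin_of_mem_nhds (Icc_mem_nhds hs.1 hs.2)]
    set v := velocityWithin (chartSegment φ y y') (Icc 0 1) s with hv
    have e4 : mfderiv 𝓘(ℝ, ℝ) M.coneI (fun s => ((t, chartSegment φ y y' s) : M.Cone)) s (1 : ℝ) =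
        ((0, v) : EuclideanSpace ℝ (Fin 1) × M.Model) :=
      (congrArg (fun A : ℝ →L[ℝ] EuclideanSpace ℝ (Fin 1) × M.Model => A 1) e2).trans
        (Prod.ext rfl e3)
    rw [Bundle.RiemannianMetric.sqSpeed, e4]
    refine (coneMetric_inner_self g _ _).trans_le ?_
    have e5 : v.2 = 0 := (isLeafwiseOn_chartSegment hφ h he).2 s hs'
    rw [coneSq, form_normalProj_eq_zero _ _ e5]
    have e6 := hC s hs' v
    rw [hv, chartDeriv_velocityWithin_chartSegment hφ h hs', ← hv] at e6
    simp only [PiLp.zero_apply, mul_zero, zero_add, add_zero]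
    refine e6.trans ?_
    push_cast
    rw [mul_pow]
    exact mul_le_mul_of_nonneg_right (by nlinarith [C.2]) (sq_nonneg _)

end ChartSegment

/-- Balls of the model space are convex, so the preimage of a small ball serves as `V`. -/
theorem eventually_segment_mem (x₀ : M) {U : Set M} (hU : U ∈ 𝓝 x₀) :
    ∃ V ∈ 𝓝 x₀, V ⊆ (chartAt M.Model x₀).source ∧ ∀ y ∈ V, ∀ y' ∈ V, ∀ s ∈ Icc (0 : ℝ) 1,
      chartAt M.Model x₀ y + s • (chartAt M.Model x₀ y' - chartAt M.Model x₀ y) ∈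
        (chartAt M.Model x₀).target ∧
      chartSegment (chartAt M.Model x₀) y y' s ∈ U := by
  set φ := chartAt M.Model x₀
  have hx : x₀ ∈ φ.source := mem_chart_source _ _
  have h1 : φ.target ∩ φ.symm ⁻¹' U ∈ 𝓝 (φ x₀) :=
    inter_mem (φ.open_target.mem_nhds (φ.map_source hx)) (tendsto_symm φ hx hU)
  obtain ⟨r, hr, hr'⟩ := Metric.mem_nhds_iff.1 h1
  refine ⟨φ.source ∩ φ ⁻¹' Metric.ball (φ x₀) r, inter_mem (φ.open_source.mem_nhds hx)
    (φ.continuousAt hx (Metric.ball_mem_nhds _ hr)), inter_subset_left, ?_⟩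
  intro y hy y' hy' s hs
  exact hr' ((convex_ball (φ x₀) r).add_smul_sub_mem hy.2 hy'.2 hs)

theorem exists_sliceClose_plaque (g : M.Metric) (x₀ : M) :
    ∃ V ∈ 𝓝 x₀, ∃ R : ℝ≥0, ∀ y ∈ V, ∀ y' ∈ V, trans x₀ y = trans x₀ y' → SliceClose g R y y' := by
  obtain ⟨C, hC⟩ := eventually_form_le g x₀
  obtain ⟨V, hV, hVs, hV'⟩ := eventually_segment_mem x₀ hC
  set φ := chartAt M.Model x₀
  have hb : V ∩ φ ⁻¹' Metric.ball (φ x₀) 1 ∈ 𝓝 x₀ :=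
    inter_mem hV (φ.continuousAt (mem_chart_source _ _) (Metric.ball_mem_nhds _ one_pos))
  -- The factor `2` bounds the diameter of the unit ball in the chart.
  refine ⟨_, hb, (C + 1) * 2, fun y hy y' hy' he => ?_⟩
  refine (sliceClose_of_chartSegment g (chart_mem_atlas M.Model x₀) (hVs hy.1) (hVs hy'.1)
    (fun s hs => (hV' y hy.1 y' hy'.1 s hs).1) he
    fun s hs => (hV' y hy.1 y' hy'.1 s hs).2).mono ?_
  refine mul_le_mul_right ?_ _
  rw [← NNReal.coe_le_coe, coe_nnnorm, ← dist_eq_norm]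
  refine (dist_triangle_right _ _ (φ x₀)).trans ?_
  have h1 : dist (φ y) (φ x₀) < 1 := hy.2
  have h2 : dist (φ y') (φ x₀) < 1 := hy'.2
  push_cast
  linarith

/-! ### Leafwise distances and holonomy -/

/-- The parameters `t` for which points with equal values of `σ 0` near `c 0` and of `σ t` near `c
t` are uniformly close form a clopen subset of `[0, 1]`. It contains `0` because `σ 0` separates the
plaques near `c 0`, by `h0`, and each plaque is small in all slices. -/
theorem IsContinuation.exists_sliceClose {c : ℝ → M} {σ : ℝ → M → M.Trans}
    (hσ : IsContinuation c σ) (hc : IsLeafwisePath c) (g : M.Metric)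
    (h0 : ∃ U ∈ 𝓝 (c 0), ∀ y ∈ U, ∀ z ∈ U, σ 0 y = σ 0 z → trans (c 0) y = trans (c 0) z) :
    ∃ U ∈ 𝓝 (c 0), ∃ V ∈ 𝓝 (c 1), ∃ R : ℝ≥0, ∀ y ∈ U, ∀ z ∈ V, σ 0 y = σ 1 z →
      SliceClose g R y z := by
  set P : ℝ → Prop := fun t => ∃ U ∈ 𝓝 (c 0), ∃ V ∈ 𝓝 (c t), ∃ R : ℝ≥0, ∀ y ∈ U, ∀ z ∈ V,
    σ 0 y = σ t z → SliceClose g R y z with hP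
  have hP0 : P 0 := by
    obtain ⟨U, hU, h⟩ := h0
    obtain ⟨V, hV, R, hR⟩ := exists_sliceClose_plaque g (c 0)
    exact ⟨U ∩ V, inter_mem hU hV, U ∩ V, inter_mem hU hV, R, fun y hy z hz he =>
      hR y hy.2 z hz.2 (h y hy.1 z hz.1 he)⟩
  have key : ∀ t ∈ Icc (0 : ℝ) 1, ∀ᶠ s in 𝓝[Icc 0 1] t, P s ↔ P t := by
    intro t ht
    obtain ⟨⟨k, hk⟩, hs⟩ := hσ t ht
    obtain ⟨W, hW, R', hR'⟩ := exists_sliceClose_plaque g (c t)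
    set φ := chartAt M.Model (c t) with hφ
    have hφs : c t ∈ φ.source := mem_chart_source _ _
    have hO : φ.target ∩ φ.symm ⁻¹' (W ∩ {y | σ t y = k (trans (c t) y)}) ∈ 𝓝 (φ (c t)) :=
      inter_mem (φ.open_target.mem_nhds (φ.map_source hφs))
        (tendsto_symm φ hφs (inter_mem hW hk))
    obtain ⟨r, hr, hr'⟩ := Metric.mem_nhds_iff.1 hO
    have hB : φ.source ∩ φ ⁻¹' Metric.ball (φ (c t)) r ∈ 𝓝 (c t) :=
      inter_mem (φ.open_source.mem_nhds hφs)
        (φ.continuousAt hφs (Metric.ball_mem_nhds _ hr))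
    have hc' : Tendsto c (𝓝[Icc 0 1] t) (𝓝 (c t)) := hc.1 t ht
    -- The germs at `c s` and `c t` come from one function, so it suffices to shrink `V` around `c
    -- s`.
    have hfwd : P t → ∀ᶠ s in 𝓝[Icc 0 1] t, P s := by
      rintro ⟨U, hU, V, hV, R, hR⟩
      filter_upwards [hs, hc'.eventually (eventually_mem_nhds_iff.2 hV)] with s h1 h2
      exact ⟨U, hU, _, inter_mem h2 h1, R, fun y hy z hz he =>
        hR y hy z hz.1 (he.trans hz.2)⟩
    suffices hbwd : ∀ᶠ s in 𝓝[Icc 0 1] t, P s → P t by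
      by_cases h : P t
      · exact (hfwd h).mono fun s hs => ⟨fun _ => h, fun _ => hs⟩
      · exact hbwd.mono fun s hs => ⟨hs, fun h' => (h h').elim⟩
    -- Conversely, a neighbourhood `V` of `c s` may miss `c t`. A point `z` near `c t` is moved in
    -- its plaque, at cost `R'`, to the point `z'` with the longitudinal coordinate of `c s`. As `c
    -- s` and `c t` lie on one plaque, `z'` is close to `c s`.
    filter_upwards [hs, hc.eventually_trans_eq ht, hc'.eventually (eventually_mem_nhds_iff.2 hB)]
      with s h1 h2 h3
    have h3' := mem_of_mem_nhds h3
    rintro ⟨U, hU, V, hV, R, hR⟩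
    have hcs : c s ∈ φ.source := h3'.1
    have hV' : ∀ᶠ z in 𝓝 (c t), φ.symm ((φ (c s)).1, (φ z).2) ∈ V ∩ {y | σ s y = σ t y} := by
      have e : φ.symm ((φ (c s)).1, (φ (c t)).2) = c s := by
        have : (φ (c s)).2 = (φ (c t)).2 := h2
        rw [← this, Prod.mk.eta, φ.left_inv hcs]
      have hcont : ContinuousAt (fun z => φ.symm ((φ (c s)).1, (φ z).2)) (c t) := by
        refine ContinuousAt.comp (g := φ.symm) ?_ (continuousAt_const.prodMk
          (continuous_snd.continuousAt.comp (φ.continuousAt hφs)))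
        refine φ.symm.continuousAt ?_
        have : ((φ (c s)).1, (φ (c t)).2) = φ (c s) := Prod.ext rfl h2.symm
        rw [this]
        exact φ.map_source hcs
      have := hcont.tendsto
      rw [e] at this
      exact this (inter_mem hV h1)
    refine ⟨U, hU, _, inter_mem hV' hB, R + R', fun y hy z hz he => ?_⟩
    obtain ⟨⟨hz1, hz2⟩, hz3, hz4⟩ := hz
    set z' := φ.symm ((φ (c s)).1, (φ z).2) with hz'
    have hmem : ((φ (c s)).1, (φ z).2) ∈ Metric.ball (φ (c t)) r := by
      rw [← ball_prod_same]
      rw [mem_preimage, ← ball_prod_same] at hz4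
      have := h3'.2
      rw [mem_preimage, ← ball_prod_same] at this
      exact ⟨this.1, hz4.2⟩
    obtain ⟨g1, g2, g3⟩ := hr' hmem
    have e1 : (φ z').2 = (φ z).2 := by rw [hz', φ.right_inv g1]
    have g4 := hr' hz4
    rw [mem_inter_iff, mem_preimage, φ.left_inv hz3] at g4
    obtain ⟨-, g5, g6⟩ := g4
    have e2 : σ s z' = σ t z := by
      rw [show σ s z' = σ t z' from hz2, show σ t z' = _ from g3, show σ t z = _ from g6]
      exact congrArg k e1
    exact (hR y hy z' hz1 (he.trans e2.symm)).trans (hR' z' g2 z g5 e1)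
  have hclopen : IsClopen {t : Icc (0 : ℝ) 1 | P t} := by
    have h : ∀ t : Icc (0 : ℝ) 1, ∀ᶠ s : Icc (0 : ℝ) 1 in 𝓝 t, P s ↔ P t := fun t =>
      (eventually_nhds_subtype_iff _ t fun s => P s ↔ P t).2 (key t t.2)
    refine ⟨⟨isOpen_iff_mem_nhds.2 fun t ht => ?_⟩, isOpen_iff_mem_nhds.2 fun t ht => ?_⟩
    · filter_upwards [h t] with s hs using fun hs' => ht (hs.1 hs')
    · filter_upwards [h t] with s hs using hs.2 ht
  have : PreconnectedSpace (Icc (0 : ℝ) 1) := Subtype.preconnectedSpace isPreconnected_Icc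
  have huniv := hclopen.eq_univ ⟨⟨0, by simp⟩, hP0⟩
  have h1 : (⟨1, by simp⟩ : Icc (0 : ℝ) 1) ∈ {t : Icc (0 : ℝ) 1 | P t} := huniv ▸ mem_univ _
  exact h1

/-- The end points of nearby elements of the holonomy groupoid have bounded distance in all slices
of the cone. -/
theorem HolonomyGroupoid.exists_eventually_sliceClose (g : M.Metric) (γ : HolonomyGroupoid M) :
    ∃ R : ℝ≥0, ∀ᶠ δ in 𝓝 γ, SliceClose g R δ.src δ.rng := by
  obtain ⟨c, e, hc, h0, h1, ⟨he, ha, hea, σ, hσ, hσ0, hσ1⟩, hg⟩ := γ.exists_path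
  let C : HolonomyChart M :=
    ⟨chartAt _ γ.src, chartAt _ γ.rng, e, chart_mem_atlas _ _, chart_mem_atlas _ _, he⟩
  have ha' : (C.φ γ.src).2 ∈ C.e.source := h0 ▸ ha
  have hC : γ ∈ C.dom := by
    rw [h0, h1] at hea
    refine ⟨mem_chart_source _ _, mem_chart_source _ _, ha', hea, e, ?_, id, EventuallyEq.rfl,
      EventuallyEq.rfl⟩
    rw [hg]
    exact EventuallyEq.rfl
  have hφ : ContinuousAt (fun y => (C.φ y).2) γ.src :=
    continuous_snd.continuousAt.comp (C.φ.continuousAt (mem_chart_source _ _))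
  have hsrc : ∀ᶠ y in 𝓝 γ.src, (C.φ y).2 ∈ e.source :=
    hφ.eventually_mem (e.open_source.mem_nhds ha')
  rw [h0] at hσ0
  -- Near `c 0`, `σ 0` is the injective map `e` after the transverse coordinate, so it separates
  -- plaques.
  have hinj : ∃ U ∈ 𝓝 (c 0), ∀ y ∈ U, ∀ z ∈ U, σ 0 y = σ 0 z → trans (c 0) y = trans (c 0) z := by
    rw [h0]
    refine ⟨_, inter_mem hsrc hσ0, fun y hy z hz hyz => e.injOn hy.1 hz.1 ?_⟩
    have h2 : σ 0 y = _ := hy.2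
    have h3 : σ 0 z = _ := hz.2
    exact h2.symm.trans (hyz.trans h3)
  obtain ⟨U, hU, V, hV, R, hR⟩ := hσ.exists_sliceClose hc g hinj
  rw [h0] at hU
  rw [h1] at hV hσ1
  refine ⟨R, ?_⟩
  filter_upwards [C.dom_mem_nhds hC, continuous_src.continuousAt.eventually (inter_mem hU hσ0),
    continuous_rng.continuousAt.eventually (inter_mem hV hσ1)] with δ hδ h2 h3
  -- What remains is that `e` takes the transverse coordinate of the source to that of the range,
  -- which is part of membership in the chart domain.
  refine hR _ h2.1 _ h3.1 ?_
  rw [show σ 0 δ.src = _ from h2.2, show σ 1 δ.rng = _ from h3.2]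
  exact hδ.2.2.2.1

/-! ### Transverse coordinate changes and short plaque elements of the holonomy groupoid -/

/-- The transverse coordinate change is represented by its values on the transversal through `x`,
which makes it smooth. The same construction in the opposite direction is a left inverse, since each
transverse coordinate is locally a function of the other. -/
theorem exists_transverse_leftInverse {φ ψ : OpenPartialHomeomorph M M.Model}
    (hφ : φ ∈ atlas M.Model M) (hψ : ψ ∈ atlas M.Model M) {x : M} (hx : x ∈ φ.source)
    (hx' : x ∈ ψ.source) : ∃ A : Set M.Trans, IsOpen A ∧ (φ x).2 ∈ A ∧
      ContDiffOn ℝ ∞ (fun w => (ψ (φ.symm ((φ x).1, w))).2) A ∧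
      (∀ w ∈ A, (φ (ψ.symm ((ψ x).1, (ψ (φ.symm ((φ x).1, w))).2))).2 = w) ∧
      ∀ᶠ y in 𝓝 x, (ψ y).2 = (ψ (φ.symm ((φ x).1, (φ y).2))).2 := by
  have hslice : ∀ φ : OpenPartialHomeomorph M M.Model, x ∈ φ.source →
      Tendsto (fun w => φ.symm ((φ x).1, w)) (𝓝 (φ x).2) (𝓝 x) := fun φ hx =>
    (tendsto_symm φ hx).comp (tendsto_const_nhds.prodMk_nhds tendsto_id)
  have hsnd : ∀ φ : OpenPartialHomeomorph M M.Model, x ∈ φ.source →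
      Tendsto (fun y => (φ y).2) (𝓝 x) (𝓝 (φ x).2) := fun φ hx =>
    continuous_snd.continuousAt.comp (φ.continuousAt hx)
  have hfac : ∀ φ ∈ atlas M.Model M, ∀ ψ ∈ atlas M.Model M, x ∈ φ.source → x ∈ ψ.source →
      ∀ᶠ y in 𝓝 x, (ψ y).2 = (ψ (φ.symm ((φ x).1, (φ y).2))).2 := by
    intro φ hφ ψ hψ hx hx'
    obtain ⟨k, hk⟩ := M.foliated φ hφ ψ hψ x ⟨hx, hx'⟩
    have h1 : ∀ᶠ w in 𝓝 (φ x).2, (ψ (φ.symm ((φ x).1, w))).2 = k w := by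
      have h2 : ∀ᶠ w in 𝓝 (φ x).2, ((φ x).1, w) ∈ φ.target :=
        (tendsto_const_nhds.prodMk_nhds tendsto_id).eventually
          (φ.open_target.mem_nhds (φ.map_source hx))
      filter_upwards [(hslice φ hx).eventually hk, h2] with w h3 h4
      rw [h3, φ.right_inv h4]
    filter_upwards [hk, (hsnd φ hx).eventually h1] with y h2 h3
    rw [h2, h3]
  set O : Set M.Trans := {w | ((φ x).1, w) ∈ (φ.symm.trans ψ).source} with hO
  have hc : Continuous fun w : M.Trans => ((φ x).1, w) := by fun_prop
  have hO1 : IsOpen O := (φ.symm.trans ψ).open_source.preimage hc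
  have hO2 : (φ x).2 ∈ O := by
    change φ x ∈ (φ.symm.trans ψ).source
    rw [OpenPartialHomeomorph.trans_source]
    exact ⟨φ.map_source hx, by rwa [mem_preimage, φ.left_inv hx]⟩
  have hd : ContDiffOn ℝ ∞ (fun w => (ψ (φ.symm ((φ x).1, w))).2) O := by
    have h1 : φ.symm.trans ψ ∈ contDiffGroupoid ∞ M.I := HasGroupoid.compatible hφ hψ
    have h2 := contMDiffOn_iff_contDiffOn.1 (contMDiffOn_of_mem_contDiffGroupoid h1)
    have h3 : ContDiffOn ℝ ∞ (fun w : M.Trans => ((φ x).1, w)) O :=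
      (contDiff_const.prodMk contDiff_id).contDiffOn
    exact (h2.comp h3 fun w hw => hw).snd
  have hinv : ∀ᶠ w in 𝓝 (φ x).2,
      (φ (ψ.symm ((ψ x).1, (ψ (φ.symm ((φ x).1, w))).2))).2 = w := by
    have h2 : ∀ᶠ w in 𝓝 (φ x).2, ((φ x).1, w) ∈ φ.target :=
      (tendsto_const_nhds.prodMk_nhds tendsto_id).eventually
        (φ.open_target.mem_nhds (φ.map_source hx))
    filter_upwards [(hslice φ hx).eventually (hfac ψ hψ φ hφ hx' hx), h2] with w h3 h4
    rw [← h3, φ.right_inv h4]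
  obtain ⟨A, hA, hA', hA''⟩ := mem_nhds_iff.1 hinv
  exact ⟨A ∩ O, hA'.inter hO1, ⟨hA'', hO2⟩, hd.mono inter_subset_right,
    fun w hw => hA hw.1, hfac φ hφ ψ hψ hx hx'⟩

/-- The transverse coordinate changes are germs of local diffeomorphisms. -/
theorem exists_transverse_transition {φ ψ : OpenPartialHomeomorph M M.Model}
    (hφ : φ ∈ atlas M.Model M) (hψ : ψ ∈ atlas M.Model M) {x : M} (hx : x ∈ φ.source)
    (hx' : x ∈ ψ.source) : ∃ e : OpenPartialHomeomorph M.Trans M.Trans,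
      e ∈ contDiffGroupoid ∞ 𝓘(ℝ, M.Trans) ∧ (φ x).2 ∈ e.source ∧
      (fun y => (ψ y).2) =ᶠ[𝓝 x] fun y => e (φ y).2 := by
  obtain ⟨A, hA, hxA, hdA, hiA, hfA⟩ := exists_transverse_leftInverse hφ hψ hx hx'
  obtain ⟨B, hB, hxB, hdB, hiB, hfB⟩ := exists_transverse_leftInverse hψ hφ hx' hx
  set k : M.Trans → M.Trans := fun w => (ψ (φ.symm ((φ x).1, w))).2 with hk
  set k' : M.Trans → M.Trans := fun w => (φ (ψ.symm ((ψ x).1, w))).2 with hk'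
  -- `k'` inverts `k` on `A`, and `k` inverts `k'` on `B`; source and target are cut down so that
  -- each map lands where the other identity holds.
  let e : OpenPartialHomeomorph M.Trans M.Trans :=
    { toFun := k
      invFun := k'
      source := A ∩ k ⁻¹' B
      target := B ∩ k' ⁻¹' A
      map_source' := fun w hw => ⟨hw.2, by
        change k' (k w) ∈ A
        rw [show k' (k w) = w from hiA w hw.1]
        exact hw.1⟩
      map_target' := fun w hw => ⟨hw.2, by
        change k (k' w) ∈ B
        rw [show k (k' w) = w from hiB w hw.1]
        exact hw.1⟩
      left_inv' := fun w hw => hiA w hw.1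
      right_inv' := fun w hw => hiB w hw.1
      open_source := hdA.continuousOn.isOpen_inter_preimage hA hB
      open_target := hdB.continuousOn.isOpen_inter_preimage hB hA
      continuousOn_toFun := hdA.continuousOn.mono inter_subset_left
      continuousOn_invFun := hdB.continuousOn.mono inter_subset_left }
  refine ⟨e, ?_, ⟨hxA, ?_⟩, hfA⟩
  · rw [contDiffGroupoid, mem_groupoid_of_pregroupoid]
    constructor
    · simp only [contDiffPregroupoid, modelWithCornersSelf_coe, modelWithCornersSelf_coe_symm, Function.comp_id, Function.id_comp, preimage_id, range_id, inter_univ]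
      exact hdA.mono inter_subset_left
    · simp only [contDiffPregroupoid, modelWithCornersSelf_coe, modelWithCornersSelf_coe_symm, Function.comp_id, Function.id_comp, preimage_id, range_id, inter_univ]
      exact hdB.mono inter_subset_left
  · change (ψ (φ.symm ((φ x).1, (φ x).2))).2 ∈ B
    rwa [Prod.mk.eta, φ.left_inv hx]

/-- The chart of the holonomy groupoid around the units in the domain of a foliation chart. -/
noncomputable def unitChart (φ : OpenPartialHomeomorph M M.Model) (hφ : φ ∈ atlas M.Model M) :
    HolonomyChart M :=
  ⟨φ, φ, OpenPartialHomeomorph.refl _, hφ, hφ, (contDiffGroupoid ∞ 𝓘(ℝ, M.Trans)).id_mem⟩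

/-- The class is that of the segment in the chart. Germs are recorded in the preferred charts at the
ends, so its germ is the inverse of the transverse change `a` at `y`, followed by the change `b` at
`y'`. As the segment stays in the domain of `φ`, a constant family is a continuation along it. -/
theorem exists_mem_unitChart_dom {φ : OpenPartialHomeomorph M M.Model} (hφ : φ ∈ atlas M.Model M)
    {y y' : M} (hy : y ∈ φ.source) (hy' : y' ∈ φ.source)
    (h : ∀ s ∈ Icc (0 : ℝ) 1, φ y + s • (φ y' - φ y) ∈ φ.target) (he : (φ y).2 = (φ y').2) :
    ∃ γ ∈ (unitChart φ hφ).dom, γ.src = y ∧ γ.rng = y' := by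
  obtain ⟨a, ha, hya, hfa⟩ := exists_transverse_transition hφ (chart_mem_atlas M.Model y) hy
    (mem_chart_source _ _)
  obtain ⟨b, hb, hyb, hfb⟩ := exists_transverse_transition hφ (chart_mem_atlas M.Model y') hy'
    (mem_chart_source _ _)
  have hφy : ContinuousAt (fun z => (φ z).2) y :=
    continuous_snd.continuousAt.comp (φ.continuousAt hy)
  have hφy' : ContinuousAt (fun z => (φ z).2) y' :=
    continuous_snd.continuousAt.comp (φ.continuousAt hy')
  have hya' : ∀ᶠ z in 𝓝 y, (φ z).2 ∈ a.source := hφy.eventually_mem (a.open_source.mem_nhds hya)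
  have hyb' : ∀ᶠ z in 𝓝 y', (φ z).2 ∈ b.source := hφy'.eventually_mem (b.open_source.mem_nhds hyb)
  have hyb'' : ∀ᶠ z in 𝓝 y, (φ z).2 ∈ b.source :=
    hφy.eventually_mem (b.open_source.mem_nhds (he ▸ hyb))
  have ea : (chartAt M.Model y y).2 = a (φ y).2 := hfa.self_of_nhds
  have eb : (chartAt M.Model y' y').2 = b (φ y').2 := hfb.self_of_nhds
  have h0 := chartSegment_zero (y' := y') hy
  have h1 := chartSegment_one (y := y) hy'
  have hgerm : (fun z => b (φ z).2) =ᶠ[𝓝 y] fun z => (a.symm.trans b) (chartAt M.Model y z).2 := by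
    filter_upwards [hfa, hya'] with z h2 h3
    rw [h2, OpenPartialHomeomorph.trans_apply, a.left_inv h3]
  refine ⟨⟨y, y', {k | k =ᶠ[𝓝 (trans y y)] (a.symm.trans b)}, chartSegment φ y y', a.symm.trans b,
    isLeafwisePath_chartSegment hφ h he, h0, h1, ⟨(contDiffGroupoid ∞ 𝓘(ℝ, M.Trans)).trans
      ((contDiffGroupoid ∞ 𝓘(ℝ, M.Trans)).symm ha) hb, ?_, ?_, fun _ z => b (φ z).2, ?_, ?_, ?_⟩,
    rfl⟩, ⟨hy, hy', mem_univ _, he, a.symm.trans b, EventuallyEq.rfl, b.symm, ?_, ?_⟩, rfl, rfl⟩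
  · rw [h0, ea, OpenPartialHomeomorph.trans_source]
    refine ⟨a.map_source hya, ?_⟩
    rw [mem_preimage, a.left_inv hya, he]
    exact hyb
  · rw [h0, h1, ea, eb, OpenPartialHomeomorph.trans_apply, a.left_inv hya, he]
  · intro t ht
    have hm : chartSegment φ y y' t ∈ φ.source := φ.map_target (h t ht)
    obtain ⟨k, hk⟩ := M.foliated _ (chart_mem_atlas M.Model (chartSegment φ y y' t)) φ hφ _
      ⟨mem_chart_source _ _, hm⟩
    exact ⟨⟨fun w => b (k w), EventuallyEq.fun_comp hk b⟩, Eventually.of_forall fun _ => EventuallyEq.rfl⟩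
  · rw [h0]
    exact hgerm
  · rw [h1]
    exact hfb.symm
  · filter_upwards [hfb, hyb'] with z h2 h3
    change (φ z).2 = b.symm (chartAt M.Model y' z).2
    rw [h2, b.left_inv h3]
  · filter_upwards [hgerm, hyb''] with z h2 h3
    change (φ z).2 = b.symm ((a.symm.trans b) (chartAt M.Model y z).2)
    rw [← h2, b.left_inv h3]

/-! ### The topology of the holonomy groupoid -/

/-- The transverse coordinate is open at `x`. Hence an identity between functions of it which holds
near `x` holds near its value at `x`. -/
theorem map_trans_nhds (x : M) : map (trans x) (𝓝 x) = 𝓝 (trans x x) := by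
  have h := (chartAt M.Model x).map_nhds_eq (mem_chart_source M.Model x)
  change map (Prod.snd ∘ chartAt M.Model x) (𝓝 x) = _
  rw [← map_map, h, map_snd_nhds]
  rfl

theorem HolonomyGroupoid.tendsto_germ {γ : HolonomyGroupoid M} {h : M.Trans → M.Trans}
    (hh : h ∈ γ.germ) :
    Tendsto h (𝓝 (trans γ.src γ.src)) (𝓝 (trans γ.rng γ.rng)) := by
  obtain ⟨c, e, -, h0, h1, ⟨-, ha, hea, -⟩, hg⟩ := γ.exists_path
  rw [h0] at ha hea
  rw [h1] at hea
  rw [hg] at hh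
  have := (e.continuousAt ha).tendsto
  rw [hea] at this
  exact this.congr' (EventuallyEq.symm hh)

/-- At `γ` the two local diffeomorphisms differ by the transverse coordinate change `b` at the
range. This identity of germs persists at nearby points, where it turns the conditions for `C` into
those for `D`. -/
theorem HolonomyChart.exists_nhds_mem_dom {C D : HolonomyChart M} {γ : HolonomyGroupoid M}
    (hC : γ ∈ C.dom) (hD : γ ∈ D.dom) : ∃ U ∈ 𝓝 γ.src, ∃ V ∈ 𝓝 γ.rng, ∀ δ ∈ C.dom,
      δ.src ∈ U → δ.rng ∈ V → δ ∈ D.dom := by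
  obtain ⟨c1, c2, c3, c4, h, hh, k, hk, hk'⟩ := hC
  obtain ⟨d1, d2, d3, d4, l, hl, m, hm, hm'⟩ := hD
  obtain ⟨b, hb⟩ := M.foliated C.ψ C.ψ_mem D.ψ D.ψ_mem γ.rng ⟨c2, d2⟩
  have hlh : l =ᶠ[𝓝 (trans γ.src γ.src)] h := by
    obtain ⟨c, e, -, -, -, -, hg⟩ := γ.exists_path
    rw [hg] at hh hl
    exact EventuallyEq.trans hl (EventuallyEq.symm hh)
  have hbk : ∀ᶠ w in 𝓝 (trans γ.rng γ.rng), b (k w) = m w := by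
    rw [← map_trans_nhds, eventually_map]
    filter_upwards [hb, hk, hm] with z h1 h2 h3
    rw [← h2, ← h1, h3]
  have hkey : ∀ᶠ y in 𝓝 γ.src, D.e (D.φ y).2 = b (C.e (C.φ y).2) := by
    filter_upwards [hk', hm', (tendsto_trans γ.src).eventually hlh,
      ((HolonomyGroupoid.tendsto_germ hh).comp (tendsto_trans γ.src)).eventually hbk]
      with y h1 h2 h3 h4
    rw [h1, h2, h3]
    exact h4.symm
  have hds : ∀ᶠ y in 𝓝 γ.src, y ∈ D.φ.source ∧ (D.φ y).2 ∈ D.e.source :=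
    (D.φ.open_source.eventually_mem d1).and
      ((continuous_snd.continuousAt.comp (D.φ.continuousAt d1)).eventually_mem
        (D.e.open_source.mem_nhds d3))
  refine ⟨_, hds.and (eventually_eventually_nhds.2 hkey), _,
    (D.ψ.open_source.eventually_mem d2).and (eventually_eventually_nhds.2 hb), ?_⟩
  rintro δ ⟨e1, e2, e3, e4, h', hh', k', hk₁, hk₂⟩ ⟨⟨f1, f2⟩, f3⟩ ⟨f4, f5⟩
  refine ⟨f1, f4, f2, ?_, h', hh', fun w => b (k' w), ?_, ?_⟩
  · rw [f3.self_of_nhds, f5.self_of_nhds, e4]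
  · filter_upwards [f5, hk₁] with z g1 g2
    rw [g1, g2]
  · filter_upwards [f3, hk₂] with z g1 g2
    rw [g1, g2]

/-- The topology is generated by sets from all charts, but inside the domain of `C` every other
chart condition at `γ` follows from closeness of source and range (`exists_nhds_mem_dom`). One chart
therefore suffices to test convergence. -/
theorem HolonomyChart.nhds_eq {C : HolonomyChart M} {γ : HolonomyGroupoid M} (hC : γ ∈ C.dom) :
    𝓝 γ = 𝓟 C.dom ⊓ comap HolonomyGroupoid.src (𝓝 γ.src) ⊓
      comap HolonomyGroupoid.rng (𝓝 γ.rng) := by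
  refine le_antisymm (le_inf (le_inf (le_principal_iff.2 (C.dom_mem_nhds hC))
    continuous_src.continuousAt.le_comap) continuous_rng.continuousAt.le_comap) ?_
  rw [TopologicalSpace.nhds_generateFrom]
  refine le_iInf₂ fun s hs => ?_
  obtain ⟨hγ, D, O, hO, rfl⟩ := hs
  obtain ⟨U, hU, V, hV, h⟩ := C.exists_nhds_mem_dom hC hγ.1
  set L := 𝓟 C.dom ⊓ comap HolonomyGroupoid.src (𝓝 γ.src) ⊓
      comap HolonomyGroupoid.rng (𝓝 γ.rng)
  have h1 : Tendsto HolonomyGroupoid.src L (𝓝 γ.src) :=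
    tendsto_comap.mono_left (inf_le_left.trans inf_le_right)
  have h2 : Tendsto HolonomyGroupoid.rng L (𝓝 γ.rng) :=
    tendsto_comap.mono_left inf_le_right
  have h3 : ∀ᶠ δ in L, δ ∈ C.dom := (inf_le_left.trans inf_le_left : L ≤ 𝓟 C.dom) (mem_principal_self _)
  have h4 : Tendsto D.coord L (𝓝 (D.coord γ)) :=
    (((D.φ.continuousAt hγ.1.1).tendsto.comp h1)).prodMk_nhds
      ((continuous_fst.tendsto _).comp ((D.ψ.continuousAt hγ.1.2.1).tendsto.comp h2))
  refine le_principal_iff.2 ?_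
  filter_upwards [h3, h1.eventually hU, h2.eventually hV, h4.eventually (hO.mem_nhds hγ.2)]
    with δ g1 g2 g3 g4
  exact ⟨h δ g1 g2 g3, g4⟩

theorem HolonomyChart.tendsto_nhds {X : Type*} {l : Filter X} {F : X → HolonomyGroupoid M}
    {C : HolonomyChart M} {γ : HolonomyGroupoid M} (hC : γ ∈ C.dom) (h : ∀ᶠ x in l, F x ∈ C.dom)
    (hs : Tendsto (fun x => (F x).src) l (𝓝 γ.src))
    (hr : Tendsto (fun x => (F x).rng) l (𝓝 γ.rng)) : Tendsto F l (𝓝 γ) := by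
  rw [C.nhds_eq hC, tendsto_inf, tendsto_inf]
  exact ⟨⟨tendsto_principal.2 h, tendsto_comap_iff.2 hs⟩, tendsto_comap_iff.2 hr⟩

/-! ### Algebra of the holonomy groupoid -/

namespace HolonomyGroupoid

theorem exists_mem_germ (γ : HolonomyGroupoid M) : ∃ h, h ∈ γ.germ := by
  obtain ⟨c, e, -, -, -, -, hg⟩ := γ.exists_path
  exact ⟨e, by rw [hg]; exact EventuallyEq.rfl⟩

/-- A germ contains all functions that agree near the base point with one of its members. The
groupoid identities below are obtained by exhibiting a common representative. -/
theorem ext_of_mem_germ {γ δ : HolonomyGroupoid M} (hs : γ.src = δ.src) (hr : γ.rng = δ.rng)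
    {k : M.Trans → M.Trans} (hγ : k ∈ γ.germ) (hδ : k ∈ δ.germ) : γ = δ := by
  refine HolonomyGroupoid.ext hs hr ?_
  obtain ⟨c, e, -, -, -, -, hg⟩ := γ.exists_path
  obtain ⟨c', e', -, -, -, -, hg'⟩ := δ.exists_path
  rw [hg] at hγ
  rw [hg'] at hδ
  rw [hg, hg', ← hs]
  rw [← hs] at hδ
  exact Set.ext fun l => ⟨fun hl => (EventuallyEq.trans hl (EventuallyEq.symm hγ)).trans hδ,
    fun hl => (EventuallyEq.trans hl (EventuallyEq.symm hδ)).trans hγ⟩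

theorem comp_mem_germ_mul {γ₁ γ₂ : HolonomyGroupoid M} (h : γ₁.src = γ₂.rng)
    {k₁ k₂ : M.Trans → M.Trans} (h₁ : k₁ ∈ γ₁.germ) (h₂ : k₂ ∈ γ₂.germ) :
    k₁ ∘ k₂ ∈ (mul γ₁ γ₂ h).germ :=
  ⟨k₁, h₁, k₂, h₂, EventuallyEq.rfl⟩

theorem mul_assoc {γ₁ γ₂ γ₃ : HolonomyGroupoid M} (h : γ₁.src = γ₂.rng) (h' : γ₂.src = γ₃.rng) :
    mul (mul γ₁ γ₂ h) γ₃ h' = mul γ₁ (mul γ₂ γ₃ h') h := by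
  obtain ⟨k₁, h₁⟩ := γ₁.exists_mem_germ
  obtain ⟨k₂, h₂⟩ := γ₂.exists_mem_germ
  obtain ⟨k₃, h₃⟩ := γ₃.exists_mem_germ
  exact ext_of_mem_germ rfl rfl (comp_mem_germ_mul (γ₁ := mul γ₁ γ₂ h) h' (comp_mem_germ_mul h h₁ h₂) h₃)
    (comp_mem_germ_mul (γ₂ := mul γ₂ γ₃ h') (k₁ := k₁) (k₂ := k₂ ∘ k₃) h h₁ (comp_mem_germ_mul h' h₂ h₃))

theorem unit_mul (γ : HolonomyGroupoid M) : mul (unit γ.rng) γ rfl = γ := by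
  obtain ⟨k, h⟩ := γ.exists_mem_germ
  exact ext_of_mem_germ rfl rfl
    (comp_mem_germ_mul (γ₁ := unit γ.rng) rfl (k₁ := id) EventuallyEq.rfl h) h

theorem mul_unit (γ : HolonomyGroupoid M) : mul γ (unit γ.src) rfl = γ := by
  obtain ⟨k, h⟩ := γ.exists_mem_germ
  exact ext_of_mem_germ rfl rfl
    (comp_mem_germ_mul (γ₂ := unit γ.src) rfl (k₂ := id) h EventuallyEq.rfl) h

theorem inv_unit (x : M) : inv (unit x) = unit x :=
  ext_of_mem_germ (k := id) rfl rfl ⟨id, EventuallyEq.rfl, Eventually.of_forall fun _ => rfl⟩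
    EventuallyEq.rfl

theorem inv_mul {γ₁ γ₂ : HolonomyGroupoid M} (h : γ₁.src = γ₂.rng) :
    (mul γ₁ γ₂ h).inv = mul γ₂.inv γ₁.inv h.symm := by
  obtain ⟨k₁, l₁, hl₁, hk₁⟩ := γ₁.inv.exists_mem_germ
  obtain ⟨k₂, l₂, hl₂, hk₂⟩ := γ₂.inv.exists_mem_germ
  refine ext_of_mem_germ (k := k₂ ∘ k₁) rfl rfl
    ⟨l₁ ∘ l₂, comp_mem_germ_mul h hl₁ hl₂, ?_⟩
    (comp_mem_germ_mul (γ₁ := γ₂.inv) (γ₂ := γ₁.inv) h.symm ⟨l₂, hl₂, hk₂⟩ ⟨l₁, hl₁, hk₁⟩)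
  rw [h] at hk₁
  filter_upwards [hk₂, (tendsto_germ hl₂).eventually hk₁] with w h1 h2
  simp only [Function.comp_apply, h2, h1]

open Classical in
/-- The product of two classes, with a junk value if they are not composable. -/
noncomputable def prod (γ₁ γ₂ : HolonomyGroupoid M) : HolonomyGroupoid M :=
  if h : γ₁.src = γ₂.rng then mul γ₁ γ₂ h else γ₁

theorem prod_eq {γ₁ γ₂ : HolonomyGroupoid M} (h : γ₁.src = γ₂.rng) : prod γ₁ γ₂ = mul γ₁ γ₂ h :=
  dif_pos h

theorem prod_src {γ₁ γ₂ : HolonomyGroupoid M} (h : γ₁.src = γ₂.rng) :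
    (prod γ₁ γ₂).src = γ₂.src := by
  rw [prod_eq h]
  rfl

theorem prod_rng {γ₁ γ₂ : HolonomyGroupoid M} (h : γ₁.src = γ₂.rng) :
    (prod γ₁ γ₂).rng = γ₁.rng := by
  rw [prod_eq h]
  rfl

theorem prod_assoc {γ₁ γ₂ γ₃ : HolonomyGroupoid M} (h : γ₁.src = γ₂.rng) (h' : γ₂.src = γ₃.rng) :
    prod (prod γ₁ γ₂) γ₃ = prod γ₁ (prod γ₂ γ₃) := by
  rw [prod_eq (γ₁ := prod γ₁ γ₂) (by rwa [prod_src h]), prod_eq (γ₂ := prod γ₂ γ₃) (by rwa [prod_rng h'])]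
  simp only [prod_eq h, prod_eq h']
  exact mul_assoc h h'

theorem inv_prod {γ₁ γ₂ : HolonomyGroupoid M} (h : γ₁.src = γ₂.rng) :
    (prod γ₁ γ₂).inv = prod γ₂.inv γ₁.inv := by
  rw [prod_eq h, prod_eq (γ₁ := γ₂.inv) (γ₂ := γ₁.inv) h.symm]
  exact inv_mul h

theorem unit_prod (γ : HolonomyGroupoid M) : prod (unit γ.rng) γ = γ := by
  rw [prod_eq (γ₁ := unit γ.rng) rfl, unit_mul]

theorem prod_unit (γ : HolonomyGroupoid M) : prod γ (unit γ.src) = γ := by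
  rw [prod_eq (γ₂ := unit γ.src) rfl, mul_unit]

end HolonomyGroupoid

/-! ### Smooth maps between holonomy groupoids -/

open HolonomyGroupoid

theorem exists_holonomyChart_chartAt (γ : HolonomyGroupoid M) : ∃ C : HolonomyChart M,
    γ ∈ C.dom ∧ C.φ = chartAt M.Model γ.src ∧ C.ψ = chartAt M.Model γ.rng := by
  obtain ⟨c, e, hc, h0, h1, ⟨he, ha, hea, -⟩, hg⟩ := γ.exists_path
  rw [h0] at ha hea
  rw [h1] at hea
  refine ⟨⟨chartAt _ γ.src, chartAt _ γ.rng, e, chart_mem_atlas _ _, chart_mem_atlas _ _, he⟩,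
    ⟨mem_chart_source _ _, mem_chart_source _ _, ha, hea, e, ?_, id, EventuallyEq.rfl,
    EventuallyEq.rfl⟩, rfl, rfl⟩
  rw [hg]
  exact EventuallyEq.rfl

/-- The chart for products of elements of the domains of two composable charts. -/
noncomputable def HolonomyChart.mul (C D : HolonomyChart M) : HolonomyChart M :=
  ⟨D.φ, C.ψ, D.e.trans C.e, D.φ_mem, C.ψ_mem, (contDiffGroupoid ∞ 𝓘(ℝ, M.Trans)).trans D.e_mem C.e_mem⟩

theorem HolonomyChart.mul_mem_dom {C D : HolonomyChart M} (hCD : C.φ = D.ψ)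
    {γ δ : HolonomyGroupoid M} (hγ : γ ∈ C.dom) (hδ : δ ∈ D.dom) (h : γ.src = δ.rng) :
    HolonomyGroupoid.mul γ δ h ∈ (C.mul D).dom := by
  obtain ⟨-, c2, c3, c4, l, hl, m, hm, hm'⟩ := hγ
  obtain ⟨d1, -, d3, d4, l', hl', m', hn, hn'⟩ := hδ
  rw [h, hCD] at c3 c4 hm'
  have key : ∀ᶠ w in 𝓝 (trans δ.rng δ.rng), C.e (m' w) = m (l w) := by
    rw [← map_trans_nhds, eventually_map]
    filter_upwards [hm', hn] with y h1 h2
    rw [← h2, h1]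
  refine ⟨d1, c2, ?_, ?_, l ∘ l', comp_mem_germ_mul h hl hl', m, hm, ?_⟩
  · change (D.φ δ.src).2 ∈ (D.e.trans C.e).source
    rw [OpenPartialHomeomorph.trans_source]
    exact ⟨d3, by rw [mem_preimage, d4]; exact c3⟩
  · change C.e (D.e (D.φ δ.src).2) = (C.ψ γ.rng).2
    rw [d4, c4]
  · change ∀ᶠ y in 𝓝 δ.src, C.e (D.e (D.φ y).2) = m (l (l' (trans δ.src y)))
    filter_upwards [hn', ((tendsto_germ hl').comp (tendsto_trans δ.src)).eventually key]
      with y h1 h2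
    rw [h1]
    exact h2

/-- Smoothness can be checked in one chart around each point. -/
theorem smoothOnGroupoid_of_exists {F : HolonomyGroupoid M → HolonomyGroupoid N}
    {A : Set (HolonomyGroupoid M)}
    (h : ∀ γ ∈ A, ContinuousWithinAt F A γ ∧ ∃ (C : HolonomyChart M) (D : HolonomyChart N),
      γ ∈ C.dom ∧ F γ ∈ D.dom ∧ ∃ Φ : M.Model × M.Plaque → N.Model × N.Plaque,
        ContDiffAt ℝ ∞ Φ (C.coord γ) ∧ ∀ᶠ δ in 𝓝[A] γ, D.coord (F δ) = Φ (C.coord δ)) :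
    SmoothOnGroupoid F A := by
  intro γ hγ
  obtain ⟨hc, C, D, hC, hD, Φ, hΦ, he⟩ := h γ hγ
  refine ⟨hc, fun C' D' hC' hD' => ?_⟩
  obtain ⟨Φ₁, hΦ₁, he₁⟩ := (smoothOnGroupoid_id univ γ (mem_univ _)).2 C' C hC' hC
  obtain ⟨Φ₂, hΦ₂, he₂⟩ := (smoothOnGroupoid_id univ (F γ) (mem_univ _)).2 D D' hD hD'
  rw [nhdsWithin_univ] at he₁ he₂
  have e₁ : C.coord γ = Φ₁ (C'.coord γ) := he₁.self_of_nhds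
  have e : D.coord (F γ) = Φ (C.coord γ) := he.self_of_nhdsWithin hγ
  rw [e, e₁] at hΦ₂
  rw [e₁] at hΦ
  refine ⟨Φ₂ ∘ (Φ ∘ Φ₁), ContDiffAt.comp (f := Φ ∘ Φ₁) (C'.coord γ) hΦ₂ (hΦ.comp _ hΦ₁), ?_⟩
  filter_upwards [he, hc.eventually he₂, mem_nhdsWithin_of_mem_nhds he₁] with δ h1 h2 h3
  change C.coord δ = _ at h3
  rw [h3] at h1
  exact h2.trans (congrArg Φ₂ h1)

/-- In a product chart the source coordinates come from the second factor and the range coordinate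
from the first. The two charts are chosen with the preferred chart at the common middle point, which
makes them composable. -/
theorem SmoothOnGroupoid.mul {F₁ F₂ G : HolonomyGroupoid M → HolonomyGroupoid N}
    {A : Set (HolonomyGroupoid M)} (h₁ : SmoothOnGroupoid F₁ A) (h₂ : SmoothOnGroupoid F₂ A)
    (h : ∀ γ ∈ A, ∃ e, G γ = HolonomyGroupoid.mul (F₁ γ) (F₂ γ) e) : SmoothOnGroupoid G A := by
  refine smoothOnGroupoid_of_exists fun γ hγ => ?_
  obtain ⟨C, hC⟩ := exists_holonomyChart γ
  obtain ⟨D₁, hD₁, hφ, -⟩ := exists_holonomyChart_chartAt (F₁ γ)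
  obtain ⟨D₂, hD₂, -, hψ⟩ := exists_holonomyChart_chartAt (F₂ γ)
  obtain ⟨c₁, s₁⟩ := h₁ γ hγ
  obtain ⟨c₂, s₂⟩ := h₂ γ hγ
  obtain ⟨Φ₁, hΦ₁, e₁⟩ := s₁ C D₁ hC hD₁
  obtain ⟨Φ₂, hΦ₂, e₂⟩ := s₂ C D₂ hC hD₂
  have hD : D₁.φ = D₂.ψ := by
    obtain ⟨e, -⟩ := h γ hγ
    rw [hφ, hψ, e]
  have hdom : ∀ δ ∈ A, F₁ δ ∈ D₁.dom → F₂ δ ∈ D₂.dom → G δ ∈ (D₁.mul D₂).dom := by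
    intro δ hδ g₁ g₂
    obtain ⟨e, he⟩ := h δ hδ
    rw [he]
    exact HolonomyChart.mul_mem_dom hD g₁ g₂ e
  have hs : ∀ δ ∈ A, (G δ).src = (F₂ δ).src := by
    intro δ hδ
    obtain ⟨e, he⟩ := h δ hδ
    rw [he]
    rfl
  have hr : ∀ δ ∈ A, (G δ).rng = (F₁ δ).rng := by
    intro δ hδ
    obtain ⟨e, he⟩ := h δ hδ
    rw [he]
    rfl
  refine ⟨HolonomyChart.tendsto_nhds (hdom γ hγ hD₁ hD₂) ?_ ?_ ?_, C, D₁.mul D₂, hC,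
    hdom γ hγ hD₁ hD₂, fun v => ((Φ₂ v).1, (Φ₁ v).2), hΦ₂.fst.prodMk hΦ₁.snd, ?_⟩
  · filter_upwards [c₁.eventually (D₁.dom_mem_nhds hD₁), c₂.eventually (D₂.dom_mem_nhds hD₂),
      self_mem_nhdsWithin] with δ g₁ g₂ hδ
    exact hdom δ hδ g₁ g₂
  · rw [hs γ hγ]
    refine ((continuous_src.tendsto _).comp c₂).congr' ?_
    filter_upwards [self_mem_nhdsWithin] with δ hδ using (hs δ hδ).symm
  · rw [hr γ hγ]
    refine ((continuous_rng.tendsto _).comp c₁).congr' ?_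
    filter_upwards [self_mem_nhdsWithin] with δ hδ using (hr δ hδ).symm
  · filter_upwards [e₁, e₂, self_mem_nhdsWithin] with δ g₁ g₂ hδ
    rw [← g₁, ← g₂]
    change (D₂.φ (G δ).src, (D₁.ψ (G δ).rng).1) = _
    rw [hs δ hδ, hr δ hδ]
    rfl

theorem SmoothOnGroupoid.of_locally {F : HolonomyGroupoid M → HolonomyGroupoid N}
    {A : Set (HolonomyGroupoid M)}
    (h : ∀ γ ∈ A, ∃ U ∈ 𝓝 γ, SmoothOnGroupoid F (A ∩ U)) : SmoothOnGroupoid F A := by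
  intro γ hγ
  obtain ⟨U, hU, hF⟩ := h γ hγ
  obtain ⟨hc, hs⟩ := hF γ ⟨hγ, mem_of_mem_nhds hU⟩
  rw [ContinuousWithinAt, nhdsWithin_inter_of_mem' (mem_nhdsWithin_of_mem_nhds hU)] at hc
  rw [nhdsWithin_inter_of_mem' (mem_nhdsWithin_of_mem_nhds hU)] at hs
  exact ⟨hc, hs⟩

theorem unit_mem_unitChart_dom {φ : OpenPartialHomeomorph M M.Model} (hφ : φ ∈ atlas M.Model M)
    {x : M} (hx : x ∈ φ.source) : unit x ∈ (unitChart φ hφ).dom := by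
  obtain ⟨k, hk⟩ := M.foliated _ (chart_mem_atlas M.Model x) φ hφ x ⟨mem_chart_source _ _, hx⟩
  exact ⟨hx, hx, mem_univ _, rfl, id, EventuallyEq.rfl, k, hk, hk⟩

theorem smoothOnGroupoid_unit_src (A : Set (HolonomyGroupoid M)) :
    SmoothOnGroupoid (fun γ => unit γ.src) A := by
  refine smoothOnGroupoid_of_exists fun γ _ => ?_
  obtain ⟨C, hC⟩ := exists_holonomyChart γ
  refine ⟨(continuous_unit.comp continuous_src).continuousWithinAt, C, unitChart C.φ C.φ_mem, hC,
    unit_mem_unitChart_dom _ hC.1, fun v => (v.1, v.1.1),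
    (contDiff_fst.prodMk (contDiff_fst.comp contDiff_fst)).contDiffAt,
    Eventually.of_forall fun δ => rfl⟩

/-! ### Equivalence of smooth maps of leaf spaces -/

namespace LeafMapOn

variable {ι κ : Type u}

theorem src_map_eq_rng_map (f : LeafMapOn M N ι) {α β ν : ι} {γ δ : HolonomyGroupoid M}
    (h : γ.src = δ.rng) (hα : γ.rng ∈ f.Ω α) (hβ : γ.src ∈ f.Ω β) (hν : δ.src ∈ f.Ω ν) :
    (f.map α β γ).src = (f.map β ν δ).rng :=
  (f.map_mul α β ν γ δ h hα hβ hν).1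

theorem prod_map (f : LeafMapOn M N ι) {α β ν : ι} {γ δ : HolonomyGroupoid M}
    (h : γ.src = δ.rng) (hα : γ.rng ∈ f.Ω α) (hβ : γ.src ∈ f.Ω β) (hν : δ.src ∈ f.Ω ν) :
    prod (f.map α β γ) (f.map β ν δ) = f.map α ν (prod γ δ) := by
  obtain ⟨h', e⟩ := f.map_mul α β ν γ δ h hα hβ hν
  rw [prod_eq h', prod_eq h, e]

/-! ### Gluing maps of leaf spaces along a common restriction -/

section Glue

variable {f : LeafMapOn M N κ} {F : ι → LeafMapOn M N (Option κ)}

/-- The product of images under maps of holonomy groupoids which have a common restriction, by way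
of the index `β` of this restriction. -/
noncomputable def glueProd (F : ι → LeafMapOn M N (Option κ)) (a b : ι) (β : κ)
    (γ δ : HolonomyGroupoid M) : HolonomyGroupoid N :=
  prod ((F a).map none (some β) γ) ((F b).map (some β) none δ)

theorem glueProd_composable (hF : ∀ a, (F a).IsRestriction some f) {a b : ι} {β : κ}
    {γ δ : HolonomyGroupoid M} (h : γ.src = δ.rng) (ha : γ.rng ∈ (F a).Ω none)
    (hβ : γ.src ∈ f.Ω β) (hb : δ.src ∈ (F b).Ω none) :
    ((F a).map none (some β) γ).src = ((F b).map (some β) none δ).rng := by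
  have h1 : γ.src ∈ (F a).Ω (some β) := (hF a).1 β ▸ hβ
  have h2 : δ.rng ∈ (F b).Ω (some β) := (hF b).1 β ▸ h ▸ hβ
  rw [(F a).src_map ha h1, (F b).rng_map h2 hb, ← (hF a).base_eq hβ, ← (hF b).base_eq (h ▸ hβ), h]

/-- A middle factor can change sides: `F a` and `F b` agree on `δ`, where both restrict to `f`, so
`F_a(γ) F_b(δε) = F_a(γ) f(δ) F_b(ε) = F_a(γδ) F_b(ε)`. -/
theorem glueProd_shift (hF : ∀ a, (F a).IsRestriction some f) {a b : ι} {β ν : κ}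
    {γ δ ε : HolonomyGroupoid M} (h : γ.src = δ.rng) (h' : δ.src = ε.rng)
    (ha : γ.rng ∈ (F a).Ω none) (hβ : γ.src ∈ f.Ω β) (hν : δ.src ∈ f.Ω ν)
    (hb : ε.src ∈ (F b).Ω none) :
    glueProd F a b β γ (prod δ ε) = glueProd F a b ν (prod γ δ) ε := by
  have h1 : γ.src ∈ (F a).Ω (some β) := (hF a).1 β ▸ hβ
  have h2 : δ.src ∈ (F a).Ω (some ν) := (hF a).1 ν ▸ hν
  have h3 : δ.rng ∈ (F b).Ω (some β) := (hF b).1 β ▸ h ▸ hβ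
  have h4 : δ.src ∈ (F b).Ω (some ν) := (hF b).1 ν ▸ hν
  have e1 : (F a).map (some β) (some ν) δ = (F b).map (some β) (some ν) δ :=
    ((hF a).2 β ν δ (h ▸ hβ) hν).symm.trans ((hF b).2 β ν δ (h ▸ hβ) hν)
  rw [glueProd, glueProd, ← (F a).prod_map h ha h1 h2, ← (F b).prod_map h' h3 h4 hb, e1,
    HolonomyGroupoid.prod_assoc]
  · rw [← e1]
    exact (F a).src_map_eq_rng_map h ha h1 h2
  · exact (F b).src_map_eq_rng_map h' h3 h4 hb

theorem inv_glueProd (hF : ∀ a, (F a).IsRestriction some f) {a b : ι} {β : κ}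
    {γ δ : HolonomyGroupoid M} (h : γ.src = δ.rng) (ha : γ.rng ∈ (F a).Ω none)
    (hβ : γ.src ∈ f.Ω β) (hb : δ.src ∈ (F b).Ω none) :
    (glueProd F a b β γ δ).inv = glueProd F b a β δ.inv γ.inv := by
  have h1 : γ.src ∈ (F a).Ω (some β) := (hF a).1 β ▸ hβ
  have h3 : δ.rng ∈ (F b).Ω (some β) := (hF b).1 β ▸ h ▸ hβ
  rw [glueProd, inv_prod (glueProd_composable hF h ha hβ hb), ← (F a).map_inv _ _ _ ha h1,
    ← (F b).map_inv _ _ _ h3 hb]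
  rfl

/-- The two inner factors are values of `F b` at the unit of `x`, leading from `β` to `none` and
back. Their product is the value of `f` at this unit, which is absorbed by the factor from `F a`. -/
theorem prod_glueProd (hF : ∀ a, (F a).IsRestriction some f) {a b c : ι} {β : κ}
    {γ δ : HolonomyGroupoid M} {x : M} (h : γ.src = x) (h' : x = δ.rng)
    (ha : γ.rng ∈ (F a).Ω none) (hβ : x ∈ f.Ω β) (hb : x ∈ (F b).Ω none)
    (hc : δ.src ∈ (F c).Ω none) :
    (glueProd F a b β γ (unit x)).src = (glueProd F b c β (unit x) δ).rng ∧
    prod (glueProd F a b β γ (unit x)) (glueProd F b c β (unit x) δ) = glueProd F a c β γ δ := by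
  subst h
  have g1 := glueProd_composable hF (a := a) (b := b) (δ := unit γ.src) rfl ha hβ hb
  have g2 := glueProd_composable hF (a := b) (b := c) (γ := unit γ.src) h' hb hβ hc
  have hβ' : γ.src ∈ (F b).Ω (some β) := (hF b).1 β ▸ hβ
  have hβ'' : γ.src ∈ (F a).Ω (some β) := (hF a).1 β ▸ hβ
  have g3 := (F b).src_map_eq_rng_map (γ := unit γ.src) (δ := unit γ.src) rfl hβ' hb hβ'
  have g4 := (F b).prod_map (γ := unit γ.src) (δ := unit γ.src) rfl hβ' hb hβ'
  have e1 : (F b).map (some β) (some β) (unit γ.src) = (F a).map (some β) (some β) (unit γ.src) :=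
    ((hF b).2 β β (unit γ.src) hβ hβ).symm.trans ((hF a).2 β β (unit γ.src) hβ hβ)
  have g5 := (F a).prod_map (γ := γ) (δ := unit γ.src) rfl ha hβ'' hβ''
  have e2 : prod (unit γ.src) (unit γ.src) = unit γ.src := unit_prod (unit γ.src)
  have g6 : (glueProd F a b β γ (unit γ.src)).src = ((F b).map none (some β) (unit γ.src)).rng := by
    rw [glueProd, prod_src g1]
    exact g3
  rw [e2] at g4
  rw [prod_unit] at g5
  refine ⟨?_, ?_⟩
  · rw [g6, glueProd, prod_rng g2]
  · rw [glueProd.eq_1 F b c, ← prod_assoc g6 g2, glueProd, prod_assoc g1 g3, g4, e1, g5]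
    rfl

/-- Smooth maps of leaf spaces with a common restriction can be glued. -/
theorem exists_glue (hF : ∀ a, (F a).IsRestriction some f)
    (hc : ∀ x, ∃ a, x ∈ (F a).Ω none) : ∃ G : LeafMapOn M N ι, (∀ a, G.Ω a = (F a).Ω none) ∧
      ∀ a b γ β, γ.rng ∈ (F a).Ω none → γ.src ∈ (F b).Ω none → γ.src ∈ f.Ω β →
        G.map a b γ = glueProd F a b β γ (unit γ.src) := by
  -- The index depends on the point without any continuity; `hl` shows that the choice does not
  -- matter, and `hr` that `γ` may be put into either factor. Both are shifts in which some of the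
  -- classes are units.
  choose β hβ using f.cover
  have hl : ∀ {a b : ι} {γ : HolonomyGroupoid M} {ν ν' : κ}, γ.rng ∈ (F a).Ω none →
      γ.src ∈ (F b).Ω none → γ.src ∈ f.Ω ν → γ.src ∈ f.Ω ν' →
      glueProd F a b ν γ (unit γ.src) = glueProd F a b ν' γ (unit γ.src) := by
    intro a b γ ν ν' ha hb h1 h2
    have := glueProd_shift hF (γ := γ) (δ := unit γ.src) (ε := unit γ.src) rfl rfl ha h1 h2 hb
    rwa [prod_unit, show prod (unit γ.src) (unit γ.src) = unit γ.src from unit_prod (unit γ.src)]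
      at this
  have hr : ∀ {a b : ι} {γ : HolonomyGroupoid M} {ν ν' : κ}, γ.rng ∈ (F a).Ω none →
      γ.src ∈ (F b).Ω none → γ.rng ∈ f.Ω ν → γ.src ∈ f.Ω ν' →
      glueProd F a b ν (unit γ.rng) γ = glueProd F a b ν' γ (unit γ.src) := by
    intro a b γ ν ν' ha hb h1 h2
    have := glueProd_shift hF (γ := unit γ.rng) (δ := γ) (ε := unit γ.src) rfl rfl ha h1 h2 hb
    rwa [prod_unit, unit_prod] at this
  refine ⟨⟨fun a => (F a).Ω none, fun a => (F a).isOpen _, hc,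
    fun a b γ => glueProd F a b (β γ.src) γ (unit γ.src), fun a b => ?_, fun a b γ ha hb => ?_,
    fun a b c γ δ h ha hb hc => ?_⟩, fun _ => rfl, fun a b γ ν ha hb hν => hl ha hb (hβ _) hν⟩
  -- Near `γ` the index can be kept fixed, and then the glued map is a product of two smooth maps.
  · refine SmoothOnGroupoid.of_locally fun γ hγ => ⟨_, ((f.isOpen (β γ.src)).preimage
      continuous_src).mem_nhds (hβ γ.src), ?_⟩
    refine SmoothOnGroupoid.mul (F₁ := (F a).map none (some (β γ.src)))
      (F₂ := fun δ => (F b).map (some (β γ.src)) none (unit δ.src)) ?_ ?_ ?_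
    · refine ((F a).smooth none (some (β γ.src))).mono fun δ hδ => ⟨hδ.1.1, ?_⟩
      rw [← (hF a).1]
      exact hδ.2
    · refine SmoothOnGroupoid.comp ((F b).smooth (some (β γ.src)) none)
        (smoothOnGroupoid_unit_src _) fun δ hδ => ⟨?_, hδ.1.2⟩
      rw [← (hF b).1]
      exact hδ.2
    · intro δ hδ
      have h1 := glueProd_composable hF (γ := δ) (δ := unit δ.src) rfl hδ.1.1 hδ.2 hδ.1.2
      exact ⟨h1, (hl hδ.1.1 hδ.1.2 (hβ _) hδ.2).trans (prod_eq h1)⟩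
  · rw [inv_glueProd hF (δ := unit γ.src) rfl ha (hβ _) hb, inv_unit]
    exact (hr (γ := γ.inv) hb ha (hβ _) (hβ _)).symm
  · have hδ : δ.rng ∈ (F b).Ω none := h ▸ hb
    have h1 := prod_glueProd hF (γ := γ) (δ := δ) (x := γ.src) rfl h ha (hβ _) hb hc
    have h2 : glueProd F b c (β γ.src) (unit γ.src) δ =
        glueProd F b c (β δ.src) δ (unit δ.src) := by
      rw [h]
      exact hr hδ hc (hβ _) (hβ _)
    have h3 := glueProd_shift hF (ε := unit δ.src) h rfl ha (hβ _) (hβ _) hc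
    rw [prod_unit, prod_eq h] at h3
    rw [h2] at h1
    exact ⟨h1.1, (prod_eq h1.1).symm.trans (h1.2.trans h3)⟩

end Glue

end LeafMapOn

namespace LeafMap

theorem equivalence_isEquivalent (M N : CompactFoliation.{u}) :
    Equivalence (IsEquivalent (M := M) (N := N)) where
  refl f := equiv_of_isRestriction f.data _ _ f.data.isRestriction_self f.data.isRestriction_self
  symm := fun ⟨F, h, h'⟩ => equiv_of_isRestriction F _ _ h' h
  trans := by
    rintro f g h ⟨F, hf, hg⟩ ⟨H, hg', hh⟩
    -- Each single index of `f` or `h` is adjoined to the indices of `g` as `none`. All the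
    -- resulting maps restrict to `g` along `some`, which is the situation of `exists_glue`.
    let s : f.ι → Option g.ι → f.ι ⊕ g.ι := fun a i => i.elim (Sum.inl a) Sum.inr
    let t : h.ι → Option g.ι → g.ι ⊕ h.ι := fun a i => i.elim (Sum.inr a) Sum.inl
    have hcs : ∀ a x, ∃ i, x ∈ F.Ω (s a i) := fun a x => by
      obtain ⟨β, hβ⟩ := g.data.cover x
      exact ⟨some β, hg.1 β ▸ hβ⟩
    have hct : ∀ a x, ∃ i, x ∈ H.Ω (t a i) := fun a x => by
      obtain ⟨β, hβ⟩ := g.data.cover x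
      exact ⟨some β, hg'.1 β ▸ hβ⟩
    let K : f.ι ⊕ h.ι → LeafMapOn M N (Option g.ι) :=
      Sum.elim (fun a => F.reindex (s a) (hcs a)) (fun a => H.reindex (t a) (hct a))
    have hK : ∀ a, (K a).IsRestriction some g.data := by
      rintro (a | a)
      · exact hg
      · exact hg'
    obtain ⟨G, hG, hG'⟩ := LeafMapOn.exists_glue hK fun x => by
      obtain ⟨α, hα⟩ := f.data.cover x
      exact ⟨Sum.inl α, hf.1 α ▸ hα⟩
    refine ⟨G, ⟨fun α => (hf.1 α).trans (hG (Sum.inl α)).symm, fun α β γ hr hs => ?_⟩,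
      ⟨fun α => (hh.1 α).trans (hG (Sum.inr α)).symm, fun α β γ hr hs => ?_⟩⟩
    -- Between two indices of `f` both factors come from `F`, so their product is again a value of
    -- `F`, and it agrees with `f`.
    · obtain ⟨ν, hν⟩ := g.data.cover γ.src
      have hr' : γ.rng ∈ F.Ω (Sum.inl α) := hf.1 α ▸ hr
      have hs' : γ.src ∈ F.Ω (Sum.inl β) := hf.1 β ▸ hs
      have hν' : γ.src ∈ F.Ω (Sum.inr ν) := hg.1 ν ▸ hν
      rw [hG' (Sum.inl α) (Sum.inl β) γ ν hr' hs' hν, hf.2 α β γ hr hs]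
      have h1 := F.prod_map (γ := γ) (δ := unit γ.src) rfl hr' hν' hs'
      rw [prod_unit] at h1
      exact h1.symm
    · obtain ⟨ν, hν⟩ := g.data.cover γ.src
      have hr' : γ.rng ∈ H.Ω (Sum.inr α) := hh.1 α ▸ hr
      have hs' : γ.src ∈ H.Ω (Sum.inr β) := hh.1 β ▸ hs
      have hν' : γ.src ∈ H.Ω (Sum.inl ν) := hg'.1 ν ▸ hν
      rw [hG' (Sum.inr α) (Sum.inr β) γ ν hr' hs' hν, hh.2 α β γ hr hs]
      have h1 := H.prod_map (γ := γ) (δ := unit γ.src) rfl hr' hν' hs'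
      rw [prod_unit] at h1
      exact h1.symm

end LeafMap

open HolonomyGroupoid

/-! ### The maps of manifolds underlying a smooth map of leaf spaces -/

theorem HolonomyChart.exists_nhds_forall {C : HolonomyChart M} {γ : HolonomyGroupoid M}
    (hC : γ ∈ C.dom) {P : HolonomyGroupoid M → Prop} (h : ∀ᶠ δ in 𝓝 γ, P δ) :
    ∃ U ∈ 𝓝 γ.src, ∃ V ∈ 𝓝 γ.rng, ∀ δ ∈ C.dom, δ.src ∈ U → δ.rng ∈ V → P δ := by
  rw [C.nhds_eq hC] at h
  obtain ⟨A, hA, B, ⟨V, hV, hVB⟩, hAB⟩ := mem_inf_iff_superset.1 h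
  obtain ⟨A₁, hA₁, A₂, ⟨U, hU, hUA⟩, hA'⟩ := mem_inf_iff_superset.1 hA
  exact ⟨U, hU, V, hV, fun δ h1 h2 h3 =>
    hAB ⟨hA' ⟨mem_principal.1 hA₁ h1, hUA h2⟩, hVB h3⟩⟩

namespace LeafMapOn

variable {ι : Type u} (f : LeafMapOn M N ι) {α β : ι}

theorem tendsto_map_unit {x : M} (hα : x ∈ f.Ω α) (hβ : x ∈ f.Ω β) :
    Tendsto (fun y => f.map α β (unit y)) (𝓝 x) (𝓝 (f.map α β (unit x))) := by
  have h := (f.smooth α β (unit x) ⟨hα, hβ⟩).1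
  refine h.tendsto.comp (tendsto_nhdsWithin_iff.2 ⟨continuous_unit.continuousAt, ?_⟩)
  filter_upwards [(f.isOpen α).mem_nhds hα, (f.isOpen β).mem_nhds hβ] with y h1 h2
  exact ⟨h1, h2⟩

theorem continuousAt_base {x : M} (hx : x ∈ f.Ω α) : ContinuousAt (f.base α) x :=
  (f.continuousOn_base α).continuousAt ((f.isOpen α).mem_nhds hx)

/-- In a unit chart the unit at `y` has coordinates `(φ y, (φ y).1)`. Along this embedding the first
component of the coordinate expression of `f.map α α` is the base map. -/
theorem contMDiffAt_base {x : M} (hx : x ∈ f.Ω α) : ContMDiffAt M.I N.I ∞ (f.base α) x := by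
  set φ := chartAt M.Model x
  set ψ := chartAt N.Model (f.base α x)
  have hφ : x ∈ φ.source := mem_chart_source _ _
  have hψ : f.base α x ∈ ψ.source := mem_chart_source _ _
  have hC := unit_mem_unitChart_dom (chart_mem_atlas M.Model x) hφ
  have hD := unit_mem_unitChart_dom (chart_mem_atlas N.Model (f.base α x)) hψ
  rw [← f.map_unit hx] at hD
  obtain ⟨Φ, hΦ, hΦ'⟩ := (f.smooth α α (unit x) ⟨hx, hx⟩).2 _ _ hC hD
  change ContDiffAt ℝ ∞ Φ (φ x, (φ x).1) at hΦ
  have hu : Tendsto unit (𝓝 x) (𝓝[{γ | γ.rng ∈ f.Ω α ∧ γ.src ∈ f.Ω α}] unit x) := by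
    refine tendsto_nhdsWithin_iff.2 ⟨continuous_unit.continuousAt, ?_⟩
    filter_upwards [(f.isOpen α).mem_nhds hx] with y h1
    exact ⟨h1, h1⟩
  have key : f.base α =ᶠ[𝓝 x] fun y => ψ.symm (Φ (φ y, (φ y).1)).1 := by
    filter_upwards [hu.eventually hΦ', (f.isOpen α).mem_nhds hx,
      (f.continuousAt_base hx).eventually_mem (ψ.open_source.mem_nhds hψ)] with y h1 h2 h3
    rw [f.map_unit h2] at h1
    change (ψ (f.base α y), (ψ (f.base α y)).1) = Φ (φ y, (φ y).1) at h1
    rw [← h1, ψ.left_inv h3]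
  have key' : ψ (f.base α x) = (Φ (φ x, (φ x).1)).1 := by
    have h1 := hΦ'.self_of_nhdsWithin (show unit x ∈ _ from ⟨hx, hx⟩)
    rw [f.map_unit hx] at h1
    exact congrArg Prod.fst h1
  refine ContMDiffAt.congr_of_eventuallyEq ?_ key
  have h1 : ContMDiffAt M.I 𝓘(ℝ, M.Model) ∞ φ x :=
    (contMDiffOn_of_mem_maximalAtlas (mem_maximalAtlas (chart_mem_atlas M.Model x))).contMDiffAt
      (φ.open_source.mem_nhds hφ)
  have h2 : ContDiffAt ℝ ∞ (fun q : M.Model => (Φ (q, q.1)).1) (φ x) :=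
    ContDiffAt.fst (ContDiffAt.comp (f := fun q : M.Model => (q, q.1)) (φ x) hΦ
      (contDiff_id.prodMk contDiff_fst).contDiffAt)
  have h3 : ContMDiffAt 𝓘(ℝ, N.Model) N.I ∞ ψ.symm (Φ (φ x, (φ x).1)).1 := by
    rw [← key']
    exact (contMDiffOn_symm_of_mem_maximalAtlas
      (mem_maximalAtlas (chart_mem_atlas N.Model _))).contMDiffAt
      (ψ.open_target.mem_nhds (ψ.map_source hψ))
  exact ContMDiffAt.comp (f := fun y => (Φ (φ y, (φ y).1)).1) x h3
    (ContMDiffAt.comp (f := φ) (g := fun q : M.Model => (Φ (q, q.1)).1) x h2.contMDiffAt h1)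

/-- If `y` is near `x` on the same plaque, a class near the unit joins them. Its image is near the
unit at the image of `x`, hence in the domain of a unit chart, and so the images of `x` and `y` lie
on one plaque. -/
theorem modelDeriv_base_snd_eq_zero {x : M} (hx : x ∈ f.Ω α) {v : M.Model} (hv : v.2 = 0) :
    (modelDeriv (f.base α) x v).2 = 0 := by
  have hxs := mem_chart_source M.Model x
  have hfs := mem_chart_source N.Model (f.base α x)
  have hC := unit_mem_unitChart_dom (chart_mem_atlas M.Model x) hxs
  have hD := unit_mem_unitChart_dom (chart_mem_atlas N.Model (f.base α x)) hfs
  rw [← f.map_unit hx] at hD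
  refine modelDeriv_snd_eq_zero ((f.contMDiffAt_base hx).of_le (by norm_num))
    (chart_mem_atlas M.Model x) hxs (chart_mem_atlas N.Model (f.base α x)) hfs ?_ hv
  have h1 := eventually_nhdsWithin_iff.1
    ((f.smooth α α (unit x) ⟨hx, hx⟩).1.eventually (HolonomyChart.dom_mem_nhds _ hD))
  obtain ⟨U, hU, V, hV, h2⟩ := HolonomyChart.exists_nhds_forall hC h1
  obtain ⟨W, hW, hWs, hW'⟩ := eventually_segment_mem x univ_mem
  filter_upwards [hW, hV, (f.isOpen α).mem_nhds hx] with y hy hy' hy'' he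
  obtain ⟨γ, hγ, hs, hr⟩ := exists_mem_unitChart_dom (chart_mem_atlas M.Model x)
    hxs (hWs hy) (fun s hs => (hW' x (mem_of_mem_nhds hW) y hy s hs).1) he.symm
  have h3 : γ.rng ∈ f.Ω α := hr ▸ hy''
  have h4 : γ.src ∈ f.Ω α := hs ▸ hx
  have h5 := (h2 γ hγ (hs ▸ mem_of_mem_nhds hU) (hr ▸ hy') ⟨h3, h4⟩).2.2.2.1
  rw [f.src_map h3 h4, f.rng_map h3 h4, hs, hr] at h5
  exact h5.symm

theorem exists_form_modelDeriv_base_le (g : M.Metric) (h : N.Metric) {K : Set M}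
    (hK : IsCompact K) (hKα : K ⊆ f.Ω α) : ∃ L : ℝ≥0, ∀ x ∈ K, ∀ v : M.Model,
      form h (f.base α x) (modelDeriv (f.base α) x v) (modelDeriv (f.base α) x v) ≤
        L * form g x v v := by
  refine hK.exists_nnreal_forall (P := fun L x => ∀ v : M.Model,
    form h (f.base α x) (modelDeriv (f.base α) x v) (modelDeriv (f.base α) x v) ≤
        L * form g x v v) (fun x L L' hL h' v => (h' v).trans
      (mul_le_mul_of_nonneg_right (NNReal.coe_le_coe.2 hL) (form_nonneg _ _ _))) fun x hx => ?_
  obtain ⟨L, hL⟩ := eventually_form_modelDeriv_le g h (f := f.base α) (x₀ := x) (by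
    filter_upwards [(f.isOpen α).mem_nhds (hKα hx)] with y hy
    exact (f.contMDiffAt_base hy).of_le (by norm_num))
  exact ⟨L, mem_nhdsWithin_of_mem_nhds hL⟩

/-! ### Estimates on the cone that are uniform in the height -/

/-- The map of cones `(t, x) ↦ (t, f_α x)`. -/
noncomputable def coneBase (α : ι) (z : M.Cone) : N.Cone := (z.1, f.base α z.2)

theorem contMDiffAt_coneBase {z : M.Cone} (hz : z.2 ∈ f.Ω α) :
    ContMDiffAt M.coneI N.coneI 1 (f.coneBase α) z :=
  contMDiffAt_fst.prodMk
    ((((f.contMDiffAt_base hz).of_le (by norm_num)) : ContMDiffAt M.I N.I 1 _ _).comp z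
      contMDiffAt_snd)

theorem mfderiv_coneBase {z : M.Cone} (hz : z.2 ∈ f.Ω α)
    (v : EuclideanSpace ℝ (Fin 1) × M.Model) :
    mfderiv M.coneI N.coneI (f.coneBase α) z v = (v.1, modelDeriv (f.base α) z.2 v.2) := by
  have h1 := ((f.contMDiffAt_base hz).mdifferentiableAt (by simp)).hasMFDerivAt
  have h2 := ((hasMFDerivAt_fst (I := 𝓡∂ 1) (I' := M.I) z).prodMk
    (h1.comp z (hasMFDerivAt_snd (I := 𝓡∂ 1) (I' := M.I) z))).mfderiv
  exact congrArg (fun A : (EuclideanSpace ℝ (Fin 1) × M.Model) →L[ℝ]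
    (EuclideanSpace ℝ (Fin 1) × N.Model) => A v) h2

theorem exists_coneMetric_mfderiv_le (g : M.Metric) (h : N.Metric) {K : Set M}
    (hK : IsCompact K) (hKα : K ⊆ f.Ω α) : ∃ L : ℝ≥0, ∀ z : M.Cone, z.2 ∈ K →
      ∀ v : TangentSpace M.coneI z, (coneMetric h).inner (f.coneBase α z)
        (mfderiv M.coneI N.coneI (f.coneBase α) z v)
        (mfderiv M.coneI N.coneI (f.coneBase α) z v) ≤ L ^ 2 * (coneMetric g).inner z v v := by
  obtain ⟨L, hL⟩ := f.exists_form_modelDeriv_base_le g h hK hKα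
  refine ⟨L + 1, fun z hz v => ?_⟩
  have hL1 : (1 : ℝ) ≤ (L + 1 : ℝ≥0) := by simp
  rw [show mfderiv M.coneI N.coneI (f.coneBase α) z v = _ from f.mfderiv_coneBase (hKα hz) v]
  refine (coneMetric_inner_self h (f.coneBase α z) _).trans_le (le_of_le_of_eq ?_
    (congrArg (((L + 1 : ℝ≥0) : ℝ) ^ 2 * ·) (coneMetric_inner_self g z v).symm))
  refine coneSq_map_le (A := modelDeriv (f.base α) z.2)
    (fun v hv => f.modelDeriv_base_snd_eq_zero (hKα hz) hv) hL1 (fun v => ?_) _ _ _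
  refine (hL z.2 hz v).trans (mul_le_mul_of_nonneg_right ?_ (form_nonneg _ _ _))
  push_cast
  nlinarith [L.2]

/-- The class `f.map β α (unit x)` leads from one point to the other and depends continuously on
`x`. The bound for nearby classes is therefore locally uniform, and `K` is compact. -/
theorem exists_sliceClose_base (h : N.Metric) {K : Set M} (hK : IsCompact K) (hα : K ⊆ f.Ω α)
    (hβ : K ⊆ f.Ω β) : ∃ J : ℝ≥0, ∀ x ∈ K, SliceClose h J (f.base α x) (f.base β x) := by
  refine hK.exists_nnreal_forall (P := fun J x => SliceClose h J (f.base α x) (f.base β x))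
    (fun x L L' hL h' => h'.mono hL) fun x hx => ?_
  obtain ⟨J, hJ⟩ := exists_eventually_sliceClose h (f.map β α (unit x))
  refine ⟨J, mem_nhdsWithin_of_mem_nhds ?_⟩
  filter_upwards [(f.tendsto_map_unit (hβ hx) (hα hx)).eventually hJ,
    (f.isOpen α).mem_nhds (hα hx), (f.isOpen β).mem_nhds (hβ hx)] with y h1 h2 h3
  rwa [f.src_map (γ := unit y) h3 h2, f.rng_map (γ := unit y) h3 h2] at h1

end LeafMapOn

end CompactFoliation

/-- A map which is piecewise continuous, with finitely many Borel pieces, is a Borel map. -/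
theorem measurable_borel_of_pieces {X Y κ : Type*} [TopologicalSpace X] [TopologicalSpace Y]
    [Countable κ] {U : κ → Set X} (hU : ∀ k, IsOpen (U k)) {c : κ → X → Y}
    (hc : ∀ k, ContinuousOn (c k) (U k)) {i : X → κ} (hi : @Measurable X κ (borel X) ⊤ i)
    (hiU : ∀ x, x ∈ U (i x)) : @Measurable X Y (borel X) (borel Y) fun x => c (i x) x := by
  let : MeasurableSpace X := borel X
  have : BorelSpace X := ⟨rfl⟩
  let : MeasurableSpace Y := borel Y
  have : BorelSpace Y := ⟨rfl⟩
  refine measurable_of_isOpen fun O hO => ?_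
  have h : (fun x => c (i x) x) ⁻¹' O = ⋃ k, i ⁻¹' {k} ∩ (U k ∩ c k ⁻¹' O) := by
    ext x
    simp only [mem_preimage, mem_iUnion, mem_inter_iff, mem_singleton_iff]
    exact ⟨fun h => ⟨i x, rfl, hiU x, h⟩, by rintro ⟨k, rfl, -, h⟩; exact h⟩
  rw [h]
  exact MeasurableSet.iUnion fun k => (@hi {k} trivial).inter
    ((hc k).isOpen_inter_preimage (hU k) hO).measurableSet

namespace CompactFoliation

variable {M N P : CompactFoliation.{u}}

/-! ### Induced maps of cones -/

namespace LeafMap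

theorem IsInduced.of_finite {f : LeafMap M N} {F : M.Cone → N.Cone} {κ : Type*} [Finite κ]
    {U : κ → Set M} {α : κ → f.ι} {i : M → κ}
    (hU : ∀ k, IsOpen (U k) ∧ closure (U k) ⊆ f.data.Ω (α k))
    (hi : @Measurable M κ (borel M) ⊤ i) (hiU : ∀ x, x ∈ U (i x))
    (hF : ∀ t x, F (t, x) = (t, f.data.base (α (i x)) x)) : f.IsInduced F := by
  obtain ⟨m, ⟨e⟩⟩ := Finite.exists_equiv_fin κ
  refine ⟨m, fun k => U (e.symm k), fun k => α (e.symm k), fun x => e (i x), fun k => hU _, ?_, ?_,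
    ?_⟩
  · exact @Measurable.comp _ _ _ (borel M) ⊤ ⊤ _ _ measurable_from_top hi
  · simpa using hiU
  · simpa using hF

theorem IsInduced.of_isRestriction {κ : Type u} {G : LeafMapOn M N κ} {f : LeafMap M N}
    {s : f.ι → κ} (h : G.IsRestriction s f.data) {F : M.Cone → N.Cone} (hF : f.IsInduced F) :
    (LeafMap.mk κ G).IsInduced F := by
  obtain ⟨m, U, α, i, hU, hi, hiU, hF⟩ := hF
  refine ⟨m, U, fun k => s (α k), i, fun k => ⟨(hU k).1, h.1 (α k) ▸ (hU k).2⟩, hi, hiU,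
    fun t x => ?_⟩
  rw [hF, h.base_eq ((hU _).2 (subset_closure (hiU x)))]

theorem isInduced_id (M : CompactFoliation.{u}) : (LeafMap.id M).IsInduced _root_.id :=
  IsInduced.of_finite (κ := Unit) (U := fun _ => univ) (α := fun _ => PUnit.unit)
    (i := fun _ => ()) (fun _ => ⟨isOpen_univ, fun _ _ => mem_univ _⟩)
    (@measurable_const _ _ ⊤ (borel M) _) (fun _ => mem_univ _) fun _ _ => rfl

/-- The pieces are the parts of `U k` which `f` maps into `U' l`. A point in the closure of such a
piece lies in the open set where the base map is continuous, so its image lies in the closure of `U'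
l`. -/
theorem IsInduced.comp {f : LeafMap M N} {f' : LeafMap N P} {F : M.Cone → N.Cone}
    {F' : N.Cone → P.Cone} (hF : f.IsInduced F) (hF' : f'.IsInduced F') :
    (f.comp f').IsInduced (F' ∘ F) := by
  obtain ⟨m, U, α, i, hU, hi, hiU, hF⟩ := hF
  obtain ⟨m', U', α', i', hU', hi', hiU', hF'⟩ := hF'
  have hUα : ∀ k, U k ⊆ f.data.Ω (α k) := fun k => subset_closure.trans (hU k).2
  have hb := measurable_borel_of_pieces (fun k => (hU k).1)
    (fun k => (f.data.continuousOn_base (α k)).mono (hUα k)) hi hiU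
  refine IsInduced.of_finite (κ := Fin m × Fin m')
    (U := fun k => U k.1 ∩ f.data.base (α k.1) ⁻¹' U' k.2) (α := fun k => (α k.1, α' k.2))
    (i := fun x => (i x, i' (f.data.base (α (i x)) x))) (fun k => ⟨?_, fun x hx => ?_⟩) ?_
    (fun x => ⟨hiU x, hiU' _⟩) fun t x => ?_
  · exact ((f.data.continuousOn_base _).mono (hUα _)).isOpen_inter_preimage (hU _).1 (hU' _).1
  · have h1 := (hU _).2 (closure_mono inter_subset_left hx)
    refine ⟨h1, (hU' _).2 ?_⟩
    exact closure_mono (by rintro _ ⟨y, hy, rfl⟩; exact hy.2)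
      (mem_closure_image (f.data.continuousAt_base h1) hx)
  · let : MeasurableSpace M := borel M
    let : MeasurableSpace N := borel N
    have h1 : Measurable i := hi
    have h2 : Measurable fun x => i' (f.data.base (α (i x)) x) := Measurable.comp hi' hb
    have h3 := h1.prodMk h2
    refine Measurable.mono h3 le_rfl ?_
    exact fun s _ => s.to_countable.measurableSet
  · rw [Function.comp_apply, hF, hF']
    exact congrArg (Prod.mk t) (f.data.base_comp f'.data
      (α (i x), α' (i' (f.data.base (α (i x)) x))) (hUα _ (hiU x))).symm

/-- Every smooth map of leaf spaces induces a map of cones. -/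
theorem exists_isInduced (f : LeafMap M N) : ∃ F : M.Cone → N.Cone, f.IsInduced F := by
  choose α hα using f.data.cover
  have h : ∀ x, ∃ t ∈ 𝓝 x, IsClosed t ∧ t ⊆ f.data.Ω (α x) := fun x =>
    exists_mem_nhds_isClosed_subset ((f.data.isOpen _).mem_nhds (hα x))
  choose V hV hVc hVα using h
  obtain ⟨t, ht⟩ := CompactSpace.elim_nhds_subcover (fun x => interior (V x))
    fun x => interior_mem_nhds.2 (hV x)
  obtain ⟨m, ⟨e⟩⟩ := Finite.exists_equiv_fin t
  set U : Fin m → Set M := fun k => interior (V (e.symm k)) with hUdef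
  have hne : ∀ x, {k | x ∈ U k}.Nonempty := by
    intro x
    have : x ∈ ⋃ y ∈ t, interior (V y) := ht ▸ mem_univ x
    obtain ⟨y, hy, hxy⟩ := mem_iUnion₂.1 this
    exact ⟨e ⟨y, hy⟩, by simpa [hUdef] using hxy⟩
  -- Taking the least index makes the level sets finite Boolean combinations of open sets, hence
  -- Borel.
  set i : M → Fin m := fun x => wellFounded_lt.min {k | x ∈ U k} (hne x) with hi
  have hiU : ∀ x, x ∈ U (i x) := fun x => wellFounded_lt.min_mem {k | x ∈ U k} (hne x)
  refine ⟨fun z => (z.1, f.data.base (α (e.symm (i z.2))) z.2), m, U, fun k => α (e.symm k), i,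
    fun k => ⟨isOpen_interior, ?_⟩, ?_, hiU, fun _ _ => rfl⟩
  · exact (closure_minimal interior_subset (hVc _)).trans (hVα _)
  · let : MeasurableSpace M := borel M
    have : BorelSpace M := ⟨rfl⟩
    refine @measurable_to_countable' _ _ ⊤ _ _ _ fun k => ?_
    have h : i ⁻¹' {k} = U k ∩ ⋂ j ∈ Iio k, (U j)ᶜ := by
      ext x
      simp only [mem_preimage, mem_singleton_iff, mem_inter_iff, mem_iInter, mem_compl_iff]
      constructor
      · rintro rfl
        exact ⟨hiU x, fun j hj hx => wellFounded_lt.not_lt_min {k | x ∈ U k} hx hj⟩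
      · rintro ⟨h1, h2⟩
        refine le_antisymm ?_ ?_
        · by_contra! h3
          exact wellFounded_lt.not_lt_min {k | x ∈ U k} h1 h3
        · by_contra! h3
          exact h2 _ h3 (hiU x)
    rw [h]
    exact isOpen_interior.measurableSet.inter (MeasurableSet.biInter (to_countable _)
      fun j _ => isOpen_interior.measurableSet.compl)

/-- Any two maps of cones which are induced by the same smooth map of leaf spaces are close. -/
theorem IsInduced.exists_coneEDist_le {f : LeafMap M N} {F F' : M.Cone → N.Cone}
    (hF : f.IsInduced F) (hF' : f.IsInduced F') (h : N.Metric) :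
    ∃ J : ℝ≥0, ∀ z, coneEDist h (F z) (F' z) ≤ J := by
  obtain ⟨m, U, α, i, hU, hi, hiU, hF⟩ := hF
  obtain ⟨m', U', α', i', hU', hi', hiU', hF'⟩ := hF'
  have hJ : ∀ k : Fin m × Fin m', ∃ J : ℝ≥0, ∀ x ∈ closure (U k.1) ∩ closure (U' k.2),
      SliceClose h J (f.data.base (α k.1) x) (f.data.base (α' k.2) x) := fun k =>
    f.data.exists_sliceClose_base h (isClosed_closure.inter isClosed_closure).isCompact
      (inter_subset_left.trans (hU _).2) (inter_subset_right.trans (hU' _).2)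
  choose J hJ using hJ
  obtain ⟨J₀, hJ₀⟩ := Finite.exists_le J
  refine ⟨J₀, fun z => ?_⟩
  have h1 := (hJ (i z.2, i' z.2) z.2 ⟨subset_closure (hiU _), subset_closure (hiU' _)⟩).mono
    (hJ₀ _) z.1
  rw [← hF, ← hF'] at h1
  exact h1

/-- A path shorter than a Lebesgue number of the cover projects into a single `U k`. There `F` is
replaced by the smooth map `coneBase (α k)`: the bound consists of a jump at each end and the length
of the image path. -/
theorem IsInduced.exists_coneEDist_le_of_length_le {f : LeafMap M N} {F : M.Cone → N.Cone}
    (hF : f.IsInduced F) (g : M.Metric) (h : N.Metric) :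
    ∃ δ D : ℝ≥0, 0 < δ ∧ ∀ (c : ℝ → M.Cone) (a b : ℝ), a ≤ b →
      ContMDiffOn 𝓘(ℝ, ℝ) M.coneI 1 c (Icc a b) → (coneMetric g).length c a b ≤ δ →
        coneEDist h (F (c a)) (F (c b)) ≤ D := by
  obtain ⟨m, U, α, i, hU, hi, hiU, hF⟩ := hF
  have hL := fun k => f.data.exists_coneMetric_mfderiv_le g h
    (isClosed_closure (s := U k)).isCompact (hU k).2
  choose L hL using hL
  obtain ⟨L₀, hL₀⟩ := Finite.exists_le L
  have hJ : ∀ k : Fin m × Fin m, ∃ J : ℝ≥0, ∀ x ∈ closure (U k.1) ∩ closure (U k.2),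
      SliceClose h J (f.data.base (α k.1) x) (f.data.base (α k.2) x) := fun k =>
    f.data.exists_sliceClose_base h (isClosed_closure.inter isClosed_closure).isCompact
      (inter_subset_left.trans (hU _).2) (inter_subset_right.trans (hU _).2)
  choose J hJ using hJ
  obtain ⟨J₀, hJ₀⟩ := Finite.exists_le J
  have hleb : ∃ δ : ℝ≥0∞, 0 < δ ∧ ∀ x, ∃ k, {y | metricEDist g x y < δ} ⊆ U k := by
    obtain ⟨δ, hδ, h⟩ := @lebesgue_number_lemma_of_emetric M (emetricSpace g) univ (Fin m) U
      isCompact_univ (fun k => (hU k).1) fun x _ => mem_iUnion.2 ⟨i x, hiU x⟩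
    refine ⟨δ, hδ, fun x => ?_⟩
    obtain ⟨k, hk⟩ := h x (mem_univ x)
    refine ⟨k, fun y hy => hk ?_⟩
    exact (@Metric.mem_eball' M (emetricSpace g) x y δ).2 hy
  obtain ⟨δ, hδ, hδU⟩ := hleb
  obtain ⟨δ', hδ', hδ''⟩ := ENNReal.lt_iff_exists_nnreal_btwn.1 hδ
  refine ⟨δ', J₀ + L₀ * δ' + J₀, by exact_mod_cast hδ', fun c a b hab hc hl => ?_⟩
  obtain ⟨k, hk⟩ := hδU (c a).2
  have hmem : ∀ s ∈ Icc a b, (c s).2 ∈ U k := fun s hs => by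
    refine hk (lt_of_le_of_lt ?_ hδ'')
    refine (metricEDist_snd_le g _ _).trans (le_trans ?_ hl)
    exact (Bundle.RiemannianMetric.eDist_le_length hs.1 (hc.mono (Icc_subset_Icc_right hs.2))).trans
      ((coneMetric g).length_mono c le_rfl hs.2)
  have hjump : ∀ s ∈ Icc a b, coneEDist h (F (c s)) (f.data.coneBase (α k) (c s)) ≤ J₀ := by
    intro s hs
    have h1 := (hJ (i (c s).2, k) (c s).2 ⟨subset_closure (hiU _),
      subset_closure (hmem s hs)⟩).mono (hJ₀ _) (c s).1
    rw [← hF] at h1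
    exact h1
  have hmid : coneEDist h (f.data.coneBase (α k) (c a)) (f.data.coneBase (α k) (c b)) ≤
      (L k : ℝ≥0∞) * (coneMetric g).length c a b :=
    Bundle.RiemannianMetric.eDist_comp_le_mul_length hab hc
      (fun s hs => f.data.contMDiffAt_coneBase ((hU k).2 (subset_closure (hmem s hs))))
      fun s hs v => hL k (c s) (subset_closure (hmem s hs)) v
  push_cast
  refine (coneEDist_triangle h _ (f.data.coneBase (α k) (c b)) _).trans (add_le_add
    ((coneEDist_triangle h _ (f.data.coneBase (α k) (c a)) _).trans (add_le_add
      (hjump a (left_mem_Icc.2 hab)) (hmid.trans ?_))) ?_)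
  · exact mul_le_mul' (by exact_mod_cast hL₀ k) hl
  · rw [coneEDist_comm]
    exact hjump b (right_mem_Icc.2 hab)

/-- Induced maps of cones are bornologous. -/
theorem IsInduced.exists_coneEDist_map_le {f : LeafMap M N} {F : M.Cone → N.Cone}
    (hF : f.IsInduced F) (g : M.Metric) (h : N.Metric) (R : ℝ≥0) :
    ∃ R' : ℝ≥0, ∀ z z', coneEDist g z z' ≤ R → coneEDist h (F z) (F z') ≤ R' := by
  obtain ⟨δ, D, hδ, hD⟩ := hF.exists_coneEDist_le_of_length_le g h
  -- Induction on the number of pieces: a path of length at least `δ` is cut where its initial piece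
  -- has length exactly `δ`, and the rest is shorter by `δ`.
  have key : ∀ (n : ℕ) (c : ℝ → M.Cone) (a b : ℝ), a ≤ b →
      ContMDiffOn 𝓘(ℝ, ℝ) M.coneI 1 c (Icc a b) →
      (coneMetric g).length c a b ≤ ((n + 1) * δ : ℝ≥0) →
        coneEDist h (F (c a)) (F (c b)) ≤ ((n + 1) * D : ℝ≥0) := by
    intro n
    induction n with
    | zero =>
      intro c a b hab hc hl
      simpa using hD c a b hab hc (by simpa using hl)
    | succ n ih =>
      intro c a b hab hc hl
      rcases le_total ((coneMetric g).length c a b) δ with h1 | h1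
      · refine (hD c a b hab hc h1).trans ?_
        rw [ENNReal.coe_le_coe]
        exact le_mul_of_one_le_left zero_le (by push_cast; exact le_add_self)
      · obtain ⟨s, hs, hs'⟩ := Bundle.RiemannianMetric.exists_length_eq
          (ne_top_of_le_ne_top ENNReal.coe_ne_top hl) hab h1
        have h2 := (coneMetric g).length_add c hs.1 hs.2
        have h3 : (coneMetric g).length c s b ≤ ((n + 1) * δ : ℝ≥0) := by
          rw [← h2, hs', Nat.cast_succ, add_mul, one_mul, add_comm, ENNReal.coe_add] at hl
          exact (ENNReal.add_le_add_iff_right ENNReal.coe_ne_top).1 hl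
        refine (coneEDist_triangle h _ (F (c s)) _).trans ((add_le_add
          (hD c a s hs.1 (hc.mono (Icc_subset_Icc_right hs.2)) hs'.le)
          (ih c s b hs.2 (hc.mono (Icc_subset_Icc_left hs.1)) h3)).trans_eq ?_)
        push_cast
        ring
  -- The distance is an infimum that need not be attained; `R + 1` leaves room for an actual path.
  obtain ⟨n, hn⟩ := exists_nat_ge ((R + 1) / δ)
  refine ⟨(n + 1) * D, fun z z' hz => ?_⟩
  obtain ⟨c, rfl, rfl, hc, hl⟩ := Bundle.RiemannianMetric.exists_length_lt
    (R := coneMetric g) (r := (R + 1 : ℝ≥0)) (lt_of_le_of_lt hz (by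
      rw [ENNReal.coe_lt_coe]
      exact lt_add_one R))
  refine key n c 0 1 zero_le_one hc (hl.le.trans ?_)
  rw [ENNReal.coe_le_coe]
  rw [div_le_iff₀ hδ] at hn
  exact hn.trans (mul_le_mul_left (le_add_right le_rfl) _)

/-- `F` is Borel because it is piecewise continuous on finitely many Borel pieces, and proper
because it keeps heights: relatively compact sets have bounded height, and sets of bounded height in
the cone over `M` are relatively compact. -/
theorem IsInduced.isCoarseBorel {f : LeafMap M N} {F : M.Cone → N.Cone} (hF : f.IsInduced F)
    (g : M.Metric) (h : N.Metric) :
    CoarseSpace.IsCoarseBorel (foliatedCone g) (foliatedCone h) F := by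
  refine ⟨?_, ?_, ?_⟩
  · obtain ⟨m, U, α, i, hU, hi, hiU, hF⟩ := hF
    have hUα : ∀ k, U k ⊆ f.data.Ω (α k) := fun k => subset_closure.trans (hU k).2
    have hi' : @Measurable M.Cone (Fin m) (borel M.Cone) ⊤ fun z => i z.2 :=
      @Measurable.comp _ _ _ (borel M.Cone) (borel M) ⊤ _ _ hi continuous_snd.borel_measurable
    have h1 := measurable_borel_of_pieces (X := M.Cone) (Y := N.Cone)
      (U := fun k => Prod.snd ⁻¹' U k) (fun k => (hU k).1.preimage continuous_snd)
      (c := fun k => f.data.coneBase (α k))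
      (fun k => continuousOn_fst.prodMk (((f.data.continuousOn_base (α k)).mono (hUα k)).comp
        continuousOn_snd fun z hz => hz)) hi' fun z => hiU z.2
    have h2 : (fun z : M.Cone => f.data.coneBase (α (i z.2)) z) = F :=
      funext fun z => (hF z.1 z.2).symm
    rw [h2] at h1
    exact h1
  · rintro E ⟨R, hR⟩
    obtain ⟨R', hR'⟩ := hF.exists_coneEDist_map_le g h R
    refine ⟨R', ?_⟩
    rintro _ ⟨p, hp, rfl⟩
    exact hR' _ _ (hR p hp)
  · intro K hK
    change IsCompact (closure (F ⁻¹' (K : Set N.Cone)))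
    have hK' : IsCompact (closure (K : Set N.Cone)) := hK
    have hcont : Continuous fun z : N.Cone => z.1.1 0 :=
      isInducing_height.continuous.comp continuous_fst
    obtain ⟨r, hr⟩ := (hK'.image hcont).bddAbove
    have hcont' : Continuous fun z : M.Cone => z.1.1 0 :=
      isInducing_height.continuous.comp continuous_fst
    refine (isCompact_height_le M r).of_isClosed_subset isClosed_closure
      (closure_minimal (fun z hz => ?_) (isClosed_le hcont' continuous_const))
    obtain ⟨m, U, α, i, hU, hi, hiU, hF⟩ := hF
    have h1 : (F z).1.1 0 ≤ r := hr ⟨F z, subset_closure hz, rfl⟩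
    rwa [show F z = _ from hF z.1 z.2] at h1

end LeafMap

end CompactFoliation

namespace CompactFoliation

variable {M N P : CompactFoliation.{u}}

/-! ### The foliated cone functor -/

/-- The morphism of coarse spaces given by a map of cones which is induced by `f`. -/
noncomputable def LeafMap.coneHom (g : ∀ M : CompactFoliation.{u}, M.Metric) (f : LeafMap M N) :
    foliatedCone (g M) ⟶ foliatedCone (g N) :=
  CoarseSpace.toHom f.exists_isInduced.choose
    (f.exists_isInduced.choose_spec.isCoarseBorel (g M) (g N))

theorem LeafMap.IsInduced.coneHom_eq {f : LeafMap M N} {F : M.Cone → N.Cone}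
    (hF : f.IsInduced F) (g : ∀ M : CompactFoliation.{u}, M.Metric) :
    f.coneHom g = CoarseSpace.toHom (X := foliatedCone (g M)) (Y := foliatedCone (g N)) F
      (hF.isCoarseBorel (g M) (g N)) := by
  obtain ⟨J, hJ⟩ := f.exists_isInduced.choose_spec.exists_coneEDist_le hF (g N)
  refine Quotient.sound ⟨J, ?_⟩
  rintro _ ⟨z, rfl⟩
  exact hJ z

/-- Maps induced by `f` and by `f'` are both induced by the map `G` that restricts to `f` and `f'`,
hence close to each other. -/
theorem LeafMap.IsEquivalent.coneHom_eq {f f' : LeafMap M N} (h : f.IsEquivalent f')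
    (g : ∀ M : CompactFoliation.{u}, M.Metric) : f.coneHom g = f'.coneHom g := by
  obtain ⟨G, h, h'⟩ := h
  obtain ⟨F, hF⟩ := f.exists_isInduced
  obtain ⟨F', hF'⟩ := f'.exists_isInduced
  rw [hF.coneHom_eq, hF'.coneHom_eq, ← (hF.of_isRestriction h).coneHom_eq,
    ← (hF'.of_isRestriction h').coneHom_eq]

/-- The foliated cone functor. -/
noncomputable def coneFunctor (g : ∀ M : CompactFoliation.{u}, M.Metric) :
    CompactFoliation.{u} ⥤ MetrizableCoarseSpace.{u} where
  obj M := ⟨foliatedCone (g M), isMetrizable_foliatedCone (g M)⟩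
  map f := ObjectProperty.homMk (Quot.lift (LeafMap.coneHom g) (fun _ _ h => h.coneHom_eq g) f)
  map_id M := ObjectProperty.hom_ext _ ((LeafMap.isInduced_id M).coneHom_eq g)
  map_comp := by
    rintro M N P ⟨f⟩ ⟨f'⟩
    refine ObjectProperty.hom_ext _ ?_
    exact (f.exists_isInduced.choose_spec.comp f'.exists_isInduced.choose_spec).coneHom_eq g

end CompactFoliation

theorem theorem3p3 :
    (∀ M N : CompactFoliation.{u},
      Equivalence (CompactFoliation.LeafMap.IsEquivalent (M := M) (N := N))) ∧
    (∀ (M : CompactFoliation.{u}) (g g' : M.Metric),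
      CompactFoliation.foliatedCone g = CompactFoliation.foliatedCone g') ∧
    (∀ (M : CompactFoliation.{u}) (g : M.Metric), ConnectedSpace M →
      ∀ z z' : M.Cone, CompactFoliation.coneEDist g z z' < ⊤) ∧
    (∀ (M N : CompactFoliation.{u}) (f : CompactFoliation.LeafMap M N),
      ∃ F : M.Cone → N.Cone, f.IsInduced F) ∧
    ∀ g : (∀ M : CompactFoliation.{u}, M.Metric),
      ∃ (O : CompactFoliation.{u} ⥤ MetrizableCoarseSpace.{u})
        (hO : ∀ M, (O.obj M).obj = CompactFoliation.foliatedCone (g M)),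
        ∀ (M N : CompactFoliation.{u}) (f : CompactFoliation.LeafMap M N) (F : M.Cone → N.Cone),
          f.IsInduced F →
            ∃ hF : CoarseSpace.IsCoarseBorel (CompactFoliation.foliatedCone (g M))
                (CompactFoliation.foliatedCone (g N)) F,
              (O.map f.toHom).hom =
                eqToHom (hO M) ≫
                  CoarseSpace.toHom (X := CompactFoliation.foliatedCone (g M))
                    (Y := CompactFoliation.foliatedCone (g N)) F hF ≫ eqToHom (hO N).symm := by
  refine ⟨CompactFoliation.LeafMap.equivalence_isEquivalent,
    fun M g g' => CompactFoliation.foliatedCone_eq g g',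
    fun M g _ z z' => CompactFoliation.coneEDist_lt_top g z z',
    fun M N f => f.exists_isInduced, fun g => ⟨CompactFoliation.coneFunctor g, fun _ => rfl,
      fun M N f F hF => ⟨hF.isCoarseBorel (g M) (g N), ?_⟩⟩⟩
  -- The equality of objects holds by definition, so both `eqToHom` are identities.
  exact (hF.coneHom_eq g).trans ((Category.id_comp _).trans (Category.comp_id _)).symm
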